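/- Let $d\ge 2$ and $1<p<\infty$, let $\mathbb T^d=(\mathbb R/\mathbb Z)^d$ with its Lebesgue measure of total mass $1$, and let $$L^p_+(\mathbb T^d)=\{\rho\in L^p(\mathbb T^d):\ \rho\ge 0\text{ a.e.},\ \|\rho\|_{L^1}>0\}.$$ For every $\rho\in L^p_+(\mathbb T^d)$ the Poisson–Boltzmann equation $-\Delta\Phi=\rho-e^{\Phi}$ has a unique solution $\Phi=\Phi[\rho]\in W^{1,2}(\mathbb T^d)$; a solution is a $\Phi\in W^{1,2}(\mathbb T^d)$ with $e^\Phi\in L^1(\mathbb T^d)$ that satisfies $\int\nabla\Phi\cdot\nabla\varphi\,dx=\int(\rho-e^\Phi)\varphi\,dx$ for all $\varphi\in C^\infty(\mathbb T^d)$. Moreover: (i) $\|e^{\Phi[\rho]}\|_{L^r}\le\|\rho\|_{L^r}$ for all $\rho\in L^p_+(\mathbb T^d)$ and $r\in[1,p]$, with equality when $r=1$. (ii) If $\rho_n,\rho\in L^p_+(\mathbb T^d)$ and $\rho_n\rightharpoonup\rho$ weakly in $L^p$, then $\nabla\Phi[\rho_n]\rightharpoonup\nabla\Phi[\rho]$ weakly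 in $L^2$ and $e^{\Phi[\rho_n]}\rightharpoonup e^{\Phi[\rho]}$ weakly in $L^p$. (iii) For every $\rho\in L^p_+(\mathbb T^d)$ one has $e^{\Phi[\rho]}\ge c_\rho>0$ a.e., where $c_\rho$ depends only on $d$, $p$, $\|\rho\|_{L^p}$ and $\|\rho\|_{L^1}$; and $\Phi[\rho]\in L^q(\mathbb T^d)$ for every $q\in[1,\infty)$. (iv) For all $\rho_1,\rho_2\in L^p_+(\mathbb T^d)$ and $q\in[1,\infty)$, $$\|\nabla\Phi[\rho_1]-\nabla\Phi[\rho_2]\|_{L^2}^2+\lambda\,\|\Phi[\rho_1]-\Phi[\rho_2]\|_{L^q}^{\frac{2q}{\min\{q,2\}}}\le\Lambda\,\|\rho_1-\rho_2\|_{L^p}^{\frac{2p}{\max\{p,2\}}},$$ where $\lambda,\Lambda>0$ depend only on $d,p,q$ and on $\|\rho_i\|_{L^1},\|\rho_i\|_{L^p}$, $i=1,2$. (v) The functionals $$\mathcal P[\rho]=\int_{\mathbb T^d}\tfrac12|\nabla\Phi[\rho]|^2\,dx,\qquad \mathcal S[\rho]=\int_{\mathbb T^d}\bigl(e^{\Phi[\rho]}(\Phi[\rho]-1)+1\bigr)\,dx$$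 are finite on $L^p_+(\mathbb T^d)$. If $\rho_n,\rho\in L^p_+(\mathbb T^d)$ and $\rho_n\to\rho$ strongly in $L^p$, then $\mathcal P[\rho_n]\to\mathcal P[\rho]$ and $\mathcal S[\rho_n]\to\mathcal S[\rho]$. If $\rho_n\rightharpoonup\rho$ weakly in $L^p$, then $\mathcal P[\rho]\le\liminf_n\mathcal P[\rho_n]$ and $\mathcal S[\rho]\le\liminf_n\mathcal S[\rho_n]$. -/

import Mathlib

open MeasureTheory Filter Topology
open scoped ENNReal ContDiff

noncomputable section

/-- The flat torus `𝕋ᵈ = (ℝ/ℤ)ᵈ`.  Its `volume` is the product of the Lebesgue measures of total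
mass one on the circles. -/
abbrev Torus (d : ℕ) : Type := UnitAddTorus (Fin d)

/-- The Euclidean space in which gradients take their values. -/
abbrev Vec (d : ℕ) : Type := EuclideanSpace ℝ (Fin d)

/-- `φ ∈ C^∞(𝕋ᵈ)`: the `ℤᵈ`-periodic lift of `φ` to `ℝᵈ` is smooth. -/
def TorusSmooth {d : ℕ} (φ : Torus d → ℝ) : Prop :=
  ContDiff ℝ ∞ (fun y : Fin d → ℝ => φ (fun i => (y i : UnitAddCircle)))

/-- The classical gradient of a smooth function on the torus: the `i`-th component is the
derivative at `t = 0` of `t ↦ φ (x + t eᵢ)`. -/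
def torusGrad {d : ℕ} (φ : Torus d → ℝ) (x : Torus d) : Vec d :=
  WithLp.toLp 2 (fun i => deriv (fun t : ℝ => φ (x + Pi.single i (t : UnitAddCircle))) 0)

/-- `G` is a weak (distributional) gradient of `u` on the torus and is square integrable. -/
def IsL2WeakGrad {d : ℕ} (u : Torus d → ℝ) (G : Torus d → Vec d) : Prop :=
  MemLp G 2 volume ∧
    ∀ φ : Torus d → ℝ, TorusSmooth φ → ∀ i : Fin d,
      ∫ x, u x * torusGrad φ x i = - ∫ x, G x i * φ x

/-- The Sobolev space `W^{1,2}(𝕋ᵈ)`. -/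
def MemW12 {d : ℕ} (u : Torus d → ℝ) : Prop :=
  MemLp u 2 volume ∧ ∃ G : Torus d → Vec d, IsL2WeakGrad u G

open Classical in
/-- The weak gradient `∇u` of `u ∈ W^{1,2}(𝕋ᵈ)` (it is unique up to a null set). -/
def weakGrad {d : ℕ} (u : Torus d → ℝ) : Torus d → Vec d :=
  if h : ∃ G : Torus d → Vec d, IsL2WeakGrad u G then h.choose else 0

/-- `ρ ∈ L^p_+(𝕋ᵈ)`: `ρ ∈ L^p`, `ρ ≥ 0` almost everywhere and `‖ρ‖_{L¹} > 0`. -/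
def MemLpPlus {d : ℕ} (p : ℝ) (ρ : Torus d → ℝ) : Prop :=
  MemLp ρ (ENNReal.ofReal p) volume ∧ (∀ᵐ x, 0 ≤ ρ x) ∧ 0 < lpNorm ρ 1 volume

/-- `Φ ∈ W^{1,2}(𝕋ᵈ)` solves `-ΔΦ = ρ - e^Φ` in the sense of distributions.  Integrability of
`e^Φ` is what makes the right-hand side a distribution. -/
def IsPBSolution {d : ℕ} (ρ Φ : Torus d → ℝ) : Prop :=
  MemW12 Φ ∧ Integrable (fun x => Real.exp (Φ x)) ∧
    ∀ φ : Torus d → ℝ, TorusSmooth φ →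
      ∫ x, inner ℝ (weakGrad Φ x) (torusGrad φ x) = ∫ x, (ρ x - Real.exp (Φ x)) * φ x

open Classical in
/-- The solution `Φ[ρ]` of the Poisson–Boltzmann equation with density `ρ`. -/
def pbPotential {d : ℕ} (ρ : Torus d → ℝ) : Torus d → ℝ :=
  if h : ∃ Φ : Torus d → ℝ, IsPBSolution ρ Φ then h.choose else 0

/-- Weak convergence `f n ⇀ g` in `L^p(𝕋ᵈ; E)`, `1 < p < ∞`: all the functions are in `L^p`, and
the pairings with every function in `L^{p'}`, `p' = p / (p - 1)`, converge. -/
def WeakLpTendsto {d : ℕ} {E : Type*} [NormedAddCommGroup E] [InnerProductSpace ℝ E] (p : ℝ)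
    (f : ℕ → Torus d → E) (g : Torus d → E) : Prop :=
  (∀ n, MemLp (f n) (ENNReal.ofReal p) volume) ∧ MemLp g (ENNReal.ofReal p) volume ∧
    ∀ h : Torus d → E, MemLp h (ENNReal.ofReal (p / (p - 1))) volume →
      Tendsto (fun n => ∫ x, inner ℝ (f n x) (h x)) atTop (𝓝 (∫ x, inner ℝ (g x) (h x)))

/-- Strong convergence `f n → g` in `L^p(𝕋ᵈ)`. -/
def StrongLpTendsto {d : ℕ} (p : ℝ) (f : ℕ → Torus d → ℝ) (g : Torus d → ℝ) : Prop :=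
  (∀ n, MemLp (f n) (ENNReal.ofReal p) volume) ∧ MemLp g (ENNReal.ofReal p) volume ∧
    Tendsto (fun n => eLpNorm (f n - g) (ENNReal.ofReal p) volume) atTop (𝓝 0)

/-- The potential energy `𝒫[ρ] = ∫ ½ |∇Φ[ρ]|²`. -/
def potentialEnergy {d : ℕ} (ρ : Torus d → ℝ) : ℝ :=
  ∫ x, (1 / 2 : ℝ) * ‖weakGrad (pbPotential ρ) x‖ ^ 2

/-- The density `e^Φ (Φ - 1) + 1`, `Φ = Φ[ρ]`, of the electron entropy. -/
def entropyDensity {d : ℕ} (ρ : Torus d → ℝ) (x : Torus d) : ℝ :=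
  Real.exp (pbPotential ρ x) * (pbPotential ρ x - 1) + 1

/-- The electron entropy `𝒮[ρ] = ∫ (e^Φ (Φ - 1) + 1)`, `Φ = Φ[ρ]`. -/
def electronEntropy {d : ℕ} (ρ : Torus d → ℝ) : ℝ :=
  ∫ x, entropyDensity ρ x

end

/-!
The proof works with Fourier coefficients throughout.  A function `u ∈ L²` on the torus is in
`W^{1,2}` exactly when `∑ 4π²|k|² |û(k)|²` converges, this sum is `∫ |∇u|²`, and the equation
`-Δu = f` reads `4π²|k|² û(k) = f̂(k)` (`memW12_iff`, `IsL2WeakGrad.integral_inner`,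
`isPBSolution_iff`).  No Sobolev embedding is used.

*Comparison.*  The Dirichlet form is the limit of difference quotient forms
`∑ᵢ h⁻² ∫ (u(x + h eᵢ) - u(x)) (v(x + h eᵢ) - v(x)) dx`, so pointwise inequalities between products
of increments pass to it (`energy_le_energy`).  Testing with truncations gives the comparison
principle, for right-hand sides in `L¹` because bounded `W^{1,2}` functions are admissible test
functions (`SolvesPoisson.energy_eq_of_bounded`, by smoothing with powers of the resolvent).
Uniqueness, and the monotonicity of `Φ[ρ]` in `ρ`, follow from the monotonicity of the exponential
(`SolvesPB.mono`).

*Existence and bounds.*  For `f` bounded of mean zero, `-Δw = f` has a bounded solution: with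
`R = (1 - Δ)⁻¹`, a contraction of `L^∞`, one has `w = R f + ⋯ + R^d f + R^d w`, and `R^d w` has an
absolutely convergent Fourier series (`exists_bounded_poisson`).  For `0 ≤ ρ ≤ K` this produces a
bounded subsolution, `log K` is a supersolution, and monotone iteration solves the equation
(`exists_solvesPB_of_bounded`).  For `ρ ∈ L^p_+` the solutions for `min ρ n` increase; the test
function `e^{(r-1)Φ}` and Young's inequality bound their exponential moments by those of `ρ`, and
the limit solves the equation (`exists_solvesPB`).  The potential is bounded below by the solution
for a single truncation of `ρ`, which carries at least half of the mass at a level determined by the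
norms of `ρ`.

*Strong stability.*  Testing the equation of `u = Φ₁ - Φ₂` with `u` gives
`∫ |∇u|² + ∫ (e^{Φ₁} - e^{Φ₂}) u ≤ ∫ (ρ₁ - ρ₂) u`.  Since both potentials are bounded below, the
second integral controls `∫ |u|^t` for every `t ≥ 2` (`exists_exp_coercive`), and Young's inequality
absorbs the right-hand side (`exists_strong_stability`).

*Weak stability.*  If `ρₙ ⇀ ρ`, then `uₙ = Φ[ρₙ] - Φ[ρ]` is bounded in `W^{1,2}` and in every `L^t`.
Truncating and smoothing `uₙ` reduces `∫ (ρₙ - ρ) uₙ` to absolutely summable Fourier series, so this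
integral tends to zero without any convergence of `uₙ` being known
(`tendsto_integral_mul_of_bounded_energy`).  The energy inequality then yields `∇uₙ → 0` in `L²` and
`uₙ → 0` in every `L^t` (`RegularPB.weak_stability`), and the equation yields the weak
convergence of `e^{Φ[ρₙ]}`.  Consequently `𝒫` and `𝒮` are even continuous under weak convergence.
-/

noncomputable section

open UnitAddTorus
open scoped ComplexConjugate

variable {d : ℕ}

/-! ### Fourier coefficients on the torus -/

instance torus_isProbabilityMeasure : IsProbabilityMeasure (volume : Measure (Torus d)) := by
  constructor
  rw [← Set.pi_univ (Set.univ : Set (Fin d)), volume_pi, Measure.pi_pi]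
  simp

/-- The Fourier coefficient `∫ u e_{-k}` of a real function on the torus.  It replaces
`mFourierCoeff`, which refers to another `MeasureSpace` instance on the circle. -/
def fc (u : Torus d → ℝ) (k : Fin d → ℤ) : ℂ := ∫ x, (u x : ℂ) * mFourier (-k) x

lemma norm_mFourier_apply (k : Fin d → ℤ) (x : Torus d) : ‖mFourier k x‖ = 1 := by
  simp only [mFourier, ContinuousMap.coe_mk, norm_prod, fourier_apply, Circle.norm_coe,
    Finset.prod_const_one]

lemma integrable_mul_mFourier {u : Torus d → ℝ} (hu : Integrable u) (k : Fin d → ℤ) :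
    Integrable (fun x => (u x : ℂ) * mFourier k x) := by
  refine hu.ofReal.mul_bdd (c := 1) ?_ ?_
  · exact (mFourier k).continuous.aestronglyMeasurable
  · exact Eventually.of_forall fun x => (norm_mFourier_apply k x).le

lemma fc_congr {u v : Torus d → ℝ} (h : u =ᵐ[volume] v) (k : Fin d → ℤ) : fc u k = fc v k := by
  apply integral_congr_ae
  filter_upwards [h] with x hx
  rw [hx]

lemma fc_sub {u v : Torus d → ℝ} (hu : Integrable u) (hv : Integrable v) (k : Fin d → ℤ) :
    fc (fun x => u x - v x) k = fc u k - fc v k := by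
  unfold fc
  rw [← integral_sub (integrable_mul_mFourier hu _) (integrable_mul_mFourier hv _)]
  congr 1; ext x; push_cast; ring

lemma fc_const_mul (c : ℝ) (u : Torus d → ℝ) (k : Fin d → ℤ) :
    fc (fun x => c * u x) k = c * fc u k := by
  unfold fc
  rw [← integral_const_mul]
  congr 1; ext x; push_cast; ring

lemma fc_zero_fun (k : Fin d → ℤ) : fc (fun _ : Torus d => (0 : ℝ)) k = 0 := by
  simp [fc]

lemma fc_neg_index (u : Torus d → ℝ) (k : Fin d → ℤ) : fc u (-k) = conj (fc u k) := by
  unfold fc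
  rw [← integral_conj]
  congr 1; ext x
  rw [map_mul, Complex.conj_ofReal, mFourier_neg (n := -k)]

lemma norm_fc_le {u : Torus d → ℝ} (k : Fin d → ℤ) : ‖fc u k‖ ≤ ∫ x, |u x| := by
  refine (norm_integral_le_integral_norm _).trans (le_of_eq ?_)
  congr 1; ext x
  rw [norm_mul, norm_mFourier_apply, mul_one, Complex.norm_real, Real.norm_eq_abs]

lemma fc_zero_index (u : Torus d → ℝ) : fc u 0 = ((∫ x, u x : ℝ) : ℂ) := by
  unfold fc
  rw [← integral_complex_ofReal]
  congr 1; ext x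
  simp [mFourier_zero]

/-- `e_k (x + y) = e_k(x) e_k(y)`. -/
lemma mFourier_apply_add (k : Fin d → ℤ) (x y : Torus d) :
    mFourier k (x + y) = mFourier k x * mFourier k y := by
  simp [mFourier, fourier_apply, Finset.prod_mul_distrib, AddCircle.toCircle_add, smul_add]

lemma fc_translate (u : Torus d → ℝ) (a : Torus d) (k : Fin d → ℤ) :
    fc (fun x => u (x + a)) k = mFourier k a * fc u k := by
  unfold fc
  rw [← integral_add_right_eq_self (μ := (volume : Measure (Torus d)))
      (fun x => (u x : ℂ) * mFourier (-k) x) a,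
    ← integral_const_mul]
  congr 1; ext x
  rw [mFourier_apply_add, mFourier_neg (n := k) (x := a)]
  have : mFourier k a * conj (mFourier k a) = 1 := by
    rw [Complex.mul_conj, Complex.normSq_eq_norm_sq, norm_mFourier_apply]; simp
  linear_combination (-(u (x + a) : ℂ) * mFourier (-k) x) * this

lemma mFourier_single_coe (k : Fin d → ℤ) (i : Fin d) (t : ℝ) :
    mFourier k (Pi.single i (t : UnitAddCircle))
      = Complex.exp (2 * Real.pi * Complex.I * k i * t) := by
  simp only [mFourier, ContinuousMap.coe_mk]
  rw [Finset.prod_eq_single i]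
  · rw [Pi.single_eq_same, fourier_coe_apply]; simp
  · intro j _ hj
    rw [Pi.single_eq_of_ne hj, fourier_eval_zero]
  · simp

lemma integral_mFourier (k : Fin d → ℤ) (hk : k ≠ 0) : ∫ x : Torus d, mFourier k x = 0 := by
  obtain ⟨i, hi⟩ := Function.ne_iff.mp hk
  have hi : (k i : ℂ) ≠ 0 := by exact_mod_cast hi
  set a : Torus d := Pi.single i ((1 / (2 * (k i : ℝ)) : ℝ) : UnitAddCircle)
  have ha : mFourier k a = -1 := by
    rw [mFourier_single_coe, ← Complex.exp_pi_mul_I]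
    congr 1; push_cast; field_simp
  have h := integral_add_right_eq_self (μ := (volume : Measure (Torus d))) (fun x => mFourier k x) a
  simp_rw [mFourier_apply_add, ha, mul_neg_one, integral_neg] at h
  have h2 : (2 : ℂ) * ∫ x : Torus d, mFourier k x = 0 := by linear_combination -h
  simpa using h2

/-- The characters as elements of the complex `L²` space. -/
abbrev charLp (k : Fin d → ℤ) : Lp ℂ 2 (volume : Measure (Torus d)) :=
  ContinuousMap.toLp (E := ℂ) 2 volume ℂ (mFourier k)

lemma orthonormal_charLp : Orthonormal ℂ (charLp (d := d)) := by
  rw [orthonormal_iff_ite]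
  intro m n
  simp only [ContinuousMap.inner_toLp, ← mFourier_neg, ← mFourier_add]
  split_ifs with h
  · simp [h, mFourier_zero]
  · apply integral_mFourier
    intro h0
    exact h (by rw [← sub_eq_zero, ← neg_eq_zero]; rw [← h0]; abel)

lemma span_charLp_dense :
    (Submodule.span ℂ (Set.range (charLp (d := d)))).topologicalClosure = ⊤ := by
  simpa only [Submodule.map_span, ContinuousLinearMap.coe_coe, ← Set.range_comp, Function.comp_def]
    using (ContinuousMap.toLp_denseRange ℂ (volume : Measure (Torus d)) ℂ
      (by simp)).topologicalClosure_map_submodule (span_mFourier_closure_eq_top (d := Fin d))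

/-- The characters form a Hilbert basis of complex `L²`. -/
def charBasis : HilbertBasis (Fin d → ℤ) ℂ (Lp ℂ 2 (volume : Measure (Torus d))) :=
  HilbertBasis.mk orthonormal_charLp span_charLp_dense.ge

lemma charBasis_repr (f : Lp ℂ 2 (volume : Measure (Torus d))) (k : Fin d → ℤ) :
    charBasis.repr f k = ∫ x, f x * mFourier (-k) x := by
  rw [charBasis.repr_apply_apply f k, L2.inner_def, charBasis, HilbertBasis.coe_mk]
  apply integral_congr_ae
  filter_upwards [ContinuousMap.coeFn_toLp (p := 2) (𝕜 := ℂ) volume (mFourier k)] with x hx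
  rw [hx, RCLike.inner_apply, mFourier_neg]

/-- A real `L²` function as an element of complex `L²`. -/
def toL2 (u : Torus d → ℝ) (hu : MemLp u 2) : Lp ℂ 2 (volume : Measure (Torus d)) :=
  (hu.ofReal (K := ℂ)).toLp _

lemma coe_toL2 {u : Torus d → ℝ} (hu : MemLp u 2) : toL2 u hu =ᵐ[volume] fun x => (u x : ℂ) :=
  MemLp.coeFn_toLp _

lemma repr_toL2 {u : Torus d → ℝ} (hu : MemLp u 2) (k : Fin d → ℤ) :
    charBasis.repr (toL2 u hu) k = fc u k := by
  rw [charBasis_repr]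
  apply integral_congr_ae
  filter_upwards [coe_toL2 hu] with x hx
  rw [hx]

/-- Parseval's identity for real functions. -/
lemma hasSum_fc_mul {u v : Torus d → ℝ} (hu : MemLp u 2) (hv : MemLp v 2) :
    HasSum (fun k => (fc u k * conj (fc v k)).re) (∫ x, u x * v x) := by
  have h := charBasis.hasSum_inner_mul_inner (toL2 v hv) (toL2 u hu)
  have h2 := Complex.hasSum_re h
  convert h2 using 1
  · ext k
    rw [← charBasis.repr_apply_apply, repr_toL2, ← inner_conj_symm, ← charBasis.repr_apply_apply,
      repr_toL2, mul_comm]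
  · rw [L2.inner_def]
    have : (∫ x, inner ℂ (toL2 v hv x) (toL2 u hu x)) = ((∫ x, u x * v x : ℝ) : ℂ) := by
      rw [← integral_complex_ofReal]
      apply integral_congr_ae
      filter_upwards [coe_toL2 hu, coe_toL2 hv] with x h1 h2
      rw [h1, h2]; simp
    rw [this, Complex.ofReal_re]

lemma mul_conj_re_self (z : ℂ) : (z * conj z).re = ‖z‖ ^ 2 := by
  rw [Complex.mul_conj, Complex.normSq_eq_norm_sq, Complex.ofReal_re]

lemma hasSum_norm_fc_sq {u : Torus d → ℝ} (hu : MemLp u 2) :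
    HasSum (fun k => ‖fc u k‖ ^ 2) (∫ x, u x ^ 2) := by
  have := hasSum_fc_mul hu hu
  simpa only [mul_conj_re_self, ← sq] using this

/-- **Riesz–Fischer** for real functions: every square summable family with the symmetry
`c (-k) = conj (c k)` is the family of Fourier coefficients of a real `L²` function. -/
lemma exists_fc_eq (c : (Fin d → ℤ) → ℂ) (hc : Summable fun k => ‖c k‖ ^ 2)
    (hsym : ∀ k, c (-k) = conj (c k)) :
    ∃ u : Torus d → ℝ, MemLp u 2 ∧ ∀ k, fc u k = c k := by
  have hm : Memℓp c 2 := by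
    rw [memℓp_gen_iff (by simp)]
    simpa using hc
  set F : Lp ℂ 2 (volume : Measure (Torus d)) := charBasis.repr.symm ⟨c, hm⟩ with hF
  have hFc : ∀ k, ∫ x, F x * mFourier (-k) x = c k := by
    intro k
    rw [← charBasis_repr, hF, LinearIsometryEquiv.apply_symm_apply]
  have hF2 : MemLp F 2 volume := Lp.memLp F
  have hFi : Integrable F := hF2.integrable (by simp)
  refine ⟨fun x => (F x).re, hF2.re, fun k => ?_⟩
  have hre : ∀ x, (((F x).re : ℝ) : ℂ) * mFourier (-k) x
      = (1 / 2) * (F x * mFourier (-k) x) + (1 / 2) * conj (F x * mFourier (- -k) x) := by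
    intro x
    rw [Complex.re_eq_add_conj, map_mul, mFourier_neg (n := -k), Complex.conj_conj]
    ring
  have hi : ∀ k, Integrable (fun x => F x * mFourier k x) := fun k =>
    hFi.mul_bdd (c := 1) (mFourier k).continuous.aestronglyMeasurable
      (Eventually.of_forall fun x => (norm_mFourier_apply k x).le)
  have hi2 : Integrable (fun x => conj (F x * mFourier (- -k) x)) :=
    (LinearIsometryEquiv.integrable_comp_iff Complex.conjLIE).2 (hi _)
  unfold fc
  simp_rw [hre]
  rw [integral_add ((hi _).const_mul _) (hi2.const_mul _), integral_const_mul, integral_const_mul,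
    integral_conj, hFc, hFc, hsym, Complex.conj_conj]
  ring

/-- The eigenvalue `4π²|k|²` of `-Δ`. -/
def lam (k : Fin d → ℤ) : ℝ := 4 * Real.pi ^ 2 * ∑ i, (k i : ℝ) ^ 2

lemma lam_nonneg (k : Fin d → ℤ) : 0 ≤ lam k := by unfold lam; positivity

lemma lam_neg (k : Fin d → ℤ) : lam (-k) = lam k := by simp [lam]

lemma lam_zero : lam (0 : Fin d → ℤ) = 0 := by simp [lam]

lemma one_le_lam {k : Fin d → ℤ} (hk : k ≠ 0) : 1 ≤ lam k := by
  obtain ⟨i, hi⟩ := Function.ne_iff.mp hk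
  have h1 : (1 : ℝ) ≤ (k i : ℝ) ^ 2 := by
    have : (1 : ℤ) ≤ (k i) ^ 2 := by
      have hi' : k i ≠ 0 := hi
      have : 0 < (k i) ^ 2 := by positivity
      omega
    exact_mod_cast this
  have h2 : (k i : ℝ) ^ 2 ≤ ∑ j, (k j : ℝ) ^ 2 :=
    Finset.single_le_sum (f := fun j => (k j : ℝ) ^ 2) (fun j _ => sq_nonneg _) (Finset.mem_univ i)
  have h3 : (1 : ℝ) ≤ 4 * Real.pi ^ 2 := by nlinarith [Real.pi_gt_three]
  unfold lam
  nlinarith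

lemma summable_inv_one_add_int_sq : Summable fun n : ℤ => (1 + (n : ℝ) ^ 2)⁻¹ := by
  have h1 : Summable fun n : ℤ => 1 / (n : ℝ) ^ 2 := Real.summable_one_div_int_pow.2 (by norm_num)
  have h2 : Summable fun n : ℤ => if n = 0 then (1 : ℝ) else 0 :=
    summable_of_ne_finset_zero (s := {0}) (by intro b hb; simp at hb; simp [hb])
  refine Summable.of_nonneg_of_le (fun n => by positivity) (fun n => ?_) (h1.add h2)
  by_cases hn : n = 0
  · simp [hn]
  · have : (0 : ℝ) < (n : ℝ) ^ 2 := by positivity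
    simp only [hn, if_false, add_zero, one_div]
    gcongr
    linarith

lemma summable_prod_inv (d : ℕ) :
    Summable fun k : Fin d → ℤ => ∏ i, (1 + (k i : ℝ) ^ 2)⁻¹ := by
  classical
  refine summable_of_sum_le (c := ∏ _i : Fin d, ∑' n : ℤ, (1 + (n : ℝ) ^ 2)⁻¹)
    (fun k => by positivity) (fun s => ?_)
  calc ∑ k ∈ s, ∏ i, (1 + (k i : ℝ) ^ 2)⁻¹
      ≤ ∑ k ∈ Fintype.piFinset (fun i => s.image (fun k : Fin d → ℤ => k i)),
          ∏ i, (1 + (k i : ℝ) ^ 2)⁻¹ := by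
        apply Finset.sum_le_sum_of_subset_of_nonneg
        · intro k hk
          rw [Fintype.mem_piFinset]
          exact fun i => Finset.mem_image_of_mem _ hk
        · intros; positivity
    _ = ∏ i, ∑ n ∈ s.image (fun k : Fin d → ℤ => k i), (1 + (n : ℝ) ^ 2)⁻¹ :=
        (Finset.prod_univ_sum (fun i => s.image (fun k => k i))
          (fun _ (n : ℤ) => (1 + (n : ℝ) ^ 2)⁻¹)).symm
    _ ≤ _ := by
        apply Finset.prod_le_prod
        · intros; positivity
        · intro i _
          exact summable_inv_one_add_int_sq.sum_le_tsum _ (fun n _ => by positivity)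

lemma summable_inv_one_add_lam_pow (d : ℕ) :
    Summable fun k : Fin d → ℤ => ((1 + lam k) ^ d)⁻¹ := by
  refine Summable.of_nonneg_of_le (fun k => by have := lam_nonneg k; positivity) (fun k => ?_)
    (summable_prod_inv d)
  rw [Finset.prod_inv_distrib]
  gcongr
  have h : ∏ i : Fin d, (1 + (k i : ℝ) ^ 2) ≤ ∏ _i : Fin d, (1 + lam k) := by
    refine Finset.prod_le_prod (fun i _ => by positivity) (fun i _ => ?_)
    have h2 : (k i : ℝ) ^ 2 ≤ ∑ j, (k j : ℝ) ^ 2 :=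
      Finset.single_le_sum (f := fun j => (k j : ℝ) ^ 2)
        (fun j _ => sq_nonneg _) (Finset.mem_univ i)
    have h3 : (1 : ℝ) ≤ 4 * Real.pi ^ 2 := by nlinarith [Real.pi_gt_three]
    unfold lam
    nlinarith [sq_nonneg (k i : ℝ)]
  simpa using h

lemma ae_eq_fourier_series {v : Torus d → ℝ} (hv : MemLp v 2)
    (hs : Summable fun k => ‖fc v k‖) :
    ∀ᵐ x, HasSum (fun k => fc v k * mFourier k x) (v x : ℂ) := by
  have h1 : Summable fun k => fc v k • mFourier k := by
    apply Summable.of_norm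
    simpa only [norm_smul, mFourier_norm, mul_one] using hs
  have h2 := (ContinuousMap.toLp (E := ℂ) 2 (volume : Measure (Torus d)) ℂ).hasSum h1.hasSum
  have h3 := charBasis.hasSum_repr (toL2 v hv)
  simp only [repr_toL2] at h3
  rw [charBasis, HilbertBasis.coe_mk] at h3
  simp only [map_smul] at h2
  have h4 := h2.unique h3
  have h5 := ContinuousMap.coeFn_toLp (p := 2) (𝕜 := ℂ) (volume : Measure (Torus d))
    (∑' k, fc v k • mFourier k)
  rw [h4] at h5
  filter_upwards [h5, coe_toL2 hv] with x hx hy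
  rw [← hy, hx]
  exact (ContinuousMap.evalCLM ℂ x).hasSum h1.hasSum

lemma abs_le_tsum_norm_fc {v : Torus d → ℝ} (hv : MemLp v 2)
    (hs : Summable fun k => ‖fc v k‖) : ∀ᵐ x, |v x| ≤ ∑' k, ‖fc v k‖ := by
  filter_upwards [ae_eq_fourier_series hv hs] with x hx
  rw [← Real.norm_eq_abs, ← Complex.norm_real, ← hx.tsum_eq]
  have : ∀ k, ‖fc v k * mFourier k x‖ = ‖fc v k‖ := fun k => by
    rw [norm_mul, norm_mFourier_apply, mul_one]
  refine (norm_tsum_le_tsum_norm ?_).trans (le_of_eq ?_)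
  · simpa only [this] using hs
  · simp only [this]

/-- Parseval's identity for the pairing of an integrable function with a function whose Fourier
series converges absolutely. -/
lemma hasSum_fc_mul_of_summable {f v : Torus d → ℝ} (hf : Integrable f) (hv : MemLp v 2)
    (hs : Summable fun k => ‖fc v k‖) :
    HasSum (fun k => (fc f k * conj (fc v k)).re) (∫ x, f x * v x) := by
  have hint : ∀ k, ∫ x, fc v k * ((f x : ℂ) * mFourier k x) = fc v k * conj (fc f k) := by
    intro k
    rw [integral_const_mul, ← fc_neg_index]
    simp [fc]
  have hnorm : ∀ k, ∫ x, ‖fc v k * ((f x : ℂ) * mFourier k x)‖ = ‖fc v k‖ * ∫ x, |f x| := by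
    intro k
    simp_rw [norm_mul, norm_mFourier_apply, mul_one, integral_const_mul, Complex.norm_real,
      Real.norm_eq_abs]
  have h := hasSum_integral_of_summable_integral_norm
    (F := fun k x => fc v k * ((f x : ℂ) * mFourier k x)) (μ := (volume : Measure (Torus d)))
    (fun k => (integrable_mul_mFourier hf k).const_mul _)
    (by simp_rw [hnorm]; exact hs.mul_right _)
  simp_rw [hint] at h
  have h2 : (∫ x, ∑' k, fc v k * ((f x : ℂ) * mFourier k x)) = ((∫ x, f x * v x : ℝ) : ℂ) := by
    rw [← integral_complex_ofReal]
    apply integral_congr_ae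
    filter_upwards [ae_eq_fourier_series hv hs] with x hx
    have := (hx.mul_left (f x : ℂ)).tsum_eq
    push_cast
    rw [← this]
    congr 1; ext k; ring
  rw [h2] at h
  have h3 := Complex.hasSum_re h
  rw [Complex.ofReal_re] at h3
  convert h3 using 2 with k
  simp only [Complex.mul_re, Complex.conj_re, Complex.conj_im]
  ring

/-! ### The Dirichlet form and its Markov property -/

/-- The Sobolev space `W^{1,2}` in terms of Fourier coefficients. -/
def H1 (u : Torus d → ℝ) : Prop :=
  MemLp u 2 ∧ Summable fun k => lam k * ‖fc u k‖ ^ 2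

/-- The Dirichlet form `∫ ∇u · ∇v` in terms of Fourier coefficients. -/
def energy (u v : Torus d → ℝ) : ℝ := ∑' k, lam k * (fc u k * conj (fc v k)).re

lemma energy_self (u : Torus d → ℝ) : energy u u = ∑' k, lam k * ‖fc u k‖ ^ 2 := by
  simp only [energy, mul_conj_re_self]

lemma energy_self_nonneg (u : Torus d → ℝ) : 0 ≤ energy u u := by
  rw [energy_self]
  exact tsum_nonneg fun k => mul_nonneg (lam_nonneg k) (sq_nonneg _)

lemma abs_mul_conj_re_le (z w : ℂ) : |(z * conj w).re| ≤ ‖z‖ * ‖w‖ := by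
  refine (Complex.abs_re_le_norm _).trans ?_
  rw [norm_mul, RCLike.norm_conj]

lemma H1.summable_mul {u v : Torus d → ℝ} (hu : H1 u) (hv : H1 v) :
    Summable fun k => lam k * (‖fc u k‖ * ‖fc v k‖) := by
  refine Summable.of_nonneg_of_le (fun k => mul_nonneg (lam_nonneg k) (by positivity))
    (fun k => ?_) (hu.2.add hv.2)
  have := lam_nonneg k
  nlinarith [mul_nonneg this (sq_nonneg (‖fc u k‖ - ‖fc v k‖)),
    mul_nonneg this (sq_nonneg (‖fc u k‖)), mul_nonneg this (sq_nonneg (‖fc v k‖))]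

lemma H1.integrable {u : Torus d → ℝ} (hu : H1 u) : Integrable u := hu.1.integrable (by simp)

lemma H1.sub {u v : Torus d → ℝ} (hu : H1 u) (hv : H1 v) : H1 (fun x => u x - v x) := by
  refine ⟨hu.1.sub hv.1, ?_⟩
  refine Summable.of_nonneg_of_le (fun k => mul_nonneg (lam_nonneg k) (by positivity))
    (fun k => ?_) ((hu.2.add hv.2).mul_left 2)
  rw [fc_sub hu.integrable hv.integrable]
  have h := norm_sub_le (fc u k) (fc v k)
  have h0 := norm_nonneg (fc u k - fc v k)
  have h1 : ‖fc u k - fc v k‖ ^ 2 ≤ 2 * (‖fc u k‖ ^ 2 + ‖fc v k‖ ^ 2) := by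
    nlinarith [sq_nonneg (‖fc u k‖ - ‖fc v k‖)]
  have := mul_le_mul_of_nonneg_left h1 (lam_nonneg k)
  linarith

lemma H1.congr {u v : Torus d → ℝ} (hu : H1 u) (h : u =ᵐ[volume] v) : H1 v := by
  refine ⟨hu.1.ae_eq h, ?_⟩
  simpa only [fc_congr h] using hu.2

lemma fc_const (c : ℝ) {k : Fin d → ℤ} (hk : k ≠ 0) : fc (fun _ : Torus d => c) k = 0 := by
  unfold fc
  rw [integral_const_mul, integral_mFourier _ (neg_ne_zero.2 hk), mul_zero]

lemma lam_mul_fc_const (c : ℝ) (k : Fin d → ℤ) :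
    (lam k : ℂ) * fc (fun _ : Torus d => c) k = 0 := by
  by_cases hk : k = 0
  · simp [hk, lam_zero]
  · simp [fc_const c hk]

lemma H1_const (c : ℝ) : H1 (fun _ : Torus d => c) := by
  refine ⟨memLp_const c, ?_⟩
  convert summable_zero with k
  by_cases hk : k = 0
  · simp [hk, lam_zero]
  · simp [fc_const c hk]

lemma energy_const_left (c : ℝ) (v : Torus d → ℝ) : energy (fun _ => c) v = 0 := by
  unfold energy
  convert tsum_zero with k
  by_cases hk : k = 0
  · simp [hk, lam_zero]
  · simp [fc_const c hk]

/-- The Fourier multiplier of the difference quotient form with step `h`. -/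
def dqWeight (h : ℝ) (k : Fin d → ℤ) : ℝ :=
  ∑ i, ‖mFourier k (Pi.single i (h : UnitAddCircle)) - 1‖ ^ 2 / h ^ 2

/-- The difference quotient form with step `h`, which approximates the Dirichlet form. -/
def dqForm (h : ℝ) (u v : Torus d → ℝ) : ℝ :=
  ∑ i, (∫ x, (u (x + Pi.single i (h : UnitAddCircle)) - u x) *
    (v (x + Pi.single i (h : UnitAddCircle)) - v x)) / h ^ 2

lemma dqWeight_nonneg (h : ℝ) (k : Fin d → ℤ) : 0 ≤ dqWeight h k := by
  unfold dqWeight; positivity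

lemma lam_eq_sum (k : Fin d → ℤ) : lam k = ∑ i, (2 * Real.pi * k i) ^ 2 := by
  unfold lam; rw [Finset.mul_sum]; congr 1; ext i; ring

lemma dqWeight_le (h : ℝ) (k : Fin d → ℤ) : dqWeight h k ≤ lam k := by
  rw [lam_eq_sum]
  refine Finset.sum_le_sum fun i _ => ?_
  by_cases hh : h = 0
  · subst hh; simp; positivity
  rw [div_le_iff₀ (by positivity), mFourier_single_coe, ← mul_pow]
  refine (sq_le_sq₀ (norm_nonneg _) (norm_nonneg (2 * Real.pi * k i * h))).2 ?_ |>.trans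
    (by rw [Real.norm_eq_abs, sq_abs])
  have := Real.norm_exp_I_mul_ofReal_sub_one_le (x := 2 * Real.pi * k i * h)
  have e : 2 * Real.pi * Complex.I * k i * h = Complex.I * ((2 * Real.pi * k i * h : ℝ) : ℂ) := by
    push_cast; ring
  rw [e]
  exact this

lemma tendsto_dqWeight (k : Fin d → ℤ) :
    Tendsto (fun h : ℝ => dqWeight h k) (𝓝[≠] 0) (𝓝 (lam k)) := by
  rw [lam_eq_sum]
  refine tendsto_finsetSum _ fun i _ => ?_
  set c : ℂ := 2 * Real.pi * Complex.I * k i with hc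
  have h1 : HasDerivAt (fun t : ℝ => Complex.exp (c * t)) c 0 := by
    have h2 : HasDerivAt (fun t : ℝ => c * (t : ℂ)) c 0 := by
      simpa using (Complex.ofRealCLM.hasDerivAt (x := (0 : ℝ))).const_mul c
    simpa using h2.cexp
  have h3 := (hasDerivAt_iff_tendsto_slope_zero.1 h1).norm.pow 2
  have h4 : ‖c‖ ^ 2 = (2 * Real.pi * k i) ^ 2 := by
    rw [hc]; simp [mul_pow]
  rw [← h4]
  refine h3.congr fun t => ?_
  rw [mFourier_single_coe, norm_smul, mul_pow, norm_inv, inv_pow, Real.norm_eq_abs, sq_abs]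
  simp [div_eq_inv_mul, hc]

lemma memLp_translate {u : Torus d → ℝ} {p : ℝ≥0∞} (hu : MemLp u p) (a : Torus d) :
    MemLp (fun x => u (x + a)) p :=
  hu.comp_measurePreserving (measurePreserving_add_right volume a)

lemma hasSum_dqForm (h : ℝ) {u v : Torus d → ℝ} (hu : MemLp u 2) (hv : MemLp v 2) :
    HasSum (fun k => dqWeight h k * (fc u k * conj (fc v k)).re) (dqForm h u v) := by
  unfold dqWeight dqForm
  simp_rw [Finset.sum_mul]
  refine hasSum_sum fun i _ => ?_
  set a : Torus d := Pi.single i (h : UnitAddCircle)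
  have h1 := (hasSum_fc_mul ((memLp_translate hu a).sub hu)
    ((memLp_translate hv a).sub hv)).div_const (h ^ 2)
  refine h1.congr_fun fun k => ?_
  have e : ∀ {w : Torus d → ℝ}, MemLp w 2 →
      fc ((fun x => w (x + a)) - w) k = (mFourier k a - 1) * fc w k := by
    intro w hw
    have := fc_sub ((memLp_translate hw a).integrable (by simp)) (hw.integrable (by simp)) k
    rw [fc_translate] at this
    rw [sub_mul, one_mul]
    exact this
  rw [e hu, e hv]
  set z := mFourier k a - 1
  have : z * fc u k * conj (z * fc v k) = ((‖z‖ ^ 2 : ℝ) : ℂ) * (fc u k * conj (fc v k)) := by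
    rw [map_mul, ← Complex.normSq_eq_norm_sq, ← Complex.mul_conj]; ring
  rw [this, Complex.re_ofReal_mul]
  ring

lemma tendsto_dqForm {u v : Torus d → ℝ} (hu : H1 u) (hv : H1 v) :
    Tendsto (fun h => dqForm h u v) (𝓝[≠] 0) (𝓝 (energy u v)) := by
  have : (fun h => dqForm h u v) = fun h => ∑' k, dqWeight h k * (fc u k * conj (fc v k)).re := by
    ext h; exact (hasSum_dqForm h hu.1 hv.1).tsum_eq.symm
  rw [this]
  refine tendsto_tsum_of_dominated_convergence (hu.summable_mul hv)
    (fun k => (tendsto_dqWeight k).mul_const _) (Eventually.of_forall fun h k => ?_)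
  rw [Real.norm_eq_abs, abs_mul, abs_of_nonneg (dqWeight_nonneg h k)]
  exact mul_le_mul (dqWeight_le h k) (abs_mul_conj_re_le _ _) (abs_nonneg _) (lam_nonneg k)

lemma integrable_dq {u v : Torus d → ℝ} (hu : MemLp u 2) (hv : MemLp v 2) (a : Torus d) :
    Integrable fun x => (u (x + a) - u x) * (v (x + a) - v x) :=
  ((memLp_translate hu a).sub hu).integrable_mul ((memLp_translate hv a).sub hv)

lemma dqForm_le {u v u' v' : Torus d → ℝ} (hu : MemLp u 2) (hv : MemLp v 2) (hu' : MemLp u' 2)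
    (hv' : MemLp v' 2)
    (h : ∀ x y, (u x - u y) * (v x - v y) ≤ (u' x - u' y) * (v' x - v' y)) (t : ℝ) :
    dqForm t u v ≤ dqForm t u' v' := by
  refine Finset.sum_le_sum fun i _ => ?_
  gcongr ?_ / _
  exact integral_mono (integrable_dq hu hv _) (integrable_dq hu' hv' _) fun x => h _ _

/-- The Markovian property of the Dirichlet form: pointwise inequalities between products of
increments are inherited by it. -/
lemma energy_le_energy {u v u' v' : Torus d → ℝ} (hu : H1 u) (hv : H1 v) (hu' : H1 u')
    (hv' : H1 v')
    (h : ∀ x y, (u x - u y) * (v x - v y) ≤ (u' x - u' y) * (v' x - v' y)) :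
    energy u v ≤ energy u' v' :=
  le_of_tendsto_of_tendsto' (tendsto_dqForm hu hv) (tendsto_dqForm hu' hv')
    (dqForm_le hu.1 hv.1 hu'.1 hv'.1 h)

lemma energy_nonneg_of_monotone {u v : Torus d → ℝ} (hu : H1 u) (hv : H1 v)
    (h : ∀ x y, 0 ≤ (u x - u y) * (v x - v y)) : 0 ≤ energy u v := by
  rw [← energy_const_left 0 (fun _ : Torus d => (0 : ℝ))]
  refine energy_le_energy (H1_const 0) (H1_const 0) hu hv fun x y => ?_
  simpa using h x y

/-- Functions whose increments are dominated by those of a `W^{1,2}` function, in particular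
Lipschitz functions of it, are in `W^{1,2}`. -/
lemma H1_of_abs_sub_le {u v : Torus d → ℝ} (hu : H1 u) (hv : MemLp v 2) (L : ℝ)
    (h : ∀ x y, |v x - v y| ≤ L * |u x - u y|) : H1 v := by
  refine ⟨hv, summable_of_sum_le (c := L ^ 2 * energy u u)
    (fun k => mul_nonneg (lam_nonneg k) (sq_nonneg _)) fun s => ?_⟩
  refine le_of_tendsto_of_tendsto' (b := 𝓝[≠] (0 : ℝ))
    (tendsto_finsetSum s fun k _ => (tendsto_dqWeight k).mul_const (‖fc v k‖ ^ 2))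
    ((tendsto_dqForm hu hu).const_mul (L ^ 2)) fun t => ?_
  calc _ ≤ dqForm t v v := by
        have := hasSum_dqForm t hv hv
        simp only [mul_conj_re_self] at this
        exact sum_le_hasSum s (fun k _ => mul_nonneg (dqWeight_nonneg t k) (sq_nonneg _)) this
    _ ≤ dqForm t (fun x => L * u x) (fun x => L * u x) := by
        refine dqForm_le hv hv (hu.1.const_mul L) (hu.1.const_mul L) (fun x y => ?_) t
        have h1 := h x y
        rw [← mul_sub, ← sq, ← sq]
        refine sq_le_sq.2 (h1.trans ?_)
        rw [abs_mul]
        gcongr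
        exact le_abs_self L
    _ = L ^ 2 * dqForm t u u := by
        unfold dqForm
        rw [Finset.mul_sum]
        congr 1; ext i
        rw [← mul_div_assoc, ← integral_const_mul]
        congr 2; ext x; ring

/-- Lower semicontinuity of the energy under convergence of Fourier coefficients. -/
lemma H1_of_tendsto {ι : Type*} {l : Filter ι} [l.NeBot] {u : ι → Torus d → ℝ} {v : Torus d → ℝ}
    {C : ℝ} (hu : ∀ i, H1 (u i)) (hv : MemLp v 2) (hC : ∀ᶠ i in l, energy (u i) (u i) ≤ C)
    (h : ∀ k, Tendsto (fun i => fc (u i) k) l (𝓝 (fc v k))) :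
    H1 v ∧ energy v v ≤ C := by
  have key : ∀ s : Finset (Fin d → ℤ), ∑ k ∈ s, lam k * ‖fc v k‖ ^ 2 ≤ C := by
    intro s
    refine le_of_tendsto (tendsto_finsetSum s fun k _ => ((h k).norm.pow 2).const_mul (lam k)) ?_
    filter_upwards [hC] with i hi
    refine le_trans ?_ hi
    rw [energy_self]
    exact (hu i).2.sum_le_tsum s fun k _ => mul_nonneg (lam_nonneg k) (sq_nonneg _)
  have hs : Summable fun k => lam k * ‖fc v k‖ ^ 2 :=
    summable_of_sum_le (fun k => mul_nonneg (lam_nonneg k) (sq_nonneg _)) key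
  refine ⟨⟨hv, hs⟩, ?_⟩
  rw [energy_self]
  exact hs.tsum_le_of_sum_le key

/-! ### The Poisson equation: comparison, weak form and boundedness -/

/-- `u ∈ W^{1,2}` solves `-Δ u = f` in the sense of Fourier coefficients. -/
def SolvesPoisson (f u : Torus d → ℝ) : Prop :=
  H1 u ∧ ∀ k, (lam k : ℂ) * fc u k = fc f k

lemma SolvesPoisson.sub {f g u v : Torus d → ℝ} (hu : SolvesPoisson f u) (hv : SolvesPoisson g v)
    (hf : Integrable f) (hg : Integrable g) :
    SolvesPoisson (fun x => f x - g x) (fun x => u x - v x) := by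
  refine ⟨hu.1.sub hv.1, fun k => ?_⟩
  rw [fc_sub hf hg, fc_sub hu.1.integrable hv.1.integrable, mul_sub, hu.2, hv.2]

lemma SolvesPoisson.congr {f g u v : Torus d → ℝ} (hu : SolvesPoisson f u) (hf : f =ᵐ[volume] g)
    (huv : u =ᵐ[volume] v) : SolvesPoisson g v := by
  refine ⟨hu.1.congr huv, fun k => ?_⟩
  rw [← fc_congr hf, ← fc_congr huv, hu.2]

lemma solvesPoisson_const (c : ℝ) : SolvesPoisson (fun _ : Torus d => (0 : ℝ)) (fun _ => c) := by
  refine ⟨H1_const c, fun k => ?_⟩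
  rw [lam_mul_fc_const, fc_zero_fun]

lemma SolvesPoisson.energy_term {f u : Torus d → ℝ} (hu : SolvesPoisson f u) (k : Fin d → ℤ)
    (z : ℂ) : lam k * (fc u k * z).re = (fc f k * z).re := by
  rw [← hu.2 k, ← Complex.re_ofReal_mul, mul_assoc]

lemma SolvesPoisson.energy_eq {f u v : Torus d → ℝ} (hu : SolvesPoisson f u) (hf : MemLp f 2)
    (hv : MemLp v 2) : energy u v = ∫ x, f x * v x := by
  rw [← (hasSum_fc_mul hf hv).tsum_eq]
  simp only [energy, hu.energy_term]

/-- Truncation to the interval `[a, b]`. -/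
def clamp (a b t : ℝ) : ℝ := max a (min b t)

lemma clamp_le {a b : ℝ} (hab : a ≤ b) (t : ℝ) : clamp a b t ≤ b :=
  max_le hab (min_le_left _ _)

lemma le_clamp (a b t : ℝ) : a ≤ clamp a b t := le_max_left _ _

lemma abs_clamp_le {b : ℝ} (hb : 0 ≤ b) (t : ℝ) : |clamp (-b) b t| ≤ b :=
  abs_le.2 ⟨le_clamp _ _ _, clamp_le (by linarith) _⟩

lemma clamp_mono (a b : ℝ) : Monotone (clamp a b) := fun s t h => by
  unfold clamp; gcongr

lemma clamp_sub_le {a b s t : ℝ} (h : s ≤ t) : clamp a b t - clamp a b s ≤ t - s := by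
  unfold clamp
  rcases max_cases a (min b t) with h1 | h1 <;> rcases max_cases a (min b s) with h2 | h2 <;>
  rcases min_cases b t with h3 | h3 <;> rcases min_cases b s with h4 | h4 <;> linarith

lemma abs_clamp_sub_le (a b s t : ℝ) : |clamp a b s - clamp a b t| ≤ |s - t| := by
  rcases le_total s t with h | h
  · rw [abs_sub_comm, abs_sub_comm s, abs_of_nonneg (sub_nonneg.2 (clamp_mono a b h)),
      abs_of_nonneg (sub_nonneg.2 h)]
    exact clamp_sub_le h
  · rw [abs_of_nonneg (sub_nonneg.2 (clamp_mono a b h)), abs_of_nonneg (sub_nonneg.2 h)]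
    exact clamp_sub_le h

lemma continuous_clamp (a b : ℝ) : Continuous (clamp a b) := by unfold clamp; fun_prop

lemma abs_clamp_le_abs {b : ℝ} (hb : 0 ≤ b) (t : ℝ) : |clamp (-b) b t| ≤ |t| := by
  have := abs_clamp_sub_le (-b) b t 0
  have h0 : clamp (-b) b 0 = 0 := by simp [clamp, hb]
  simpa [h0] using this

lemma memLp_of_abs_le {v : Torus d → ℝ} {p : ℝ≥0∞} (hv : AEStronglyMeasurable v) {M : ℝ}
    (h : ∀ᵐ x, |v x| ≤ M) : MemLp v p :=
  MemLp.of_bound hv M h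

lemma H1.clamp {u : Torus d → ℝ} (hu : H1 u) (a b : ℝ) : H1 fun x => clamp a b (u x) := by
  refine H1_of_abs_sub_le hu ?_ 1 fun x y => ?_
  · refine memLp_of_abs_le (M := |a| + |b|)
      ((continuous_clamp a b).comp_aestronglyMeasurable hu.1.1) (Eventually.of_forall fun x => ?_)
    unfold _root_.clamp
    rw [abs_le]
    constructor
    · exact le_max_of_le_left (by linarith [neg_abs_le a, abs_nonneg b])
    · refine max_le (by linarith [le_abs_self a, abs_nonneg b]) ((min_le_left _ _).trans ?_)
      linarith [le_abs_self b, abs_nonneg a]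
  · rw [one_mul]; exact abs_clamp_sub_le _ _ _ _

/-- The weak maximum principle: the test function `clamp 0 1 u` vanishes off `{u > 0}`, where
`f < 0`, and has nonnegative energy with `u`. -/
lemma ae_nonpos_of_energy_eq {f u : Torus d → ℝ} (hu : H1 u) (hf : Integrable f)
    (he : energy u (fun x => clamp 0 1 (u x)) = ∫ x, f x * clamp 0 1 (u x))
    (h : ∀ᵐ x, 0 < u x → f x < 0) : ∀ᵐ x, u x ≤ 0 := by
  have h0 : 0 ≤ energy u (fun x => clamp 0 1 (u x)) := by
    refine energy_nonneg_of_monotone hu (hu.clamp 0 1) fun x y => ?_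
    rcases le_total (u x) (u y) with hxy | hxy
    · exact mul_nonneg_of_nonpos_of_nonpos (by linarith) (by linarith [clamp_mono 0 1 hxy])
    · exact mul_nonneg (by linarith) (by linarith [clamp_mono 0 1 hxy])
  have hint : Integrable fun x => f x * clamp 0 1 (u x) := by
    refine hf.mul_bdd (c := 1) (hu.clamp 0 1).1.1 (Eventually.of_forall fun x => ?_)
    rw [Real.norm_eq_abs, abs_of_nonneg (le_clamp 0 1 _)]
    exact clamp_le zero_le_one _
  have hneg : ∀ᵐ x, f x * clamp 0 1 (u x) ≤ 0 := by
    filter_upwards [h] with x hx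
    rcases lt_or_ge 0 (u x) with hux | hux
    · exact mul_nonpos_of_nonpos_of_nonneg (hx hux).le (le_clamp 0 1 _)
    · have : clamp 0 1 (u x) = 0 := by
        unfold clamp; rw [max_eq_left]; exact (min_le_right _ _).trans hux
      rw [this, mul_zero]
  have hz : ∫ x, -(f x * clamp 0 1 (u x)) = 0 := by
    rw [integral_neg]
    have := integral_nonpos_of_ae hneg
    linarith
  have hz2 := (integral_eq_zero_iff_of_nonneg_ae (f := fun x => -(f x * clamp 0 1 (u x)))
    (by filter_upwards [hneg] with x hx; simpa using hx) hint.neg).1 hz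
  filter_upwards [h, hz2] with x hx hzx
  by_contra! hux
  have h1 : 0 < clamp 0 1 (u x) := lt_max_of_lt_right (lt_min zero_lt_one hux)
  have h2 := mul_neg_of_neg_of_pos (hx hux) h1
  simp at hzx
  rcases hzx with h3 | h3
  · linarith [hx hux]
  · linarith

/-- The comparison principle for square integrable right-hand sides. -/
lemma SolvesPoisson.ae_le {f g u v : Torus d → ℝ} (hu : SolvesPoisson f u) (hv : SolvesPoisson g v)
    (hf : MemLp f 2) (hg : MemLp g 2) (h : ∀ᵐ x, v x < u x → f x < g x) :
    ∀ᵐ x, u x ≤ v x := by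
  have hfi := hf.integrable (by simp)
  have hgi := hg.integrable (by simp)
  have hs := hu.sub hv hfi hgi
  have := ae_nonpos_of_energy_eq hs.1 (hfi.sub hgi)
    (hs.energy_eq (hf.sub hg) (hs.1.clamp 0 1).1) (by
      filter_upwards [h] with x hx h1
      have := hx (by linarith)
      simp only [Pi.sub_apply]; linarith)
  filter_upwards [this] with x hx
  linarith

lemma exists_multiplier {v : Torus d → ℝ} (hv : MemLp v 2) (m : (Fin d → ℤ) → ℝ) {C : ℝ}
    (hm : ∀ k, |m k| ≤ C) (hsym : ∀ k, m (-k) = m k) :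
    ∃ u : Torus d → ℝ, MemLp u 2 ∧ ∀ k, fc u k = m k * fc v k := by
  refine exists_fc_eq _ ?_ fun k => ?_
  · refine Summable.of_nonneg_of_le (fun k => sq_nonneg _) (fun k => ?_)
      ((hasSum_norm_fc_sq hv).summable.mul_left (C ^ 2))
    rw [norm_mul, mul_pow, Complex.norm_real, Real.norm_eq_abs]
    gcongr
    exact hm k
  · rw [hsym, fc_neg_index, map_mul, Complex.conj_ofReal]

/-- The resolvent equation `Λ u - Δ u = f` has a solution for every `f ∈ L²`. -/
lemma exists_resolvent {L : ℝ} (hL : 0 < L) {f : Torus d → ℝ} (hf : MemLp f 2) :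
    ∃ u : Torus d → ℝ, SolvesPoisson (fun x => f x - L * u x) u ∧
      ∀ k, fc u k = ((L + lam k)⁻¹ : ℝ) * fc f k := by
  obtain ⟨u, hu, hk⟩ := exists_multiplier hf (fun k => (L + lam k)⁻¹) (C := L⁻¹) (fun k => by
    have := lam_nonneg k
    rw [abs_of_nonneg (by positivity)]
    gcongr; linarith) (fun k => by rw [lam_neg])
  refine ⟨u, ⟨⟨hu, ?_⟩, fun k => ?_⟩, hk⟩
  · refine Summable.of_nonneg_of_le (fun k => mul_nonneg (lam_nonneg k) (sq_nonneg _)) (fun k => ?_)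
      ((hasSum_norm_fc_sq hf).summable.mul_left L⁻¹)
    have h0 := lam_nonneg k
    rw [hk, norm_mul, mul_pow, Complex.norm_real, Real.norm_eq_abs, sq_abs, ← mul_assoc]
    gcongr
    rw [inv_pow, ← div_eq_mul_inv, div_le_iff₀ (by positivity), inv_mul_eq_div,
      le_div_iff₀ hL]
    nlinarith
  · have h0 := lam_nonneg k
    have h1 : ((L + lam k : ℝ) : ℂ) ≠ 0 := by
      exact_mod_cast (by positivity : L + lam k ≠ 0)
    rw [fc_sub (hf.integrable (by simp)) ((hu.integrable (by simp)).const_mul L), fc_const_mul, hk]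
    push_cast at h1 ⊢
    field_simp
    ring

/-- `L^∞` bound for the resolvent. -/
lemma SolvesPoisson.abs_le_of_resolvent {L : ℝ} (hL : 0 < L) {f u : Torus d → ℝ} (hf : MemLp f 2)
    (hu : SolvesPoisson (fun x => f x - L * u x) u) {M : ℝ} (hM : ∀ᵐ x, |f x| ≤ L * M) :
    ∀ᵐ x, |u x| ≤ M := by
  have h2 : MemLp (fun x => f x - L * u x) 2 := hf.sub (hu.1.1.const_mul L)
  have h0 : MemLp (fun _ : Torus d => (0 : ℝ)) 2 := memLp_const 0
  have hle := hu.ae_le (solvesPoisson_const M) h2 h0 (by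
    filter_upwards [hM] with x hx h
    nlinarith [(abs_le.1 hx).2, mul_lt_mul_of_pos_left h hL])
  have hge := (solvesPoisson_const (-M)).ae_le hu h0 h2 (by
    filter_upwards [hM] with x hx h
    nlinarith [(abs_le.1 hx).1, mul_lt_mul_of_pos_left h hL])
  filter_upwards [hle, hge] with x h1 h2
  exact abs_le.2 ⟨h2, h1⟩

/-- The multiplier of the smoothing operator `(Λ (Λ - Δ)⁻¹) ^ d`.  The exponent `d` makes it
summable over `ℤᵈ`. -/
def smoothWeight (L : ℝ) (k : Fin d → ℤ) : ℝ := (L / (L + lam k)) ^ d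

lemma smoothWeight_nonneg {L : ℝ} (hL : 0 < L) (k : Fin d → ℤ) : 0 ≤ smoothWeight L k := by
  have := lam_nonneg k; unfold smoothWeight; positivity

lemma smoothWeight_le_one {L : ℝ} (hL : 0 < L) (k : Fin d → ℤ) : smoothWeight L k ≤ 1 := by
  have := lam_nonneg k
  refine pow_le_one₀ (by positivity) ?_
  rw [div_le_one (by positivity)]; linarith

lemma smoothWeight_le {L : ℝ} (hL : 1 ≤ L) (k : Fin d → ℤ) :
    smoothWeight L k ≤ L ^ d * ((1 + lam k) ^ d)⁻¹ := by
  have := lam_nonneg k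
  unfold smoothWeight
  rw [div_pow, div_eq_mul_inv]
  gcongr

lemma tendsto_smoothWeight (k : Fin d → ℤ) :
    Tendsto (fun n : ℕ => smoothWeight ((n : ℝ) + 1) k) atTop (𝓝 1) := by
  have h1 : Tendsto (fun n : ℕ => (n : ℝ) + 1) atTop atTop :=
    tendsto_atTop_add_const_right _ _ tendsto_natCast_atTop_atTop
  have h2 : Tendsto (fun n : ℕ => lam k / (((n : ℝ) + 1) + lam k)) atTop (𝓝 0) :=
    (tendsto_atTop_add_const_right _ _ h1).const_div_atTop (lam k)
  have h3 := (h2.const_sub 1).pow d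
  rw [sub_zero, one_pow] at h3
  refine h3.congr fun n => ?_
  have := lam_nonneg k
  unfold smoothWeight
  congr 1
  field_simp
  ring

/-- Powers of `Λ (Λ - Δ)⁻¹` are contractions of `L^∞`. -/
lemma exists_iterate_resolvent {L : ℝ} (hL : 0 < L) {v : Torus d → ℝ} (hv : MemLp v 2) {M : ℝ}
    (hM : ∀ᵐ x, |v x| ≤ M) (J : ℕ) :
    ∃ w : Torus d → ℝ, MemLp w 2 ∧ (∀ᵐ x, |w x| ≤ M) ∧
      ∀ k, fc w k = ((L / (L + lam k)) ^ J : ℝ) * fc v k := by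
  induction J with
  | zero => exact ⟨v, hv, hM, fun k => by simp⟩
  | succ J ih =>
    obtain ⟨w, hw, hwM, hk⟩ := ih
    obtain ⟨u, hu, huk⟩ := exists_resolvent hL (hw.const_mul L)
    refine ⟨u, hu.1.1, hu.abs_le_of_resolvent hL (hw.const_mul L) ?_, fun k => ?_⟩
    · filter_upwards [hwM] with x hx
      rw [abs_mul, abs_of_pos hL]; gcongr
    · rw [huk, fc_const_mul, hk]; push_cast; ring

/-- Smoothing: a bounded function is approximated by functions with the same bound and with
absolutely convergent Fourier series. -/
lemma exists_smoothing {L : ℝ} (hL : 0 < L) {v : Torus d → ℝ} (hv : MemLp v 2) {M : ℝ}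
    (hM : ∀ᵐ x, |v x| ≤ M) :
    ∃ w : Torus d → ℝ, MemLp w 2 ∧ (∀ᵐ x, |w x| ≤ M) ∧
      ∀ k, fc w k = smoothWeight L k * fc v k :=
  exists_iterate_resolvent hL hv hM d

lemma summable_smoothWeight {L : ℝ} (hL : 1 ≤ L) :
    Summable fun k : Fin d → ℤ => smoothWeight L k :=
  Summable.of_nonneg_of_le (smoothWeight_nonneg (by linarith)) (smoothWeight_le hL)
    ((summable_inv_one_add_lam_pow d).mul_left _)

lemma summable_norm_fc_smoothing {L : ℝ} (hL : 1 ≤ L) {v w : Torus d → ℝ}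
    (hk : ∀ k, fc w k = smoothWeight L k * fc v k) : Summable fun k => ‖fc w k‖ := by
  refine Summable.of_nonneg_of_le (fun k => norm_nonneg _) (fun k => ?_)
    ((summable_smoothWeight hL).mul_right (∫ x, |v x|))
  rw [hk, norm_mul, Complex.norm_real, Real.norm_eq_abs,
    abs_of_nonneg (smoothWeight_nonneg (by linarith) k)]
  gcongr
  · exact smoothWeight_nonneg (by linarith) k
  · exact norm_fc_le k

lemma exists_subseq_tendsto_ae {w : ℕ → Torus d → ℝ} {v : Torus d → ℝ} (hw : ∀ n, MemLp (w n) 2)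
    (hv : MemLp v 2) (h : Tendsto (fun n => ∫ x, (w n x - v x) ^ 2) atTop (𝓝 0)) :
    ∃ s : ℕ → ℕ, StrictMono s ∧ ∀ᵐ x, Tendsto (fun n => w (s n) x) atTop (𝓝 (v x)) := by
  have h1 : Tendsto (fun n => eLpNorm (w n - v) 2 volume) atTop (𝓝 0) := by
    have e : ∀ n, eLpNorm (w n - v) 2 volume
        = ENNReal.ofReal ((∫ x, (w n x - v x) ^ 2) ^ (2⁻¹ : ℝ)) := by
      intro n
      rw [((hw n).sub hv).eLpNorm_eq_integral_rpow_norm (by simp) (by simp)]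
      simp
    simp_rw [e]
    have := ENNReal.tendsto_ofReal (h.rpow_const (p := (2⁻¹ : ℝ)) (Or.inr (by norm_num)))
    simpa using this
  exact (tendstoInMeasure_of_tendsto_eLpNorm (by simp) (fun n => (hw n).1) hv.1
    h1).exists_seq_tendsto_ae

/-- The weak form of `-Δ u = f` with `f ∈ L¹` holds for bounded test functions in `W^{1,2}`. -/
lemma SolvesPoisson.energy_eq_of_bounded {f u v : Torus d → ℝ} (hu : SolvesPoisson f u)
    (hf : Integrable f) (hv : H1 v) {M : ℝ} (hM : ∀ᵐ x, |v x| ≤ M) :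
    energy u v = ∫ x, f x * v x := by
  have hpos : ∀ n : ℕ, (0 : ℝ) < (n : ℝ) + 1 := fun n => by positivity
  have hone : ∀ n : ℕ, (1 : ℝ) ≤ (n : ℝ) + 1 := fun n => by simp
  choose w hw2 hwM hwk using fun n : ℕ => exists_smoothing (hpos n) hv.1 hM
  have hL2 : Tendsto (fun n => ∫ x, (w n x - v x) ^ 2) atTop (𝓝 0) := by
    have e : ∀ n, ∫ x, (w n x - v x) ^ 2
        = ∑' k, (1 - smoothWeight ((n : ℝ) + 1) k) ^ 2 * ‖fc v k‖ ^ 2 := by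
      intro n
      rw [← (hasSum_norm_fc_sq (u := fun x => w n x - v x) ((hw2 n).sub hv.1)).tsum_eq]
      congr 1; ext k
      rw [fc_sub ((hw2 n).integrable (by simp)) hv.integrable, hwk n,
        show (smoothWeight ((n : ℝ) + 1) k : ℂ) * fc v k - fc v k
          = ((smoothWeight ((n : ℝ) + 1) k - 1 : ℝ) : ℂ) * fc v k by push_cast; ring,
        norm_mul, mul_pow, Complex.norm_real, Real.norm_eq_abs, sq_abs]
      ring
    simp_rw [e]
    rw [show (0 : ℝ) = ∑' k : Fin d → ℤ, (1 - 1) ^ 2 * ‖fc v k‖ ^ 2 by simp]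
    refine tendsto_tsum_of_dominated_convergence (hasSum_norm_fc_sq hv.1).summable
      (fun k => (((tendsto_smoothWeight k).const_sub 1).pow 2).mul_const _)
      (Eventually.of_forall fun n k => ?_)
    have h0 := smoothWeight_nonneg (hpos n) k
    have h1 := smoothWeight_le_one (hpos n) k
    rw [Real.norm_eq_abs, abs_of_nonneg (by positivity)]
    refine mul_le_of_le_one_left (sq_nonneg _) ?_
    exact pow_le_one₀ (by linarith) (by linarith)
  obtain ⟨s, hs, hsae⟩ := exists_subseq_tendsto_ae hw2 hv.1 hL2
  have hE : ∀ n, ∫ x, f x * w n x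
      = ∑' k, smoothWeight ((n : ℝ) + 1) k * (lam k * (fc u k * conj (fc v k)).re) := by
    intro n
    rw [← (hasSum_fc_mul_of_summable hf (hw2 n) (summable_norm_fc_smoothing (hone n)
      (hwk n))).tsum_eq]
    congr 1; ext k
    rw [hwk n, hu.energy_term, ← Complex.re_ofReal_mul, map_mul, Complex.conj_ofReal]
    congr 1; ring
  have hT1 : Tendsto (fun n => ∫ x, f x * w n x) atTop (𝓝 (energy u v)) := by
    simp_rw [hE]
    have : energy u v = ∑' k, 1 * (lam k * (fc u k * conj (fc v k)).re) := by simp [energy]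
    rw [this]
    refine tendsto_tsum_of_dominated_convergence (hu.1.summable_mul hv)
      (fun k => (tendsto_smoothWeight k).mul_const _) (Eventually.of_forall fun n k => ?_)
    rw [Real.norm_eq_abs, abs_mul, abs_mul, abs_of_nonneg (lam_nonneg k),
      abs_of_nonneg (smoothWeight_nonneg (hpos n) k)]
    refine (mul_le_of_le_one_left (mul_nonneg (lam_nonneg k) (abs_nonneg _))
      (smoothWeight_le_one (hpos n) k)).trans ?_
    exact mul_le_mul_of_nonneg_left (abs_mul_conj_re_le _ _) (lam_nonneg k)
  have hT2 : Tendsto (fun n => ∫ x, f x * w (s n) x) atTop (𝓝 (∫ x, f x * v x)) := by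
    refine tendsto_integral_of_dominated_convergence (fun x => |f x| * M)
      (fun n => hf.1.mul (hw2 _).1) (hf.abs.mul_const M) (fun n => ?_) ?_
    · filter_upwards [hwM (s n)] with x hx
      rw [Real.norm_eq_abs, abs_mul]; gcongr
    · filter_upwards [hsae] with x hx
      exact hx.const_mul _
  exact tendsto_nhds_unique (hT1.comp hs.tendsto_atTop) hT2

/-- The comparison principle for integrable right-hand sides. -/
lemma SolvesPoisson.ae_le_of_integrable {f g u v : Torus d → ℝ} (hu : SolvesPoisson f u)
    (hv : SolvesPoisson g v) (hf : Integrable f) (hg : Integrable g)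
    (h : ∀ᵐ x, v x < u x → f x < g x) : ∀ᵐ x, u x ≤ v x := by
  have hs := hu.sub hv hf hg
  have := ae_nonpos_of_energy_eq hs.1 (hf.sub hg)
    (hs.energy_eq_of_bounded (hf.sub hg) (hs.1.clamp 0 1) (M := 1) (Eventually.of_forall fun x => by
      rw [abs_of_nonneg (le_clamp 0 1 _)]; exact clamp_le zero_le_one _)) (by
      filter_upwards [h] with x hx h1
      have := hx (by linarith)
      simp only [Pi.sub_apply]; linarith)
  filter_upwards [this] with x hx
  linarith

/-- **`L^∞` estimate for the Poisson equation** on the torus: a bounded function of mean zero has a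
solution of `-Δ w = f` that is bounded by a multiple of the bound of `f`. -/
lemma exists_bounded_poisson (d : ℕ) : ∃ C : ℝ, 0 ≤ C ∧ ∀ (f : Torus d → ℝ) (M : ℝ),
    AEStronglyMeasurable f → (∀ᵐ x, |f x| ≤ M) → ∫ x, f x = 0 →
    ∃ w : Torus d → ℝ, SolvesPoisson f w ∧ ∀ᵐ x, |w x| ≤ C * M := by
  refine ⟨d + ∑' k : Fin d → ℤ, ((1 + lam k) ^ d)⁻¹, ?_, fun f M hf hM h0 => ?_⟩
  · have : 0 ≤ ∑' k : Fin d → ℤ, ((1 + lam k) ^ d)⁻¹ :=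
      tsum_nonneg fun k => by have := lam_nonneg k; positivity
    positivity
  have hf2 : MemLp f 2 := memLp_of_abs_le hf hM
  have hfi : Integrable f := hf2.integrable (by simp)
  have hM0 : 0 ≤ M := by
    obtain ⟨x, hx⟩ := hM.exists
    exact (abs_nonneg _).trans hx
  have hf0 : fc f 0 = 0 := by rw [fc_zero_index, h0]; simp
  have hfM : ∀ k, ‖fc f k‖ ≤ M := fun k => by
    refine (norm_fc_le k).trans ?_
    have := integral_mono_ae hfi.abs (integrable_const M) hM
    simpa using this
  have hinv : ∀ k : Fin d → ℤ, (lam k)⁻¹ ≤ 1 := fun k => by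
    by_cases hk : k = 0
    · simp [hk, lam_zero]
    · exact inv_le_one_of_one_le₀ (one_le_lam hk)
  -- At `k = 0` the weight `(lam k)⁻¹` is `0`, which is the choice of a solution of mean zero.
  obtain ⟨w, hw2, hwk⟩ := exists_multiplier hf2 (fun k => (lam k)⁻¹) (C := 1) (fun k => by
    rw [abs_of_nonneg (inv_nonneg.2 (lam_nonneg k))]; exact hinv k) (fun k => by rw [lam_neg])
  have hwf : ∀ k, (lam k : ℂ) * fc w k = fc f k := fun k => by
    rw [hwk]
    by_cases hk : k = 0
    · simp [hk, hf0]
    · have : (lam k : ℂ) ≠ 0 := by exact_mod_cast (by linarith [one_le_lam hk] : lam k ≠ 0)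
      push_cast; field_simp
  have hwle : ∀ k, ‖fc w k‖ ≤ ‖fc f k‖ := fun k => by
    rw [hwk, norm_mul, Complex.norm_real, Real.norm_eq_abs,
      abs_of_nonneg (inv_nonneg.2 (lam_nonneg k))]
    exact mul_le_of_le_one_left (norm_nonneg _) (hinv k)
  have hwS : SolvesPoisson f w := by
    refine ⟨⟨hw2, Summable.of_nonneg_of_le (fun k => mul_nonneg (lam_nonneg k) (sq_nonneg _))
      (fun k => ?_) (hasSum_norm_fc_sq hf2).summable⟩, hwf⟩
    have h1 : lam k * ‖fc w k‖ = ‖fc f k‖ := by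
      rw [← hwf, norm_mul, Complex.norm_real, Real.norm_eq_abs, abs_of_nonneg (lam_nonneg k)]
    rw [sq, ← mul_assoc, h1, sq]
    gcongr
    exact hwle k
  refine ⟨w, hwS, ?_⟩
  -- With `R = (1 - Δ)⁻¹` one has `w = R f + R w`, hence `w = R f + ⋯ + R ^ J f + R ^ J w`.
  have key : ∀ J : ℕ, ∃ r : Torus d → ℝ, MemLp r 2 ∧
      (∀ k, fc r k = ((1 + lam k)⁻¹ ^ J : ℝ) * fc w k) ∧
      ∀ᵐ x, |w x - r x| ≤ J * M := by
    intro J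
    induction J with
    | zero => exact ⟨w, hw2, fun k => by simp, by simp⟩
    | succ J ih =>
      obtain ⟨r, hr2, hrk, hrM⟩ := ih
      obtain ⟨u, hu, huk⟩ := exists_resolvent one_pos hr2
      refine ⟨u, hu.1.1, fun k => by rw [huk, hrk]; push_cast; ring, ?_⟩
      have hs := hwS.sub hu hfi ((hr2.sub (hu.1.1.const_mul 1)).integrable (by simp))
      have hg2 : MemLp (fun x => f x + (w x - r x)) 2 := hf2.add (hw2.sub hr2)
      refine SolvesPoisson.abs_le_of_resolvent one_pos hg2 (u := fun x => w x - u x)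
        (hs.congr (Eventually.of_forall fun x => ?_) (Eventually.of_forall fun x => rfl)) ?_
      · dsimp only; ring
      · filter_upwards [hM, hrM] with x h1 h2
        refine (abs_add_le _ _).trans ?_
        push_cast; linarith
  obtain ⟨r, hr2, hrk, hrM⟩ := key d
  have hrle : ∀ k, ‖fc r k‖ ≤ ((1 + lam k) ^ d)⁻¹ * M := fun k => by
    have := lam_nonneg k
    rw [hrk, norm_mul, Complex.norm_real, Real.norm_eq_abs, abs_of_nonneg (by positivity), inv_pow]
    gcongr
    exact (hwle k).trans (hfM k)
  have hsum := (summable_inv_one_add_lam_pow d).mul_right M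
  have hrs : Summable fun k => ‖fc r k‖ :=
      Summable.of_nonneg_of_le (fun k => norm_nonneg _) hrle hsum
  filter_upwards [hrM, abs_le_tsum_norm_fc hr2 hrs] with x h1 h2
  have h3 := hrs.tsum_le_tsum hrle hsum
  rw [tsum_mul_right] at h3
  have h4 : |w x| ≤ |w x - r x| + |r x| := by
    have := abs_add_le (w x - r x) (r x)
    simpa using this
  rw [add_mul]
  linarith

/-! ### Solvability for bounded densities -/

/-- `Φ ∈ W^{1,2}`, `e^Φ ∈ L¹` and `-ΔΦ = ρ - e^Φ` in the sense of Fourier coefficients. -/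
def SolvesPB (ρ Φ : Torus d → ℝ) : Prop :=
  Integrable (fun x => Real.exp (Φ x)) ∧ SolvesPoisson (fun x => ρ x - Real.exp (Φ x)) Φ

/-- The solution of the Poisson–Boltzmann equation is monotone in the density. -/
lemma SolvesPB.mono {ρ σ Φ Ψ : Torus d → ℝ} (hΦ : SolvesPB ρ Φ) (hΨ : SolvesPB σ Ψ)
    (hρ : Integrable ρ) (hσ : Integrable σ) (h : ∀ᵐ x, ρ x ≤ σ x) : ∀ᵐ x, Φ x ≤ Ψ x := by
  refine hΦ.2.ae_le_of_integrable hΨ.2 (hρ.sub hΦ.1) (hσ.sub hΨ.1) ?_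
  filter_upwards [h] with x hx hlt
  have := Real.exp_lt_exp.2 hlt
  linarith

lemma tendsto_fc_of_dominated {f : ℕ → Torus d → ℝ} {g F : Torus d → ℝ}
    (hf : ∀ n, AEStronglyMeasurable (f n)) (hF : Integrable F) (hle : ∀ n, ∀ᵐ x, |f n x| ≤ F x)
    (h : ∀ᵐ x, Tendsto (fun n => f n x) atTop (𝓝 (g x))) (k : Fin d → ℤ) :
    Tendsto (fun n => fc (f n) k) atTop (𝓝 (fc g k)) := by
  refine tendsto_integral_of_dominated_convergence F (fun n => ?_) hF (fun n => ?_) ?_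
  · exact (Complex.continuous_ofReal.comp_aestronglyMeasurable (hf n)).mul
      (mFourier (-k)).continuous.aestronglyMeasurable
  · filter_upwards [hle n] with x hx
    rw [norm_mul, norm_mFourier_apply, mul_one, Complex.norm_real]
    exact hx
  · filter_upwards [h] with x hx
    exact ((Complex.continuous_ofReal.tendsto _).comp hx).mul_const _

lemma memLp_of_ae_abs_le {u : Torus d → ℝ} {G : Torus d → ℝ} {p : ℝ≥0∞}
    (hu : AEStronglyMeasurable u) (hG : MemLp G p) (h : ∀ᵐ x, |u x| ≤ G x) : MemLp u p :=
  hG.mono' hu h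

/-- Stability of the Poisson equation under dominated convergence with bounded energy. -/
lemma SolvesPoisson.of_tendsto {f u : ℕ → Torus d → ℝ} {g v F G : Torus d → ℝ} {C : ℝ}
    (hS : ∀ n, SolvesPoisson (f n) (u n)) (hf : ∀ n, AEStronglyMeasurable (f n))
    (hF : Integrable F) (hfF : ∀ n, ∀ᵐ x, |f n x| ≤ F x)
    (hfg : ∀ᵐ x, Tendsto (fun n => f n x) atTop (𝓝 (g x)))
    (hG : MemLp G 2) (huG : ∀ n, ∀ᵐ x, |u n x| ≤ G x)
    (huv : ∀ᵐ x, Tendsto (fun n => u n x) atTop (𝓝 (v x)))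
    (hC : ∀ n, energy (u n) (u n) ≤ C) : SolvesPoisson g v := by
  have hvm : AEStronglyMeasurable v :=
      aestronglyMeasurable_of_tendsto_ae _ (fun n => (hS n).1.1.1) huv
  have hvG : ∀ᵐ x, |v x| ≤ G x := by
    filter_upwards [huv, ae_all_iff.2 huG] with x h1 h2
    exact le_of_tendsto' h1.abs h2
  have hfu := tendsto_fc_of_dominated (fun n => (hS n).1.1.1) (hG.integrable (by simp)) huG huv
  refine ⟨(H1_of_tendsto (l := atTop) (fun n => (hS n).1) (memLp_of_ae_abs_le hvm hG hvG)
    (Eventually.of_forall hC) hfu).1, fun k => ?_⟩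
  refine tendsto_nhds_unique ((hfu k).const_mul _) ?_
  simp_rw [(hS _).2]
  exact tendsto_fc_of_dominated hf hF hfF hfg k

lemma exp_sub_exp_le (s t : ℝ) : Real.exp t - Real.exp s ≤ Real.exp t * (t - s) := by
  have h := Real.add_one_le_exp (s - t)
  have h2 : Real.exp s = Real.exp t * Real.exp (s - t) := by rw [← Real.exp_add]; congr 1; ring
  rw [h2]
  nlinarith [Real.exp_pos t]

/-- **Solvability for bounded densities**, by monotone iteration between the constant supersolution
`log K` and a subsolution given by the Poisson equation.  The lower bound depends on the density
only through its bound `K` and a lower bound `m` for its mass. -/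
lemma exists_solvesPB_of_bounded (d : ℕ) {K m : ℝ} (hm : 0 < m) :
    ∃ B : ℝ, ∀ ρ : Torus d → ℝ, AEStronglyMeasurable ρ → (∀ᵐ x, 0 ≤ ρ x) → (∀ᵐ x, ρ x ≤ K) →
      m ≤ ∫ x, ρ x →
      ∃ Φ : Torus d → ℝ, SolvesPB ρ Φ ∧ (∀ᵐ x, -B ≤ Φ x) ∧ ∀ᵐ x, Φ x ≤ Real.log K := by
  obtain ⟨C, hC0, hC⟩ := exists_bounded_poisson d
  refine ⟨2 * (C * K) - Real.log m, fun ρ hρm hρ0 hρK hρI => ?_⟩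
  have hρabs : ∀ᵐ x, |ρ x| ≤ K := by
    filter_upwards [hρ0, hρK] with x h1 h2
    rwa [abs_of_nonneg h1]
  have hρ2 : MemLp ρ 2 := memLp_of_abs_le hρm hρabs
  have hρi : Integrable ρ := hρ2.integrable (by simp)
  set m₀ := ∫ x, ρ x with hm₀
  have hm₀K : m₀ ≤ K := by
    have := integral_mono_ae hρi (integrable_const K) hρK
    simpa using this
  have hK : 0 < K := by linarith
  set b := Real.log K with hb
  have hbK : Real.exp b = K := Real.exp_log hK
  -- the subsolution
  obtain ⟨w, hw, hwC⟩ := hC (fun x => ρ x - m₀) K (hρm.sub aestronglyMeasurable_const) (by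
    filter_upwards [hρ0, hρK] with x h1 h2
    rw [abs_le]; constructor <;> linarith) (by
    rw [integral_sub hρi (integrable_const _)]; simp [hm₀])
  set c := Real.log m - C * K with hc
  set s : Torus d → ℝ := fun x => w x + c with hs
  have hsS : SolvesPoisson (fun x => ρ x - m₀) s := by
    have := hw.sub (solvesPoisson_const (-c)) (hρi.sub (integrable_const _)) (integrable_const 0)
    simpa [hs] using this
  have hsm : ∀ᵐ x, Real.exp (s x) ≤ m := by
    filter_upwards [hwC] with x hx
    rw [← Real.le_log_iff_exp_le hm]
    have := (abs_le.1 hx).2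
    simp only [hs, hc]; linarith
  have hsB : ∀ᵐ x, -(2 * (C * K) - Real.log m) ≤ s x := by
    filter_upwards [hwC] with x hx
    have := (abs_le.1 hx).1
    simp only [hs, hc]; linarith
  have hsb : ∀ᵐ x, s x ≤ b := by
    filter_upwards [hsm] with x hx
    rw [← Real.exp_le_exp, hbK]; linarith
  -- `t ↦ K t - e^t` increases below `b = log K`, which makes the iteration map monotone
  have hgmono : ∀ t t' : ℝ, t ≤ t' → t' ≤ b → K * t - Real.exp t ≤ K * t' - Real.exp t' := by
    intro t t' h1 h2
    have h3 := exp_sub_exp_le t t'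
    have h4 : Real.exp t' ≤ K := by rw [← hbK]; exact Real.exp_le_exp.2 h2
    nlinarith
  set B := 2 * (C * K) - Real.log m with hB
  set D := |B| + |b| with hD
  have habs : ∀ t : ℝ, -B ≤ t → t ≤ b → |t| ≤ D := fun t h1 h2 =>
    abs_le.2 ⟨by linarith [le_abs_self B, abs_nonneg b], by linarith [le_abs_self b, abs_nonneg B]⟩
  -- the functions between the subsolution and the supersolution; `step` solves
  -- `K Ψ - Δ Ψ = ρ - e^Φ + K Φ` among them
  let S : Type := {Φ : Torus d → ℝ // MemLp Φ 2 ∧ (∀ᵐ x, s x ≤ Φ x) ∧ ∀ᵐ x, Φ x ≤ b}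
  have hg2 : ∀ Φ : S, MemLp (fun x => ρ x - Real.exp (Φ.1 x) + K * Φ.1 x) 2 := fun Φ => by
    refine (hρ2.sub ?_).add (Φ.2.1.const_mul K)
    refine memLp_of_abs_le (M := K) (Real.continuous_exp.comp_aestronglyMeasurable Φ.2.1.1) ?_
    filter_upwards [Φ.2.2.2] with x hx
    rw [abs_of_pos (Real.exp_pos _), ← hbK]
    exact Real.exp_le_exp.2 hx
  have step : ∀ Φ : S, ∃ Ψ : S,
      SolvesPoisson (fun x => (ρ x - Real.exp (Φ.1 x) + K * Φ.1 x) - K * Ψ.1 x) Ψ.1 := by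
    intro Φ
    obtain ⟨Ψ, hΨ, -⟩ := exists_resolvent hK (hg2 Φ)
    have h2 : MemLp (fun x => (ρ x - Real.exp (Φ.1 x) + K * Φ.1 x) - K * Ψ x) 2 :=
      (hg2 Φ).sub (hΨ.1.1.const_mul K)
    refine ⟨⟨Ψ, hΨ.1.1, ?_, ?_⟩, hΨ⟩
    · refine hsS.ae_le hΨ (hρ2.sub (memLp_const _)) h2 ?_
      filter_upwards [hsm, Φ.2.2.1, Φ.2.2.2] with x h1 h2 h3 h4
      have := hgmono _ _ h2 h3
      nlinarith
    · refine hΨ.ae_le (solvesPoisson_const b) h2 (memLp_const 0) ?_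
      filter_upwards [hρK, Φ.2.2.2] with x h1 h2 h3
      have := hgmono _ _ h2 le_rfl
      nlinarith
  choose F hF using step
  let Φ₀ : S := ⟨fun _ => b, memLp_const b, hsb, Eventually.of_forall fun _ => le_rfl⟩
  let Φ : ℕ → S := fun n => F^[n] Φ₀
  have hΦs : ∀ n, Φ (n + 1) = F (Φ n) := fun n => Function.iterate_succ_apply' F n Φ₀
  have hSol : ∀ n, SolvesPoisson (fun x => (ρ x - Real.exp ((Φ n).1 x) + K * (Φ n).1 x)
      - K * (Φ (n + 1)).1 x) (Φ (n + 1)).1 := fun n => by rw [hΦs]; exact hF _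
  have hSol2 : ∀ n, MemLp (fun x => (ρ x - Real.exp ((Φ n).1 x) + K * (Φ n).1 x)
      - K * (Φ (n + 1)).1 x) 2 := fun n => (hg2 _).sub ((Φ (n + 1)).2.1.const_mul K)
  have hanti : ∀ n, ∀ᵐ x, (Φ (n + 1)).1 x ≤ (Φ n).1 x := by
    intro n
    induction n with
    | zero => exact (Φ 1).2.2.2
    | succ n ih =>
      refine (hSol (n + 1)).ae_le (hSol n) (hSol2 _) (hSol2 _) ?_
      filter_upwards [ih, (Φ n).2.2.2] with x h1 h2 h3
      have := hgmono _ _ h1 h2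
      nlinarith
  have hbd : ∀ n, ∀ᵐ x, |(Φ n).1 x| ≤ D := fun n => by
    filter_upwards [hsB, (Φ n).2.2.1, (Φ n).2.2.2] with x h1 h2 h3
    exact habs _ (h1.trans h2) h3
  set Φl : Torus d → ℝ := fun x => ⨅ n, (Φ n).1 x with hΦl
  have hlim : ∀ᵐ x, Tendsto (fun n => (Φ n).1 x) atTop (𝓝 (Φl x)) := by
    filter_upwards [ae_all_iff.2 hanti, ae_all_iff.2 hbd] with x h1 h2
    refine tendsto_atTop_ciInf (antitone_nat_of_succ_le h1) ⟨-D, ?_⟩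
    rintro _ ⟨n, rfl⟩
    exact (abs_le.1 (h2 n)).1
  have hfbd : ∀ n, ∀ᵐ x, |(ρ x - Real.exp ((Φ n).1 x) + K * (Φ n).1 x) - K * (Φ (n + 1)).1 x|
      ≤ K + K + K * D + K * D := fun n => by
    filter_upwards [hρabs, (Φ n).2.2.2, hbd n, hbd (n + 1)] with x h1 h2 h3 h4
    have h5 : Real.exp ((Φ n).1 x) ≤ K := by rw [← hbK]; exact Real.exp_le_exp.2 h2
    have h6 := Real.exp_pos ((Φ n).1 x)
    rw [abs_le] at *
    constructor <;> nlinarith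
  have hΦ' : SolvesPoisson (fun x => (ρ x - Real.exp (Φl x) + K * Φl x) - K * Φl x) Φl := by
    refine SolvesPoisson.of_tendsto (C := (K + K + K * D + K * D) * D) hSol (fun n => (hSol2 n).1)
      (integrable_const (K + K + K * D + K * D)) hfbd ?_ (memLp_const D) (fun n => hbd (n + 1)) ?_
      (fun n => ?_)
    · filter_upwards [hlim] with x hx
      have hx' := hx.comp (tendsto_add_atTop_nat 1)
      exact (((Real.continuous_exp.tendsto _).comp hx).const_sub _ |>.add (hx.const_mul K)).sub
        (hx'.const_mul K)
    · filter_upwards [hlim] with x hx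
      exact hx.comp (tendsto_add_atTop_nat 1)
    · rw [(hSol n).energy_eq (hSol2 n) (Φ (n + 1)).2.1]
      have h1 : ∀ᵐ x, ((ρ x - Real.exp ((Φ n).1 x) + K * (Φ n).1 x) - K * (Φ (n + 1)).1 x)
          * (Φ (n + 1)).1 x ≤ (K + K + K * D + K * D) * D := by
        filter_upwards [hfbd n, hbd (n + 1)] with x h2 h3
        refine (le_abs_self _).trans ?_
        rw [abs_mul]
        exact mul_le_mul h2 h3 (abs_nonneg _) ((abs_nonneg _).trans h2)
      have := integral_mono_ae ((hSol2 n).integrable_mul (Φ (n + 1)).2.1) (integrable_const _) h1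
      simpa using this
  have hle : ∀ᵐ x, Φl x ≤ b := by
    filter_upwards [hlim, ae_all_iff.2 fun n => (Φ n).2.2.2] with x h1 h2
    exact le_of_tendsto' h1 h2
  have hge : ∀ᵐ x, -B ≤ Φl x := by
    filter_upwards [hlim, hsB, ae_all_iff.2 fun n => (Φ n).2.2.1] with x h1 h2 h3
    exact h2.trans (ge_of_tendsto' h1 h3)
  refine ⟨Φl, ⟨?_, hΦ'.congr (Eventually.of_forall fun x => ?_)
      (Eventually.of_forall fun x => rfl)⟩,
    hge, hle⟩
  · refine (memLp_of_abs_le (p := 1) (M := K)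
      (Real.continuous_exp.comp_aestronglyMeasurable hΦ'.1.1.1) ?_).integrable le_rfl
    filter_upwards [hle] with x hx
    rw [abs_of_pos (Real.exp_pos _), ← hbK]
    exact Real.exp_le_exp.2 hx
  · dsimp only; ring

/-! ### Exponential moments and solvability in `L^p` -/

lemma young_le {p q a b : ℝ} (hpq : p.HolderConjugate q) (ha : 0 ≤ a) (hb : 0 ≤ b) :
    a * b ≤ a ^ p + b ^ q := by
  refine (Real.young_inequality_of_nonneg ha hb hpq).trans ?_
  have h1 := Real.rpow_nonneg ha p
  have h2 := Real.rpow_nonneg hb q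
  exact add_le_add (div_le_self h1 hpq.lt.le) (div_le_self h2 hpq.symm.lt.le)

/-- Young's inequality for `a e^{(r-1)t}`, arranged to compare `a ^ r` with `(e^t) ^ r`. -/
lemma young_exp {r a : ℝ} (hr : 1 ≤ r) (ha : 0 ≤ a) (t : ℝ) :
    r * ((a - Real.exp t) * Real.exp ((r - 1) * t)) ≤ a ^ r - Real.exp (r * t) := by
  have he : Real.exp t * Real.exp ((r - 1) * t) = Real.exp (r * t) := by
    rw [← Real.exp_add]; congr 1; ring
  rcases hr.eq_or_lt with h1 | h1
  · subst h1; simp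
  · have h := Real.young_inequality_of_nonneg ha (Real.exp_pos ((r - 1) * t)).le
      (Real.HolderConjugate.conjExponent h1)
    have h2 : Real.exp ((r - 1) * t) ^ (Real.conjExponent r) = Real.exp (r * t) := by
      rw [← Real.exp_mul]; congr 1
      unfold Real.conjExponent
      have : r - 1 ≠ 0 := by linarith
      field_simp
    have h3 : (Real.conjExponent r)⁻¹ = 1 - r⁻¹ := by
      unfold Real.conjExponent
      have : r - 1 ≠ 0 := by linarith
      field_simp
    rw [h2, div_eq_mul_inv _ (Real.conjExponent r), h3] at h
    have h4 : r * (a * Real.exp ((r - 1) * t))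
        ≤ r * (a ^ r / r + Real.exp (r * t) * (1 - r⁻¹)) := by
      gcongr
    have h5 : r * (a ^ r / r + Real.exp (r * t) * (1 - r⁻¹)) = a ^ r + r * Real.exp (r * t)
        - Real.exp (r * t) := by field_simp; ring
    nlinarith

/-- Powers are dominated by exponentials. -/
lemma exists_rpow_le_exp {q c : ℝ} (hq : 0 < q) (hc : 0 < c) :
    ∃ A : ℝ, 0 < A ∧ ∀ s : ℝ, 0 ≤ s → s ^ q ≤ A * Real.exp (c * s) := by
  refine ⟨(q / c) ^ q, by positivity, fun s hs => ?_⟩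
  have h1 : s ≤ (q / c) * Real.exp (c / q * s) := by
    have := Real.add_one_le_exp (c / q * s)
    calc s = (q / c) * (c / q * s) := by field_simp
      _ ≤ _ := by gcongr; linarith
  calc s ^ q ≤ ((q / c) * Real.exp (c / q * s)) ^ q := by gcongr
    _ = (q / c) ^ q * Real.exp (c * s) := by
      rw [Real.mul_rpow (by positivity) (Real.exp_pos _).le, ← Real.exp_mul]
      congr 2; field_simp

lemma exists_abs_rpow_le_exp {q c : ℝ} (B : ℝ) (hq : 0 < q) (hc : 0 < c) :
    ∃ A : ℝ, 0 < A ∧ ∀ t : ℝ, -B ≤ t → |t| ^ q ≤ A * Real.exp (c * t) := by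
  obtain ⟨A, hA, h⟩ := exists_rpow_le_exp hq hc
  refine ⟨A * Real.exp (2 * c * |B|), by positivity, fun t ht => (h _ (abs_nonneg t)).trans ?_⟩
  rw [mul_assoc, ← Real.exp_add]
  gcongr
  have : |t| ≤ 2 * |B| + t := by
    rw [abs_le]; constructor <;> linarith [le_abs_self B, abs_nonneg B]
  nlinarith

/-- Fatou's lemma for real integrals. -/
lemma integrable_and_integral_le_of_tendsto {f : ℕ → Torus d → ℝ} {g : Torus d → ℝ} {C : ℝ}
    (hf : ∀ n, Integrable (f n)) (h0 : ∀ n, ∀ᵐ x, 0 ≤ f n x) (hC : ∀ n, ∫ x, f n x ≤ C)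
    (h : ∀ᵐ x, Tendsto (fun n => f n x) atTop (𝓝 (g x))) :
    Integrable g ∧ ∫ x, g x ≤ C := by
  have hgm : AEStronglyMeasurable g := aestronglyMeasurable_of_tendsto_ae _ (fun n => (hf n).1) h
  have hg0 : ∀ᵐ x, 0 ≤ g x := by
    filter_upwards [h, ae_all_iff.2 h0] with x h1 h2
    exact ge_of_tendsto' h1 h2
  have hC0 : 0 ≤ C := (integral_nonneg_of_ae (h0 0)).trans (hC 0)
  have hl : ∫⁻ x, ENNReal.ofReal (g x) ≤ ENNReal.ofReal C := by
    calc ∫⁻ x, ENNReal.ofReal (g x)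
        = ∫⁻ x, liminf (fun n => ENNReal.ofReal (f n x)) atTop := by
          apply lintegral_congr_ae
          filter_upwards [h] with x hx
          exact (ENNReal.tendsto_ofReal hx).liminf_eq.symm
      _ ≤ liminf (fun n => ∫⁻ x, ENNReal.ofReal (f n x)) atTop :=
          lintegral_liminf_le' fun n => (hf n).1.aemeasurable.ennreal_ofReal
      _ ≤ liminf (fun _ : ℕ => ENNReal.ofReal C) atTop := by
          refine liminf_le_liminf (Eventually.of_forall fun n => ?_)
          rw [← ofReal_integral_eq_lintegral_ofReal (hf n) (h0 n)]
          exact ENNReal.ofReal_le_ofReal (hC n)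
      _ = ENNReal.ofReal C := by simp
  refine ⟨⟨hgm, ?_⟩, ?_⟩
  · rw [hasFiniteIntegral_iff_ofReal hg0]
    exact hl.trans_lt ENNReal.ofReal_lt_top
  · rw [integral_eq_lintegral_of_nonneg_ae hg0 hgm]
    exact ENNReal.toReal_le_of_le_ofReal hC0 hl

/-- `‖e^Φ‖_{L^r} ≤ ‖ρ‖_{L^r}` for bounded solutions, from the test function `e^{(r-1)Φ}`. -/
lemma SolvesPB.integral_exp_le_of_bounded {ρ Φ : Torus d → ℝ} (hΦ : SolvesPB ρ Φ) {K D r : ℝ}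
    (hr : 1 ≤ r) (hρ0 : ∀ᵐ x, 0 ≤ ρ x) (hρK : ∀ᵐ x, |ρ x| ≤ K) (hρm : AEStronglyMeasurable ρ)
    (hD : ∀ᵐ x, |Φ x| ≤ D) :
    Integrable (fun x => Real.exp (r * Φ x)) ∧ ∫ x, Real.exp (r * Φ x) ≤ ∫ x, ρ x ^ r := by
  have hΦm := hΦ.2.1.1.1
  have hD0 : 0 ≤ D := by
    obtain ⟨x, hx⟩ := hD.exists
    exact (abs_nonneg _).trans hx
  have hρ2 : MemLp ρ 2 := memLp_of_abs_le hρm hρK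
  have hexp : ∀ c : ℝ, MemLp (fun x => Real.exp (c * Φ x)) 2 := fun c => by
    refine memLp_of_abs_le (M := Real.exp (|c| * D)) ?_ ?_
    · exact Real.continuous_exp.comp_aestronglyMeasurable (hΦm.const_mul c)
    · filter_upwards [hD] with x hx
      rw [abs_of_pos (Real.exp_pos _), Real.exp_le_exp]
      refine (le_abs_self _).trans ?_
      rw [abs_mul]; gcongr
  have hf2 : MemLp (fun x => ρ x - Real.exp (Φ x)) 2 := by
    have h1 := hexp 1
    simp only [one_mul] at h1
    exact hρ2.sub h1
  set v : Torus d → ℝ := fun x => Real.exp ((r - 1) * clamp (-D) D (Φ x)) with hv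
  have hvae : ∀ᵐ x, v x = Real.exp ((r - 1) * Φ x) := by
    filter_upwards [hD] with x hx
    have h1 := abs_le.1 hx
    simp only [hv, clamp, min_eq_right h1.2, max_eq_right h1.1]
  have hv2 : MemLp v 2 := (hexp (r - 1)).ae_eq (by filter_upwards [hvae] with x hx; exact hx.symm)
  have hr0 : 0 ≤ r - 1 := by linarith
  have key : ∀ s t : ℝ, s ≤ t → |Real.exp ((r - 1) * clamp (-D) D s) -
      Real.exp ((r - 1) * clamp (-D) D t)| ≤ (Real.exp ((r - 1) * D) * (r - 1)) * |s - t| := by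
    intro s t hst
    have h1 := clamp_mono (-D) D hst
    have h2 : Real.exp ((r - 1) * clamp (-D) D s) ≤ Real.exp ((r - 1) * clamp (-D) D t) := by
      gcongr
    rw [abs_sub_comm, abs_of_nonneg (by linarith), abs_sub_comm, abs_of_nonneg (by linarith)]
    refine (exp_sub_exp_le _ _).trans ?_
    have h3 := clamp_sub_le (a := -D) (b := D) hst
    have h4 : clamp (-D) D t ≤ D := clamp_le (by linarith) t
    rw [← mul_sub, mul_assoc]
    gcongr
  have hvH : H1 v := by
    refine H1_of_abs_sub_le hΦ.2.1 hv2 (Real.exp ((r - 1) * D) * (r - 1)) fun x y => ?_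
    rcases le_total (Φ x) (Φ y) with h | h
    · exact key _ _ h
    · rw [abs_sub_comm, abs_sub_comm (Φ x)]; exact key _ _ h
  have h0 : 0 ≤ energy Φ v := by
    refine energy_nonneg_of_monotone hΦ.2.1 hvH fun x y => ?_
    rcases le_total (Φ x) (Φ y) with h | h
    · refine mul_nonneg_of_nonpos_of_nonpos (by linarith) (sub_nonpos.2 ?_)
      have := clamp_mono (-D) D h
      simp only [hv]; gcongr
    · refine mul_nonneg (by linarith) (sub_nonneg.2 ?_)
      have := clamp_mono (-D) D h
      simp only [hv]; gcongr
  rw [hΦ.2.energy_eq hf2 hv2] at h0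
  have hρr : Integrable fun x => ρ x ^ r := by
    refine (memLp_of_abs_le (p := 1) (M := K ^ r)
        (hρm.aemeasurable.pow_const r).aestronglyMeasurable
      ?_).integrable le_rfl
    filter_upwards [hρ0, hρK] with x h1 h2
    rw [abs_of_nonneg h1] at h2
    rw [abs_of_nonneg (by positivity)]
    gcongr
  have hei := (hexp r).integrable (by simp)
  refine ⟨hei, ?_⟩
  have h1 : r * ∫ x, (ρ x - Real.exp (Φ x)) * v x ≤ ∫ x, (ρ x ^ r - Real.exp (r * Φ x)) := by
    rw [← integral_const_mul]
    refine integral_mono_ae ((hf2.integrable_mul hv2).const_mul r) (hρr.sub hei) ?_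
    filter_upwards [hvae, hρ0] with x h2 h3
    simp only [h2]
    exact young_exp hr h3 _
  rw [integral_sub hρr hei] at h1
  have h2 : 0 ≤ r * ∫ x, (ρ x - Real.exp (Φ x)) * v x := by positivity
  linarith

lemma memLp_of_integrable_exp {Φ : Torus d → ℝ} {p q B : ℝ} (hp : 0 < p) (hq : 0 < q)
    (hΦ : AEStronglyMeasurable Φ) (hB : ∀ᵐ x, -B ≤ Φ x)
    (hi : Integrable fun x => Real.exp (p * Φ x)) : MemLp Φ (ENNReal.ofReal q) := by
  obtain ⟨A, hA, h⟩ := exists_abs_rpow_le_exp B hq hp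
  rw [← integrable_norm_rpow_iff hΦ (by simpa using hq) (by simp), ENNReal.toReal_ofReal hq.le]
  refine (hi.const_mul A).mono' (hΦ.norm.aemeasurable.pow_const q).aestronglyMeasurable ?_
  filter_upwards [hB] with x hx
  rw [Real.norm_of_nonneg (by positivity), Real.norm_eq_abs]
  exact h _ hx

lemma integrable_rpow_of_memLp {ρ : Torus d → ℝ} {p : ℝ}
    (hρ : MemLp ρ (ENNReal.ofReal p)) (hρ0 : ∀ᵐ x, 0 ≤ ρ x) {r : ℝ} (hr : 1 ≤ r) (hrp : r ≤ p) :
    Integrable fun x => ρ x ^ r := by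
  have h1 : MemLp ρ (ENNReal.ofReal r) := hρ.mono_exponent (ENNReal.ofReal_le_ofReal hrp)
  have h2 := h1.integrable_norm_rpow (by simp; linarith) (by simp)
  rw [ENNReal.toReal_ofReal (by linarith)] at h2
  refine h2.congr ?_
  filter_upwards [hρ0] with x hx
  rw [Real.norm_of_nonneg hx]

/-- **Existence** for densities in `L^p_+`, by monotone approximation with the densities
`min ρ k`.  The lower bound is the one for a single truncated density, whose mass is controlled by
the mass and the `L^p` norm of `ρ`. -/
theorem exists_solvesPB (d : ℕ) {p m M : ℝ} (hp : 1 < p) (hm : 0 < m) :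
    ∃ B : ℝ, ∀ ρ : Torus d → ℝ, MemLp ρ (ENNReal.ofReal p) → (∀ᵐ x, 0 ≤ ρ x) →
      m ≤ ∫ x, ρ x → ∫ x, ρ x ^ p ≤ M →
      ∃ Φ : Torus d → ℝ, SolvesPB ρ Φ ∧ (∀ᵐ x, -B ≤ Φ x) ∧ ∀ r, 1 ≤ r → r ≤ p →
        Integrable (fun x => Real.exp (r * Φ x)) ∧ ∫ x, Real.exp (r * Φ x) ≤ ∫ x, ρ x ^ r := by
  -- a truncation level at which at least half of the mass survives
  obtain ⟨K, hK1, hKm⟩ : ∃ K : ℝ, 1 ≤ K ∧ K ^ (1 - p) * M ≤ m / 2 := by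
    have h1 : Tendsto (fun K : ℝ => K ^ (1 - p) * M) atTop (𝓝 (0 * M)) := by
      have := tendsto_rpow_neg_atTop (y := p - 1) (by linarith)
      simp only [neg_sub] at this
      exact this.mul_const M
    rw [zero_mul] at h1
    exact ((eventually_ge_atTop 1).and (h1.eventually_le_const (by positivity))).exists
  obtain ⟨B, hB⟩ := exists_solvesPB_of_bounded d (K := K) (m := m / 2) (by positivity)
  refine ⟨B, fun ρ hρp hρ0 hρI hρM => ?_⟩
  have hρm := hρp.1
  have hp1 : (1 : ℝ≥0∞) ≤ ENNReal.ofReal p := by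
    rw [← ENNReal.ofReal_one]; exact ENNReal.ofReal_le_ofReal hp.le
  have hρi : Integrable ρ := hρp.integrable hp1
  set ρt : ℕ → Torus d → ℝ := fun n x => min (ρ x) (K + n) with hρt
  have htm : ∀ n, AEStronglyMeasurable (ρt n) := fun n => hρm.inf aestronglyMeasurable_const
  have ht0 : ∀ n, ∀ᵐ x, 0 ≤ ρt n x := fun n => by
    filter_upwards [hρ0] with x hx
    exact le_min hx (by positivity)
  have htK : ∀ n : ℕ, ∀ᵐ x, ρt n x ≤ K + n := fun n =>
      Eventually.of_forall fun x => min_le_right _ _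
  have htabs : ∀ n : ℕ, ∀ᵐ x, |ρt n x| ≤ K + n := fun n => by
    filter_upwards [ht0 n, htK n] with x h1 h2
    rwa [abs_of_nonneg h1]
  have hti : ∀ n, Integrable (ρt n) := fun n =>
    (memLp_of_abs_le (p := 1) (htm n) (htabs n)).integrable le_rfl
  have htle : ∀ n x, ρt n x ≤ ρ x := fun n x => min_le_left _ _
  have htmono : ∀ n x, ρt n x ≤ ρt (n + 1) x := fun n x => by
    simp only [hρt]; push_cast; gcongr; linarith
  have htI0 : m / 2 ≤ ∫ x, ρt 0 x := by
    have hpw : ∀ᵐ x, ρ x - ρt 0 x ≤ K ^ (1 - p) * ρ x ^ p := by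
      filter_upwards [hρ0] with x hx
      simp only [hρt, Nat.cast_zero, add_zero]
      rcases le_total (ρ x) K with h | h
      · rw [min_eq_left h, sub_self]; positivity
      · have h3 : 0 < ρ x := by linarith
        calc ρ x - min (ρ x) K ≤ ρ x := by rw [min_eq_right h]; linarith
          _ = ρ x ^ (1 - p) * ρ x ^ p := by
            rw [← Real.rpow_add h3]; simp
          _ ≤ K ^ (1 - p) * ρ x ^ p := by
            gcongr ?_ * _
            exact Real.rpow_le_rpow_of_nonpos (by linarith) h (by linarith)
    have h1 := integral_mono_ae (hρi.sub (hti 0))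
      ((integrable_rpow_of_memLp hρp hρ0 hp.le le_rfl).const_mul (K ^ (1 - p))) hpw
    rw [integral_const_mul] at h1
    have h2 : ∫ x, (ρ - ρt 0) x = (∫ x, ρ x) - ∫ x, ρt 0 x := integral_sub hρi (hti 0)
    have h3 : K ^ (1 - p) * ∫ x, ρ x ^ p ≤ K ^ (1 - p) * M := by gcongr
    linarith
  have htI : ∀ n, m / 2 ≤ ∫ x, ρt n x := fun n => by
    refine htI0.trans (integral_mono (hti 0) (hti n) fun x => ?_)
    simp only [hρt]; gcongr; simp
  have hex : ∀ n : ℕ, ∃ Φ : Torus d → ℝ, SolvesPB (ρt n) Φ ∧ ∃ D, ∀ᵐ x, |Φ x| ≤ D := fun n => by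
    obtain ⟨b, hb⟩ := exists_solvesPB_of_bounded d (K := K + n) (m := m / 2) (by positivity)
    obtain ⟨Φ, h1, h2, h3⟩ := hb (ρt n) (htm n) (ht0 n) (htK n) (htI n)
    refine ⟨Φ, h1, |b| + |Real.log (K + n)|, ?_⟩
    filter_upwards [h2, h3] with x h4 h5
    rw [abs_le]
    constructor <;> linarith [le_abs_self b, abs_nonneg b, le_abs_self (Real.log (K + n)),
      abs_nonneg (Real.log (K + n))]
  choose Φ hΦ D hD using hex
  have hmono : ∀ n, ∀ᵐ x, Φ n x ≤ Φ (n + 1) x := fun n =>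
    (hΦ n).mono (hΦ (n + 1)) (hti n) (hti (n + 1)) (Eventually.of_forall (htmono n))
  have hlow : ∀ n, ∀ᵐ x, -B ≤ Φ n x := by
    have h0 : ∀ᵐ x, -B ≤ Φ 0 x := by
      obtain ⟨Ψ, h1, h2, -⟩ := hB (ρt 0) (htm 0) (ht0 0) (by simpa using htK 0) htI0
      filter_upwards [h2, h1.mono (hΦ 0) (hti 0) (hti 0) (Eventually.of_forall fun x => le_rfl)]
        with x h3 h4
      linarith
    intro n
    filter_upwards [h0, ae_all_iff.2 hmono] with x h1 h2
    exact h1.trans (monotone_nat_of_le_succ h2 (Nat.zero_le n))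
  have hmom : ∀ n r, 1 ≤ r → r ≤ p → Integrable (fun x => Real.exp (r * Φ n x)) ∧
      ∫ x, Real.exp (r * Φ n x) ≤ ∫ x, ρ x ^ r := fun n r hr hrp => by
    obtain ⟨h1, h2⟩ := (hΦ n).integral_exp_le_of_bounded hr (ht0 n) (htabs n) (htm n) (hD n)
    refine ⟨h1, h2.trans ?_⟩
    refine integral_mono_of_nonneg ?_ (integrable_rpow_of_memLp hρp hρ0 hr hrp) ?_
    · filter_upwards [ht0 n] with x hx
      exact Real.rpow_nonneg hx r
    · filter_upwards [ht0 n] with x hx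
      exact Real.rpow_le_rpow hx (htle n x) (by linarith)
  -- the increasing limit is finite almost everywhere because `∫ e^{Φ_n}` stays bounded
  have hfin : ∀ᵐ x, BddAbove (Set.range fun n => Φ n x) := by
    have h1 : ∫⁻ x, ⨆ n, ENNReal.ofReal (Real.exp (1 * Φ n x))
        ≤ ENNReal.ofReal (∫ x, ρ x ^ (1 : ℝ)) := by
      rw [lintegral_iSup' (fun n => (hmom n 1 le_rfl hp.le).1.1.aemeasurable.ennreal_ofReal)]
      · refine iSup_le fun n => ?_
        rw [← ofReal_integral_eq_lintegral_ofReal (hmom n 1 le_rfl hp.le).1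
          (Eventually.of_forall fun x => (Real.exp_pos _).le)]
        exact ENNReal.ofReal_le_ofReal (hmom n 1 le_rfl hp.le).2
      · filter_upwards [ae_all_iff.2 hmono] with x hx
        refine monotone_nat_of_le_succ fun n => ?_
        have := hx n
        gcongr
    have h2 := ae_lt_top' (AEMeasurable.iSup fun n =>
      (hmom n 1 le_rfl hp.le).1.1.aemeasurable.ennreal_ofReal)
        (h1.trans_lt ENNReal.ofReal_lt_top).ne
    filter_upwards [h2] with x hx
    refine ⟨(⨆ n, ENNReal.ofReal (Real.exp (1 * Φ n x))).toReal, ?_⟩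
    rintro _ ⟨n, rfl⟩
    have h3 := le_iSup (fun n => ENNReal.ofReal (Real.exp (1 * Φ n x))) n
    have h4 := (ENNReal.ofReal_le_iff_le_toReal hx.ne).1 h3
    have h5 := Real.add_one_le_exp (1 * Φ n x)
    simp only [one_mul] at *
    linarith
  set Φl : Torus d → ℝ := fun x => ⨆ n, Φ n x with hΦl
  have hlim : ∀ᵐ x, Tendsto (fun n => Φ n x) atTop (𝓝 (Φl x)) := by
    filter_upwards [ae_all_iff.2 hmono, hfin] with x h1 h2
    exact tendsto_atTop_ciSup (monotone_nat_of_le_succ h1) h2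
  have hle : ∀ n, ∀ᵐ x, Φ n x ≤ Φl x := fun n => by
    filter_upwards [hfin] with x h2
    exact le_ciSup h2 n
  have hΦlm : AEStronglyMeasurable Φl :=
    aestronglyMeasurable_of_tendsto_ae _ (fun n => (hΦ n).2.1.1.1) hlim
  have hlowl : ∀ᵐ x, -B ≤ Φl x := by
    filter_upwards [hlow 0, hle 0] with x h1 h2
    linarith
  have hmoml : ∀ r, 1 ≤ r → r ≤ p → Integrable (fun x => Real.exp (r * Φl x)) ∧
      ∫ x, Real.exp (r * Φl x) ≤ ∫ x, ρ x ^ r := fun r hr hrp => by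
    refine integrable_and_integral_le_of_tendsto (fun n => (hmom n r hr hrp).1)
      (fun n => Eventually.of_forall fun x => (Real.exp_pos _).le) (fun n => (hmom n r hr hrp).2) ?_
    filter_upwards [hlim] with x hx
    exact (Real.continuous_exp.tendsto _).comp (hx.const_mul r)
  have hei : Integrable fun x => Real.exp (Φl x) := by simpa using (hmoml 1 le_rfl hp.le).1
  have hΦl2 : MemLp Φl 2 := by
    simpa using memLp_of_integrable_exp (q := 2) one_pos two_pos hΦlm hlowl
      (hmoml 1 le_rfl hp.le).1
  have hpq := Real.HolderConjugate.conjExponent hp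
  set q := Real.conjExponent p
  obtain ⟨A, hA, hAq⟩ := exists_abs_rpow_le_exp B hpq.symm.pos (by linarith : 0 < p)
  have hρpi := integrable_rpow_of_memLp hρp hρ0 hp.le le_rfl
  refine ⟨Φl, ⟨hei, ?_⟩, hlowl, hmoml⟩
  refine SolvesPoisson.of_tendsto (F := fun x => ρ x + Real.exp (Φl x))
    (G := fun x => |Φl x| + |B|) (C := (∫ x, ρ x ^ p) + (1 + 2 * A) * ∫ x, ρ x ^ p)
    (fun n => (hΦ n).2) (fun n => (htm n).sub (hΦ n).1.1) (hρi.add hei) (fun n => ?_) ?_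
    (hΦl2.abs.add (memLp_const _)) (fun n => ?_) hlim (fun n => ?_)
  · filter_upwards [ht0 n, hle n, hρ0] with x h1 h2 h3
    have h4 := Real.exp_le_exp.2 h2
    have h5 := htle n x
    have h6 := Real.exp_pos (Φ n x)
    rw [abs_le]; constructor <;> linarith
  · filter_upwards [hlim] with x hx
    refine Tendsto.sub ?_ ((Real.continuous_exp.tendsto _).comp hx)
    refine tendsto_const_nhds.congr' ?_
    filter_upwards [tendsto_natCast_atTop_atTop.eventually_ge_atTop (ρ x)] with n hn
    rw [hρt]
    exact (min_eq_left (by linarith)).symm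
  · filter_upwards [hlow n, hle n] with x h1 h2
    rw [abs_le]
    constructor <;> linarith [le_abs_self B, abs_nonneg B, le_abs_self (Φl x), abs_nonneg (Φl x)]
  · have hf2 : MemLp (fun x => ρt n x - Real.exp (Φ n x)) 2 := by
      refine (memLp_of_abs_le (htm n) (htabs n)).sub
        (memLp_of_abs_le (M := Real.exp (D n)) (hΦ n).1.1 ?_)
      filter_upwards [hD n] with x hx
      rw [abs_of_pos (Real.exp_pos _), Real.exp_le_exp]
      exact (le_abs_self _).trans hx
    rw [(hΦ n).2.energy_eq hf2 (hΦ n).2.1.1]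
    have hen := hmom n p hp.le le_rfl
    have hpw : ∀ᵐ x, (ρt n x - Real.exp (Φ n x)) * Φ n x
        ≤ ρ x ^ p + (1 + 2 * A) * Real.exp (p * Φ n x) := by
      filter_upwards [ht0 n, hlow n] with x h1 h2
      have h3 := young_le hpq h1 (abs_nonneg (Φ n x))
      have h4 := young_le hpq (Real.exp_pos (Φ n x)).le (abs_nonneg (Φ n x))
      have h5 := hAq _ h2
      have h6 : ρt n x ^ p ≤ ρ x ^ p := by gcongr; exact htle n x
      have h7 : Real.exp (Φ n x) ^ p = Real.exp (p * Φ n x) := by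
        rw [← Real.exp_mul, mul_comm]
      have h8 := mul_le_mul_of_nonneg_left (le_abs_self (Φ n x)) h1
      have h9 := mul_le_mul_of_nonneg_left (neg_abs_le (Φ n x)) (Real.exp_pos (Φ n x)).le
      rw [h7] at h4
      linarith
    have h1 := integral_mono_ae (hf2.integrable_mul (hΦ n).2.1.1)
      (hρpi.add (hen.1.const_mul (1 + 2 * A))) hpw
    refine h1.trans ?_
    have h2 : ∫ x, (ρ x ^ p + (1 + 2 * A) * Real.exp (p * Φ n x))
        = (∫ x, ρ x ^ p) + (1 + 2 * A) * ∫ x, Real.exp (p * Φ n x) := by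
      rw [integral_add hρpi (hen.1.const_mul _), integral_const_mul]
    refine h2.le.trans ?_
    have h3 := mul_le_mul_of_nonneg_left hen.2 (by positivity : 0 ≤ 1 + 2 * A)
    linarith

/-! ### Weak gradients and Fourier coefficients -/

/-- The covering map `ℝᵈ → 𝕋ᵈ`. -/
def cover (y : Fin d → ℝ) : Torus d := fun i => (y i : UnitAddCircle)

lemma isOpenQuotientMap_cover : IsOpenQuotientMap (cover (d := d)) :=
  IsOpenQuotientMap.piMap (f := fun (_ : Fin d) (t : ℝ) => (t : UnitAddCircle))
    fun _ => QuotientAddGroup.isOpenQuotientMap_mk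

lemma cover_add_single (y : Fin d → ℝ) (i : Fin d) (t : ℝ) :
    cover y + Pi.single i (t : UnitAddCircle) = cover (y + Pi.single i t) := by
  ext j
  by_cases h : j = i
  · subst h; simp [cover]
  · simp [cover, Pi.single_eq_of_ne h]

lemma TorusSmooth.hasDerivAt_lift {φ : Torus d → ℝ} (hφ : TorusSmooth φ) (y : Fin d → ℝ)
    (i : Fin d) (t : ℝ) :
    HasDerivAt (fun t : ℝ => φ (cover y + Pi.single i (t : UnitAddCircle)))
      (fderiv ℝ (fun y => φ (cover y)) (y + Pi.single i t) (Pi.single i 1)) t := by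
  simp_rw [cover_add_single]
  have h1 : HasFDerivAt (fun y => φ (cover y)) (fderiv ℝ (fun y => φ (cover y)) (y + Pi.single i t))
      (y + Pi.single i t) :=
    ((hφ.differentiable (by simp)) _).hasFDerivAt
  have h2 : HasDerivAt (fun t : ℝ => y + Pi.single i t) (Pi.single i (1 : ℝ)) t :=
    (hasDerivAt_single i t).const_add y
  exact h1.comp_hasDerivAt t h2

lemma TorusSmooth.torusGrad_cover {φ : Torus d → ℝ} (hφ : TorusSmooth φ) (y : Fin d → ℝ)
    (i : Fin d) :
    torusGrad φ (cover y) i = fderiv ℝ (fun y => φ (cover y)) y (Pi.single i 1) := by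
  have := (hφ.hasDerivAt_lift y i 0).deriv
  simpa [torusGrad] using this

lemma TorusSmooth.hasDerivAt {φ : Torus d → ℝ} (hφ : TorusSmooth φ) (x : Torus d) (i : Fin d)
    (t : ℝ) :
    HasDerivAt (fun t : ℝ => φ (x + Pi.single i (t : UnitAddCircle)))
      (torusGrad φ (x + Pi.single i (t : UnitAddCircle)) i) t := by
  obtain ⟨y, rfl⟩ := isOpenQuotientMap_cover.surjective x
  rw [cover_add_single y i t, hφ.torusGrad_cover]
  exact hφ.hasDerivAt_lift y i t

lemma TorusSmooth.torusGrad {φ : Torus d → ℝ} (hφ : TorusSmooth φ) (i : Fin d) :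
    TorusSmooth fun x => torusGrad φ x i := by
  have h : (fun y : Fin d → ℝ => _root_.torusGrad φ (cover y) i)
      = fun y => fderiv ℝ (fun y => φ (cover y)) y (Pi.single i 1) := by
    ext y; exact hφ.torusGrad_cover y i
  have h2 : ContDiff ℝ ∞ fun y => fderiv ℝ (fun y => φ (cover y)) y (Pi.single i 1) :=
    (ContDiff.fderiv_right (m := ∞) hφ (by simp)).clm_apply contDiff_const
  rw [← h] at h2
  exact h2

lemma TorusSmooth.continuous {φ : Torus d → ℝ} (hφ : TorusSmooth φ) : Continuous φ :=
  isOpenQuotientMap_cover.isQuotientMap.continuous_iff.2 (ContDiff.continuous hφ)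

lemma exists_abs_le_of_continuous {φ : Torus d → ℝ} (hφ : Continuous φ) : ∃ M, ∀ x, |φ x| ≤ M := by
  obtain ⟨M, hM⟩ := isCompact_univ.exists_bound_of_continuousOn hφ.continuousOn
  exact ⟨M, fun x => hM x (Set.mem_univ x)⟩

lemma memLp_of_continuous {φ : Torus d → ℝ} (hφ : Continuous φ) (p : ℝ≥0∞) : MemLp φ p := by
  obtain ⟨M, hM⟩ := exists_abs_le_of_continuous hφ
  exact memLp_of_abs_le hφ.aestronglyMeasurable (Eventually.of_forall hM)

/-- The Fourier coefficients of a partial derivative. -/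
lemma TorusSmooth.fc_torusGrad {φ : Torus d → ℝ} (hφ : TorusSmooth φ) (i : Fin d) (k : Fin d → ℤ) :
    fc (fun x => _root_.torusGrad φ x i) k = 2 * Real.pi * Complex.I * k i * fc φ k := by
  obtain ⟨M, hM⟩ := exists_abs_le_of_continuous (hφ.torusGrad i).continuous
  have htr : ∀ t : ℝ, Continuous fun x : Torus d => x + Pi.single i (t : UnitAddCircle) :=
    fun t => continuous_id.add continuous_const
  let F : ℝ → Torus d → ℂ := fun t x =>
    ((φ (x + Pi.single i (t : UnitAddCircle)) : ℝ) : ℂ) * mFourier (-k) x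
  let F' : ℝ → Torus d → ℂ := fun t x =>
    ((_root_.torusGrad φ (x + Pi.single i (t : UnitAddCircle)) i : ℝ) : ℂ) * mFourier (-k) x
  have hFc : ∀ t, Continuous (F t) := fun t =>
    (Complex.continuous_ofReal.comp (hφ.continuous.comp (htr t))).mul (mFourier (-k)).continuous
  have hF'c : ∀ t, Continuous (F' t) := fun t =>
    (Complex.continuous_ofReal.comp ((hφ.torusGrad i).continuous.comp (htr t))).mul
      (mFourier (-k)).continuous
  have hFi : Integrable (F 0) := integrable_mul_mFourier
    ((memLp_of_continuous (hφ.continuous.comp (htr 0)) 1).integrable le_rfl) _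
  have hbound : ∀ᵐ x : Torus d, ∀ t ∈ (Set.univ : Set ℝ), ‖F' t x‖ ≤ M :=
    Eventually.of_forall fun x t _ => by
      simp only [F']
      rw [norm_mul, norm_mFourier_apply, mul_one, Complex.norm_real]; exact hM _
  have hdiff : ∀ᵐ x : Torus d, ∀ t ∈ (Set.univ : Set ℝ), HasDerivAt (F · x) (F' t x) t :=
    Eventually.of_forall fun x t _ => ((hφ.hasDerivAt x i t).ofReal_comp).mul_const _
  have h1 : HasDerivAt (fun t => ∫ x, F t x) (∫ x, F' 0 x) 0 :=
    (hasDerivAt_integral_of_dominated_loc_of_deriv_le univ_mem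
      (Eventually.of_forall fun t => (hFc t).aestronglyMeasurable) hFi
      (hF'c 0).aestronglyMeasurable hbound (integrable_const M) hdiff).2
  have h2 : (fun t : ℝ => ∫ x, F t x)
      = fun t : ℝ => Complex.exp (2 * Real.pi * Complex.I * k i * t) * fc φ k := by
    ext t
    rw [← mFourier_single_coe, ← fc_translate]
    rfl
  rw [h2] at h1
  set c : ℂ := 2 * Real.pi * Complex.I * k i
  have h3 : HasDerivAt (fun t : ℝ => Complex.exp (c * t) * fc φ k) (c * fc φ k) 0 := by
    have h4 : HasDerivAt (fun t : ℝ => c * (t : ℂ)) c 0 := by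
      simpa using (Complex.ofRealCLM.hasDerivAt (x := (0 : ℝ))).const_mul c
    simpa using h4.cexp.mul_const (fc φ k)
  have h5 := h1.unique h3
  rw [← h5]
  simp [fc, F']

/-- `cos (2π k · x)`. -/
def cosFun (k : Fin d → ℤ) (x : Torus d) : ℝ := (mFourier k x).re

/-- `sin (2π k · x)`. -/
def sinFun (k : Fin d → ℤ) (x : Torus d) : ℝ := (mFourier k x).im

lemma contDiff_mFourier_cover (k : Fin d → ℤ) :
    ContDiff ℝ ∞ fun y : Fin d → ℝ => mFourier k (cover y) := by
  have h : (fun y : Fin d → ℝ => mFourier k (cover y))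
      = fun y => ∏ i, Complex.exp (2 * Real.pi * Complex.I * k i * (y i : ℝ)) := by
    ext y
    simp only [mFourier, ContinuousMap.coe_mk, cover, fourier_coe_apply]
    simp
  rw [h]
  refine contDiff_prod fun i _ => ?_
  exact (contDiff_const.mul (Complex.ofRealCLM.contDiff.comp (contDiff_apply ℝ ℝ i))).cexp

lemma torusSmooth_cosFun (k : Fin d → ℤ) : TorusSmooth (cosFun k) :=
  Complex.reCLM.contDiff.comp (contDiff_mFourier_cover k)

lemma torusSmooth_sinFun (k : Fin d → ℤ) : TorusSmooth (sinFun k) :=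
  Complex.imCLM.contDiff.comp (contDiff_mFourier_cover k)

lemma hasDerivAt_mFourier (k : Fin d → ℤ) (x : Torus d) (i : Fin d) :
    HasDerivAt (fun t : ℝ => mFourier k (x + Pi.single i (t : UnitAddCircle)))
      (2 * Real.pi * Complex.I * k i * mFourier k x) 0 := by
  simp_rw [mFourier_apply_add, mFourier_single_coe]
  set c : ℂ := 2 * Real.pi * Complex.I * k i
  have h4 : HasDerivAt (fun t : ℝ => c * (t : ℂ)) c 0 := by
    simpa using (Complex.ofRealCLM.hasDerivAt (x := (0 : ℝ))).const_mul c
  have := h4.cexp.const_mul (mFourier k x)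
  simpa [mul_comm] using this

lemma torusGrad_cosFun (k : Fin d → ℤ) (x : Torus d) (i : Fin d) :
    torusGrad (cosFun k) x i = -(2 * Real.pi * k i) * sinFun k x := by
  have h := (Complex.reCLM.hasFDerivAt.comp_hasDerivAt 0 (hasDerivAt_mFourier k x i)).deriv
  have e : (2 * Real.pi * Complex.I * k i * mFourier k x).re
      = -(2 * Real.pi * k i) * (mFourier k x).im := by
    simp [Complex.mul_re, Complex.mul_im]
  simp only [torusGrad, cosFun, sinFun]
  rw [← e]
  exact h

lemma torusGrad_sinFun (k : Fin d → ℤ) (x : Torus d) (i : Fin d) :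
    torusGrad (sinFun k) x i = (2 * Real.pi * k i) * cosFun k x := by
  have h := (Complex.imCLM.hasFDerivAt.comp_hasDerivAt 0 (hasDerivAt_mFourier k x i)).deriv
  have e : (2 * Real.pi * Complex.I * k i * mFourier k x).im
      = (2 * Real.pi * k i) * (mFourier k x).re := by
    simp [Complex.mul_re, Complex.mul_im]
  simp only [torusGrad, cosFun, sinFun]
  rw [← e]
  exact h

lemma fc_eq_cos_sin {u : Torus d → ℝ} (hu : Integrable u) (k : Fin d → ℤ) :
    fc u k = ((∫ x, u x * cosFun k x : ℝ) : ℂ) - ((∫ x, u x * sinFun k x : ℝ) : ℂ) * Complex.I := by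
  have h := integrable_mul_mFourier hu (-k)
  have h1 : ∀ x, ((u x : ℂ) * mFourier (-k) x).re = u x * cosFun k x := fun x => by
    rw [mFourier_neg]; simp [cosFun]
  have h2 : ∀ x, ((u x : ℂ) * mFourier (-k) x).im = -(u x * sinFun k x) := fun x => by
    rw [mFourier_neg]; simp [sinFun]
  have h3 := integral_re_add_im h
  simp only [RCLike.re_eq_complex_re, RCLike.im_eq_complex_im, h1, h2, integral_neg] at h3
  unfold fc
  rw [← h3]
  simp [sub_eq_add_neg]

lemma integral_mul_cosFun {u : Torus d → ℝ} (hu : Integrable u) (k : Fin d → ℤ) :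
    ∫ x, u x * cosFun k x = (fc u k).re := by
  rw [fc_eq_cos_sin hu]; simp

lemma integral_mul_sinFun {u : Torus d → ℝ} (hu : Integrable u) (k : Fin d → ℤ) :
    ∫ x, u x * sinFun k x = -(fc u k).im := by
  rw [fc_eq_cos_sin hu]; simp

/-- Weak gradients in terms of Fourier coefficients. -/
lemma isL2WeakGrad_iff {u : Torus d → ℝ} (hu : MemLp u 2) {G : Torus d → Vec d} :
    IsL2WeakGrad u G ↔ MemLp G 2 ∧
      ∀ i k, fc (fun x => G x i) k = 2 * Real.pi * Complex.I * k i * fc u k := by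
  have hui : Integrable u := hu.integrable (by simp)
  refine and_congr_right fun hG => ⟨fun h i k => ?_, fun h φ hφ i => ?_⟩
  · have hGi : Integrable fun x => G x i := (hG.eval_piLp i).integrable (by simp)
    have h1 := h _ (torusSmooth_cosFun k) i
    have h2 := h _ (torusSmooth_sinFun k) i
    simp_rw [torusGrad_cosFun, mul_left_comm (u _), integral_const_mul,
      integral_mul_sinFun hui, integral_mul_cosFun hGi] at h1
    simp_rw [torusGrad_sinFun, mul_left_comm (u _), integral_const_mul,
      integral_mul_cosFun hui, integral_mul_sinFun hGi] at h2
    apply Complex.ext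
    · simp [Complex.mul_re, Complex.mul_im]; linarith
    · simp [Complex.mul_re, Complex.mul_im]; linarith
  · have h1 := hasSum_fc_mul hu (memLp_of_continuous (hφ.torusGrad i).continuous 2)
    have h2 := (hasSum_fc_mul (hG.eval_piLp i) (memLp_of_continuous hφ.continuous 2)).neg
    refine h1.unique (h2.congr_fun fun k => ?_)
    rw [hφ.fc_torusGrad, h]
    simp [Complex.mul_re, Complex.mul_im]
    ring

lemma norm_two_pi_I_mul (n : ℤ) (z : ℂ) :
    ‖2 * Real.pi * Complex.I * n * z‖ ^ 2 = (2 * Real.pi * n) ^ 2 * ‖z‖ ^ 2 := by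
  simp [mul_pow]

/-- The definition of `W^{1,2}` by weak gradients agrees with the one by Fourier coefficients. -/
lemma memW12_iff {u : Torus d → ℝ} : MemW12 u ↔ H1 u := by
  refine and_congr_right fun hu => ⟨?_, fun h => ?_⟩
  · rintro ⟨G, hG⟩
    obtain ⟨hG2, hk⟩ := (isL2WeakGrad_iff hu).1 hG
    have h1 : Summable fun k => ∑ i, ‖fc (fun x => G x i) k‖ ^ 2 :=
      summable_sum fun i _ => (hasSum_norm_fc_sq (hG2.eval_piLp i)).summable
    refine h1.congr fun k => ?_
    simp_rw [hk, norm_two_pi_I_mul, ← Finset.sum_mul, ← lam_eq_sum]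
  · have hex : ∀ i : Fin d, ∃ g : Torus d → ℝ, MemLp g 2 ∧
        ∀ k, fc g k = 2 * Real.pi * Complex.I * k i * fc u k := fun i => by
      refine exists_fc_eq _ ?_ fun k => ?_
      · refine Summable.of_nonneg_of_le (fun k => sq_nonneg _) (fun k => ?_) h
        rw [norm_two_pi_I_mul, lam_eq_sum]
        gcongr
        exact Finset.single_le_sum (f := fun i => (2 * Real.pi * (k i : ℝ)) ^ 2)
          (fun j _ => sq_nonneg _) (Finset.mem_univ i)
      · rw [fc_neg_index]; simp [Complex.conj_ofNat]
    choose g hg hgk using hex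
    exact ⟨fun x => WithLp.toLp 2 fun i => g i x, (isL2WeakGrad_iff hu).2
      ⟨MemLp.of_eval_piLp hg, hgk⟩⟩

lemma H1.isL2WeakGrad {u : Torus d → ℝ} (hu : H1 u) : IsL2WeakGrad u (weakGrad u) := by
  have h := (memW12_iff.2 hu).2
  unfold weakGrad
  rw [dif_pos h]
  exact h.choose_spec

lemma TorusSmooth.isL2WeakGrad {φ : Torus d → ℝ} (hφ : TorusSmooth φ) :
    IsL2WeakGrad φ (_root_.torusGrad φ) :=
  (isL2WeakGrad_iff (memLp_of_continuous hφ.continuous 2)).2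
    ⟨MemLp.of_eval_piLp fun i => memLp_of_continuous (hφ.torusGrad i).continuous 2,
      fun i k => hφ.fc_torusGrad i k⟩

lemma IsL2WeakGrad.sub {u v : Torus d → ℝ} {G H : Torus d → Vec d} (hG : IsL2WeakGrad u G)
    (hH : IsL2WeakGrad v H) (hu : MemLp u 2) (hv : MemLp v 2) :
    IsL2WeakGrad (fun x => u x - v x) (G - H) := by
  obtain ⟨hG2, hGk⟩ := (isL2WeakGrad_iff hu).1 hG
  obtain ⟨hH2, hHk⟩ := (isL2WeakGrad_iff hv).1 hH
  refine (isL2WeakGrad_iff (hu.sub hv)).2 ⟨hG2.sub hH2, fun i k => ?_⟩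
  have := fc_sub ((hG2.eval_piLp i).integrable (by simp)) ((hH2.eval_piLp i).integrable (by simp)) k
  have h2 := fc_sub (hu.integrable (by simp)) (hv.integrable (by simp)) k
  rw [hGk, hHk, ← mul_sub, ← h2] at this
  exact this

lemma integral_inner_eq_sum {G H : Torus d → Vec d} (hG : MemLp G 2) (hH : MemLp H 2) :
    ∫ x, inner ℝ (G x) (H x) = ∑ i, ∫ x, G x i * H x i := by
  have h := integral_finsetSum (μ := (volume : Measure (Torus d))) Finset.univ
    (f := fun i x => G x i * H x i) fun i _ => (hG.eval_piLp i).integrable_mul (hH.eval_piLp i)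
  rw [← h]
  congr 1; ext x
  rw [PiLp.inner_apply]
  congr 1; ext i
  simp [mul_comm]

/-- The Dirichlet form is the integral of the product of weak gradients. -/
lemma IsL2WeakGrad.integral_inner {u v : Torus d → ℝ} {G H : Torus d → Vec d}
    (hG : IsL2WeakGrad u G) (hH : IsL2WeakGrad v H) (hu : MemLp u 2) (hv : MemLp v 2) :
    ∫ x, inner ℝ (G x) (H x) = energy u v := by
  obtain ⟨hG2, hGk⟩ := (isL2WeakGrad_iff hu).1 hG
  obtain ⟨hH2, hHk⟩ := (isL2WeakGrad_iff hv).1 hH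
  have h1 : HasSum (fun k => ∑ i, (fc (fun x => G x i) k * conj (fc (fun x => H x i) k)).re)
      (∑ i, ∫ x, G x i * H x i) :=
    hasSum_sum fun i _ => hasSum_fc_mul (hG2.eval_piLp i) (hH2.eval_piLp i)
  rw [integral_inner_eq_sum hG2 hH2, ← h1.tsum_eq, energy]
  congr 1; ext k
  rw [lam_eq_sum, Finset.sum_mul]
  congr 1; ext i
  rw [hGk, hHk]
  simp [Complex.mul_re, Complex.mul_im]
  ring

/-- Solutions in the sense of distributions are solutions in the sense of Fourier coefficients. -/
lemma isPBSolution_iff {ρ Φ : Torus d → ℝ} (hρ : Integrable ρ) :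
    IsPBSolution ρ Φ ↔ SolvesPB ρ Φ := by
  unfold IsPBSolution SolvesPB
  rw [memW12_iff]
  constructor
  · rintro ⟨hΦ, he, h⟩
    refine ⟨he, hΦ, fun k => ?_⟩
    have hf : Integrable fun x => ρ x - Real.exp (Φ x) := hρ.sub he
    have hG := hΦ.isL2WeakGrad
    obtain ⟨hG2, hGk⟩ := (isL2WeakGrad_iff hΦ.1).1 hG
    have hGi : ∀ i, Integrable fun x => weakGrad Φ x i := fun i =>
      (hG2.eval_piLp i).integrable (by simp)
    have key : ∀ (φ : Torus d → ℝ), TorusSmooth φ → ∑ i, ∫ x, weakGrad Φ x i * torusGrad φ x i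
        = ∫ x, (ρ x - Real.exp (Φ x)) * φ x := fun φ hφ => by
      rw [← h φ hφ, integral_inner_eq_sum hG2 hφ.isL2WeakGrad.1]
    have h1 := key _ (torusSmooth_cosFun k)
    have h2 := key _ (torusSmooth_sinFun k)
    simp_rw [torusGrad_cosFun, mul_left_comm (weakGrad Φ _ _), integral_const_mul,
      integral_mul_sinFun (hGi _), hGk] at h1
    simp_rw [torusGrad_sinFun, mul_left_comm (weakGrad Φ _ _), integral_const_mul,
      integral_mul_cosFun (hGi _), hGk] at h2
    rw [integral_mul_cosFun hf] at h1
    rw [integral_mul_sinFun hf] at h2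
    apply Complex.ext
    · rw [Complex.re_ofReal_mul, ← h1, lam_eq_sum, Finset.sum_mul]
      congr 1; ext i
      simp [Complex.mul_re, Complex.mul_im]; ring
    · rw [Complex.im_ofReal_mul, ← neg_inj, ← h2, lam_eq_sum, Finset.sum_mul,
        ← Finset.sum_neg_distrib]
      congr 1; ext i
      simp [Complex.mul_re, Complex.mul_im]; ring
  · rintro ⟨he, hS⟩
    refine ⟨hS.1, he, fun φ hφ => ?_⟩
    have hφ2 := memLp_of_continuous hφ.continuous 2
    obtain ⟨M, hM⟩ := exists_abs_le_of_continuous hφ.continuous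
    rw [hS.1.isL2WeakGrad.integral_inner hφ.isL2WeakGrad hS.1.1 hφ2]
    exact hS.energy_eq_of_bounded (hρ.sub he)
      (memW12_iff.1 ⟨hφ2, _, hφ.isL2WeakGrad⟩) (Eventually.of_forall hM)

/-! ### Strong stability -/

/-- `Φ` solves the Poisson–Boltzmann equation with density `ρ ∈ L^p`, `ρ ≥ 0`, is bounded below by
`-B`, and satisfies `e^Φ ∈ L^p` with `∫ e^{pΦ} ≤ ∫ ρ^p`. -/
structure RegularPB (p B : ℝ) (ρ Φ : Torus d → ℝ) : Prop where
  memLp : MemLp ρ (ENNReal.ofReal p)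
  nonneg : ∀ᵐ x, 0 ≤ ρ x
  solves : SolvesPB ρ Φ
  lower : ∀ᵐ x, -B ≤ Φ x
  integrable_exp : Integrable fun x => Real.exp (p * Φ x)
  integral_exp_le : ∫ x, Real.exp (p * Φ x) ≤ ∫ x, ρ x ^ p

lemma one_le_ofReal {p : ℝ} (hp : 1 ≤ p) : (1 : ℝ≥0∞) ≤ ENNReal.ofReal p := by
  rw [← ENNReal.ofReal_one]; exact ENNReal.ofReal_le_ofReal hp

section RegularPB

variable {p B : ℝ} {ρ Φ σ Ψ : Torus d → ℝ}

lemma RegularPB.integrable (h : RegularPB p B ρ Φ) (hp : 1 < p) : Integrable ρ :=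
  h.memLp.integrable (one_le_ofReal hp.le)

lemma RegularPB.mono (h : RegularPB p B ρ Φ) {B' : ℝ} (hB : B ≤ B') : RegularPB p B' ρ Φ :=
  ⟨h.memLp, h.nonneg, h.solves, by filter_upwards [h.lower] with x hx; linarith,
    h.integrable_exp, h.integral_exp_le⟩

lemma RegularPB.aestronglyMeasurable (h : RegularPB p B ρ Φ) : AEStronglyMeasurable Φ :=
  h.solves.2.1.1.1

lemma RegularPB.memLp_potential (h : RegularPB p B ρ Φ) (hp : 1 < p) {q : ℝ} (hq : 0 < q) :
    MemLp Φ (ENNReal.ofReal q) :=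
  memLp_of_integrable_exp (by linarith) hq h.aestronglyMeasurable h.lower h.integrable_exp

lemma RegularPB.memLp_exp (h : RegularPB p B ρ Φ) (hp : 1 < p) :
    MemLp (fun x => Real.exp (Φ x)) (ENNReal.ofReal p) := by
  rw [← integrable_norm_rpow_iff h.solves.1.1 (by simp; linarith) (by simp),
    ENNReal.toReal_ofReal (by linarith)]
  refine h.integrable_exp.congr (Eventually.of_forall fun x => ?_)
  dsimp only
  rw [Real.norm_of_nonneg (Real.exp_pos _).le, ← Real.exp_mul, mul_comm]

end RegularPB

lemma integrable_abs_rpow {u : Torus d → ℝ} {q : ℝ} (hq : 0 < q) (hu : MemLp u (ENNReal.ofReal q)) :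
    Integrable fun x => |u x| ^ q := by
  have := hu.integrable_norm_rpow (by simpa using hq) (by simp)
  rwa [ENNReal.toReal_ofReal hq.le] at this

lemma lpNorm_rpow {u : Torus d → ℝ} {q : ℝ} (hq : 0 < q) (hu : MemLp u (ENNReal.ofReal q)) :
    lpNorm u (ENNReal.ofReal q) volume ^ q = ∫ x, |u x| ^ q := by
  rw [lpNorm_eq_integral_norm_rpow_toReal (by simpa using hq) (by simp) hu.1,
    ENNReal.toReal_ofReal hq.le, Real.rpow_inv_rpow (by positivity) hq.ne']
  rfl

lemma lpNorm_mono_exponent {u : Torus d → ℝ} {q r : ℝ≥0∞} (hqr : q ≤ r) (hu : MemLp u r) :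
    lpNorm u q volume ≤ lpNorm u r volume := by
  rw [← toReal_eLpNorm hu.1, ← toReal_eLpNorm hu.1]
  exact ENNReal.toReal_mono hu.2.ne (eLpNorm_le_eLpNorm_of_exponent_le hqr hu.1)

/-- Quantitative monotonicity of the exponential on half-lines. -/
lemma exists_exp_coercive (B : ℝ) {q : ℝ} (hq : 2 ≤ q) :
    ∃ c : ℝ, 0 < c ∧ ∀ a b : ℝ, -B ≤ a → -B ≤ b →
      c * |a - b| ^ q ≤ (Real.exp a - Real.exp b) * (a - b) := by
  obtain ⟨A, hA, hAe⟩ := exists_rpow_le_exp (q := q - 1) (c := 1) (by linarith) one_pos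
  -- `t ^ (q - 1) ≤ t` for `t ≤ 1`, and `t ^ (q - 1) ≤ A e^t ≤ 2 A (e^t - 1)` for `t ≥ 1`
  have key : ∀ t : ℝ, 0 ≤ t → t ^ (q - 1) ≤ (1 + 2 * A) * (Real.exp t - 1) := by
    intro t ht
    have h0 : t ≤ Real.exp t - 1 := by linarith [Real.add_one_le_exp t]
    rcases le_total t 1 with h | h
    · have h1 : t ^ (q - 1) ≤ t ^ (1 : ℝ) := by
        rcases ht.eq_or_lt with h2 | h2
        · rw [← h2, Real.zero_rpow (by linarith), Real.zero_rpow one_ne_zero]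
        · exact Real.rpow_le_rpow_of_exponent_ge h2 h (by linarith)
      rw [Real.rpow_one] at h1
      nlinarith
    · have h1 := hAe t ht
      rw [one_mul] at h1
      nlinarith
  have key2 : ∀ a b : ℝ, -B ≤ b → b ≤ a →
      Real.exp (-B) / (1 + 2 * A) * |a - b| ^ q ≤ (Real.exp a - Real.exp b) * (a - b) := by
    intro a b hb hab
    have h1 := key (a - b) (by linarith)
    have h2 : Real.exp a = Real.exp b * Real.exp (a - b) := by rw [← Real.exp_add]; congr 1; ring
    have h3 : |a - b| ^ q = (a - b) ^ (q - 1) * (a - b) := by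
      rw [abs_of_nonneg (by linarith)]
      rcases hab.eq_or_lt with h4 | h4
      · rw [h4]; simp [Real.zero_rpow (by linarith : q ≠ 0)]
      · rw [← Real.rpow_add_one (by linarith)]; congr 1; ring
    have h4 : Real.exp (-B) ≤ Real.exp b := Real.exp_le_exp.2 hb
    have h5 : 0 ≤ Real.exp (a - b) - 1 := by linarith [Real.add_one_le_exp (a - b)]
    rw [h3, ← mul_assoc]
    refine mul_le_mul_of_nonneg_right ?_ (by linarith)
    rw [div_mul_eq_mul_div, div_le_iff₀ (by positivity), h2]
    calc Real.exp (-B) * (a - b) ^ (q - 1)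
        ≤ Real.exp b * ((1 + 2 * A) * (Real.exp (a - b) - 1)) := by
          gcongr
      _ = _ := by ring
  refine ⟨Real.exp (-B) / (1 + 2 * A), by positivity, fun a b ha hb => ?_⟩
  rcases le_total b a with h | h
  · exact key2 a b hb h
  · rw [abs_sub_comm]
    refine (key2 b a ha h).trans (le_of_eq ?_)
    ring

lemma exp_mul_sub_nonneg (a b : ℝ) : 0 ≤ (Real.exp a - Real.exp b) * (a - b) := by
  rcases le_total a b with h | h
  · exact mul_nonneg_of_nonpos_of_nonpos (by linarith [Real.exp_le_exp.2 h]) (by linarith)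
  · exact mul_nonneg (by linarith [Real.exp_le_exp.2 h]) (by linarith)

lemma integrable_mul_of_holder {f g : Torus d → ℝ} {p q : ℝ} (hpq : p.HolderConjugate q)
    (hf : MemLp f (ENNReal.ofReal p)) (hg : MemLp g (ENNReal.ofReal q)) :
    Integrable fun x => f x * g x := by
  have h : ENNReal.HolderTriple (ENNReal.ofReal p) (ENNReal.ofReal q) 1 := hpq.ennrealOfReal
  exact hf.integrable_mul hg

/-- The energy inequality for `-Δu = f` with `f ∈ L^p`, `u ∈ L^{p'}`, from the test functions
`clamp (-n) n u`. -/
lemma SolvesPoisson.energy_le {f u : Torus d → ℝ} (hu : SolvesPoisson f u) (hf : Integrable f)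
    (hfu : Integrable fun x => f x * u x) : energy u u ≤ ∫ x, f x * u x := by
  have hn : ∀ n : ℕ, (0 : ℝ) ≤ n := fun n => n.cast_nonneg
  set T : ℕ → Torus d → ℝ := fun n x => _root_.clamp (-(n : ℝ)) n (u x) with hT
  have hTH : ∀ n, H1 (T n) := fun n => hu.1.clamp _ _
  have hTlim : ∀ x, Tendsto (fun n => T n x) atTop (𝓝 (u x)) := fun x => by
    refine tendsto_const_nhds.congr' ?_
    filter_upwards [tendsto_natCast_atTop_atTop.eventually_ge_atTop |u x|] with n hn
    have := abs_le.1 hn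
    simp only [hT, _root_.clamp]
    rw [min_eq_right this.2, max_eq_right this.1]
  have hEn : ∀ n, energy (T n) (T n) ≤ ∫ x, f x * T n x := fun n => by
    rw [← hu.energy_eq_of_bounded hf (hTH n) (M := n)
      (Eventually.of_forall fun x => abs_clamp_le (hn n) _)]
    refine energy_le_energy (hTH n) (hTH n) hu.1 (hTH n) fun x y => ?_
    rcases le_total (u x) (u y) with h | h
    · have h1 := clamp_mono (-(n : ℝ)) n h
      have h2 := clamp_sub_le (a := -(n : ℝ)) (b := n) h
      simp only [hT]
      nlinarith
    · have h1 := clamp_mono (-(n : ℝ)) n h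
      have h2 := clamp_sub_le (a := -(n : ℝ)) (b := n) h
      simp only [hT]
      nlinarith
  have hlim : Tendsto (fun n => ∫ x, f x * T n x) atTop (𝓝 (∫ x, f x * u x)) := by
    refine tendsto_integral_of_dominated_convergence (fun x => |f x * u x|)
      (fun n => hf.1.mul (hTH n).1.1) hfu.abs (fun n => Eventually.of_forall fun x => ?_)
      (Eventually.of_forall fun x => (hTlim x).const_mul _)
    rw [Real.norm_eq_abs, abs_mul, abs_mul]
    exact mul_le_mul_of_nonneg_left (abs_clamp_le_abs (hn n) _) (abs_nonneg _)
  have hfc : ∀ k, Tendsto (fun n => fc (T n) k) atTop (𝓝 (fc u k)) :=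
    tendsto_fc_of_dominated (fun n => (hTH n).1.1) hu.1.integrable.abs
      (fun n => Eventually.of_forall fun x => abs_clamp_le_abs (hn n) _)
      (Eventually.of_forall hTlim)
  refine le_of_forall_pos_le_add fun ε hε => ?_
  refine (H1_of_tendsto (C := (∫ x, f x * u x) + ε) hTH hu.1.1 ?_ hfc).2
  filter_upwards [hlim.eventually_le_const (lt_add_of_pos_right _ hε)] with n h
  exact (hEn n).trans h

/-- The energy estimate for the difference of two solutions. -/
lemma RegularPB.energy_sub_le {p B : ℝ} (hp : 1 < p) {ρ σ Φ Ψ : Torus d → ℝ}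
    (h1 : RegularPB p B ρ Φ) (h2 : RegularPB p B σ Ψ) :
    Integrable (fun x => (Real.exp (Φ x) - Real.exp (Ψ x)) * (Φ x - Ψ x)) ∧
    Integrable (fun x => (ρ x - σ x) * (Φ x - Ψ x)) ∧
    energy (fun x => Φ x - Ψ x) (fun x => Φ x - Ψ x) +
      ∫ x, (Real.exp (Φ x) - Real.exp (Ψ x)) * (Φ x - Ψ x) ≤ ∫ x, (ρ x - σ x) * (Φ x - Ψ x) := by
  have hpq := Real.HolderConjugate.conjExponent hp
  have hu : MemLp (fun x => Φ x - Ψ x) (ENNReal.ofReal (Real.conjExponent p)) :=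
    (h1.memLp_potential hp hpq.symm.pos).sub (h2.memLp_potential hp hpq.symm.pos)
  have hi1 : Integrable (fun x => (Real.exp (Φ x) - Real.exp (Ψ x)) * (Φ x - Ψ x)) :=
    integrable_mul_of_holder hpq ((h1.memLp_exp hp).sub (h2.memLp_exp hp)) hu
  have hi2 : Integrable (fun x => (ρ x - σ x) * (Φ x - Ψ x)) :=
    integrable_mul_of_holder hpq (h1.memLp.sub h2.memLp) hu
  refine ⟨hi1, hi2, ?_⟩
  have hS := h1.solves.2.sub h2.solves.2 ((h1.integrable hp).sub h1.solves.1)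
    ((h2.integrable hp).sub h2.solves.1)
  have e : ∀ x, ((ρ x - Real.exp (Φ x)) - (σ x - Real.exp (Ψ x))) * (Φ x - Ψ x)
      = (ρ x - σ x) * (Φ x - Ψ x) - (Real.exp (Φ x) - Real.exp (Ψ x)) * (Φ x - Ψ x) :=
    fun x => by ring
  have hfi : Integrable fun x =>
      ((ρ x - Real.exp (Φ x)) - (σ x - Real.exp (Ψ x))) * (Φ x - Ψ x) := by
    simp_rw [e]; exact hi2.sub hi1
  have := hS.energy_le (((h1.integrable hp).sub h1.solves.1).sub
    ((h2.integrable hp).sub h2.solves.1)) hfi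
  simp_rw [e] at this
  rw [integral_sub hi2 hi1] at this
  linarith

/-- Young's inequality with a weight. -/
lemma exists_young_weight {p q : ℝ} (hpq : p.HolderConjugate q) {c : ℝ} (hc : 0 < c) :
    ∃ C : ℝ, 0 < C ∧ ∀ a b : ℝ, a * b ≤ C * |a| ^ p + c * |b| ^ q := by
  refine ⟨(c ^ (1 / q))⁻¹ ^ p, by positivity, fun a b => ?_⟩
  have h0 : 0 < c ^ (1 / q) := by positivity
  have hq := hpq.symm.pos
  have h1 := young_le hpq (a := (c ^ (1 / q))⁻¹ * |a|) (b := c ^ (1 / q) * |b|) (by positivity)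
    (by positivity)
  rw [Real.mul_rpow (by positivity) (abs_nonneg a), Real.mul_rpow h0.le (abs_nonneg b),
    ← Real.rpow_mul hc.le, one_div_mul_cancel hq.ne', Real.rpow_one] at h1
  refine le_trans ?_ h1
  calc a * b ≤ |a| * |b| := by rw [← abs_mul]; exact le_abs_self _
    _ = _ := by field_simp

lemma integral_mul_le_young {p q C c : ℝ} {f g : Torus d → ℝ}
    (hY : ∀ a b : ℝ, a * b ≤ C * |a| ^ p + c * |b| ^ q) (hi : Integrable fun x => f x * g x)
    (hf : Integrable fun x => |f x| ^ p) (hg : Integrable fun x => |g x| ^ q) :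
    ∫ x, f x * g x ≤ C * (∫ x, |f x| ^ p) + c * ∫ x, |g x| ^ q := by
  rw [← integral_const_mul, ← integral_const_mul,
    ← integral_add (hf.const_mul C) (hg.const_mul c)]
  exact integral_mono hi ((hf.const_mul C).add (hg.const_mul c)) fun x => hY _ _

lemma integrable_of_coercive {t c : ℝ} {u h : Torus d → ℝ} (hu : AEStronglyMeasurable u)
    (hh : Integrable h) (hc : 0 < c) (hB : ∀ᵐ x, c * |u x| ^ t ≤ h x) :
    Integrable (fun x => |u x| ^ t) ∧ c * ∫ x, |u x| ^ t ≤ ∫ x, h x := by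
  have hi : Integrable (fun x => |u x| ^ t) := by
    refine (hh.const_mul c⁻¹).mono' (hu.norm.aemeasurable.pow_const t).aestronglyMeasurable ?_
    filter_upwards [hB] with x hx
    rw [Real.norm_of_nonneg (by positivity), inv_mul_eq_div, le_div_iff₀ hc]
    linarith
  refine ⟨hi, ?_⟩
  rw [← integral_const_mul]
  exact integral_mono_ae (hi.const_mul c) hh hB

/-- **Strong stability** of the Poisson–Boltzmann equation, with constants depending on the lower
bound of the potentials only. -/
theorem exists_strong_stability {p q : ℝ} (hp : 1 < p) (hq : 1 ≤ q) (B : ℝ) :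
    ∃ l L : ℝ, 0 < l ∧ 0 < L ∧ ∀ ρ σ Φ Ψ : Torus d → ℝ, RegularPB p B ρ Φ → RegularPB p B σ Ψ →
      energy (fun x => Φ x - Ψ x) (fun x => Φ x - Ψ x) +
        l * lpNorm (fun x => Φ x - Ψ x) (ENNReal.ofReal q) volume ^ (2 * q / min q 2) ≤
      L * lpNorm (fun x => ρ x - σ x) (ENNReal.ofReal p) volume ^ (2 * p / max p 2) := by
  have hs1 : 1 < min p 2 := lt_min hp one_lt_two
  have hss := Real.HolderConjugate.conjExponent hs1
  set s := min p 2 with hs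
  set s' := Real.conjExponent s with hs'
  have hs2 : 2 ≤ s' := by
    rw [hs', Real.conjExponent, le_div_iff₀ (by linarith)]
    linarith [min_le_right p 2]
  -- coercivity is used twice: with `s'` to absorb the right-hand side, with `max q 2` for the claim
  obtain ⟨c, hc, hcoer⟩ := exists_exp_coercive B hs2
  obtain ⟨c2, hc2, hcoer2⟩ := exists_exp_coercive B (le_max_right q 2)
  obtain ⟨C, hC, hY⟩ := exists_young_weight hss (c := c / 2) (by positivity)
  -- the exponents are `2q / min {q, 2} = max {q, 2}` and `2p / max {p, 2} = min {p, 2}`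
  have hqe : 2 * q / min q 2 = max q 2 := by
    rw [div_eq_iff (by positivity), mul_comm 2 q, ← max_mul_min]
  have hpe : 2 * p / max p 2 = s := by
    rw [div_eq_iff (by positivity), mul_comm 2 p, ← max_mul_min p 2, mul_comm]
  refine ⟨c2 / 2, C, by positivity, hC, fun ρ σ Φ Ψ h1 h2 => ?_⟩
  obtain ⟨hi1, hi2, hE⟩ := h1.energy_sub_le hp h2
  set u : Torus d → ℝ := fun x => Φ x - Ψ x with hu
  set δ : Torus d → ℝ := fun x => ρ x - σ x with hδ
  have hum : AEStronglyMeasurable u := h1.aestronglyMeasurable.sub h2.aestronglyMeasurable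
  have hut : ∀ t : ℝ, 0 < t → MemLp u (ENNReal.ofReal t) := fun t ht =>
    (h1.memLp_potential hp ht).sub (h2.memLp_potential hp ht)
  have hδp : MemLp δ (ENNReal.ofReal p) := h1.memLp.sub h2.memLp
  have hδs : MemLp δ (ENNReal.ofReal s) :=
    hδp.mono_exponent (ENNReal.ofReal_le_ofReal (min_le_left _ _))
  obtain ⟨hi3, hI3⟩ := integrable_of_coercive (t := s') hum hi1 hc (by
    filter_upwards [h1.lower, h2.lower] with x h3 h4
    exact hcoer _ _ h3 h4)
  obtain ⟨hi4, hI4⟩ := integrable_of_coercive (t := max q 2) hum hi1 hc2 (by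
    filter_upwards [h1.lower, h2.lower] with x h3 h4
    exact hcoer2 _ _ h3 h4)
  have hδi := integrable_abs_rpow hss.pos hδs
  have hI5 : ∫ x, δ x * u x ≤ C * (∫ x, |δ x| ^ s) + c / 2 * ∫ x, |u x| ^ s' :=
    integral_mul_le_young hY hi2 hδi hi3
  have hE' : energy u u + ∫ x, (Real.exp (Φ x) - Real.exp (Ψ x)) * (Φ x - Ψ x)
      ≤ ∫ x, δ x * u x := hE
  have h6 : ∫ x, |δ x| ^ s ≤ lpNorm δ (ENNReal.ofReal p) volume ^ s := by
    rw [← lpNorm_rpow hss.pos hδs]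
    exact Real.rpow_le_rpow lpNorm_nonneg
      (lpNorm_mono_exponent (ENNReal.ofReal_le_ofReal (min_le_left p 2)) hδp) hss.pos.le
  have h7 : lpNorm u (ENNReal.ofReal q) volume ^ (max q 2) ≤ ∫ x, |u x| ^ (max q 2) := by
    have hpos : 0 < max q 2 := by positivity
    rw [← lpNorm_rpow hpos (hut _ hpos)]
    exact Real.rpow_le_rpow lpNorm_nonneg
      (lpNorm_mono_exponent (ENNReal.ofReal_le_ofReal (le_max_left q 2)) (hut _ hpos)) hpos.le
  rw [hqe, hpe]
  have h8 := mul_le_mul_of_nonneg_left h6 hC.le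
  have h9 := mul_le_mul_of_nonneg_left h7 hc2.le
  linarith

/-! ### Compactness for pairings -/

/-- The rate at which smoothing approximates functions in `W^{1,2}`. -/
lemma integral_smoothing_sub_sq_le {L : ℝ} (hL : 0 < L) {v w : Torus d → ℝ} (hv : H1 v)
    (hw : MemLp w 2) (hk : ∀ k, fc w k = smoothWeight L k * fc v k) :
    ∫ x, (v x - w x) ^ 2 ≤ d / L * energy v v := by
  rw [energy_self, ← tsum_mul_left,
    ← (hasSum_norm_fc_sq (u := fun x => v x - w x) (hv.1.sub hw)).tsum_eq]
  refine (hasSum_norm_fc_sq (u := fun x => v x - w x) (hv.1.sub hw)).summable.tsum_le_tsum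
    (fun k => ?_) (hv.2.mul_left _)
  have h0 := lam_nonneg k
  have h1 : (1 - smoothWeight L k) ^ 2 ≤ d / L * lam k := by
    have h2 := smoothWeight_nonneg hL k
    have h3 := smoothWeight_le_one hL k
    have h4 : 1 - smoothWeight L k ≤ d * (lam k / L) := by
      have hx : L / (L + lam k) = 1 + -(lam k / (L + lam k)) := by field_simp; ring
      have hx1 : lam k / (L + lam k) ≤ 1 := by rw [div_le_one (by positivity)]; linarith
      have h5 := one_add_mul_le_pow (a := -(lam k / (L + lam k))) (by linarith) d
      have h6 : lam k / (L + lam k) ≤ lam k / L := by gcongr; linarith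
      have h7 : (d : ℝ) * (lam k / (L + lam k)) ≤ d * (lam k / L) := by gcongr
      unfold smoothWeight
      rw [hx]
      linarith
    calc (1 - smoothWeight L k) ^ 2 ≤ 1 - smoothWeight L k := by nlinarith
      _ ≤ d * (lam k / L) := h4
      _ = _ := by ring
  rw [fc_sub hv.integrable (hw.integrable (by simp)), hk,
    show fc v k - smoothWeight L k * fc v k = ((1 - smoothWeight L k : ℝ) : ℂ) * fc v k by
      push_cast; ring, norm_mul, mul_pow, Complex.norm_real, Real.norm_eq_abs, sq_abs, ← mul_assoc]
  gcongr

lemma abs_sub_clamp_le {M : ℝ} (hM : 0 < M) (t : ℝ) : |t - clamp (-M) M t| ≤ |t| ^ 2 / M := by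
  rw [le_div_iff₀ hM]
  by_cases h : |t| ≤ M
  · have h1 := abs_le.1 h
    rw [clamp, min_eq_right h1.2, max_eq_right h1.1, sub_self, abs_zero, zero_mul]
    positivity
  · have h2 : |t - clamp (-M) M t| ≤ |t| := by
      unfold clamp
      rcases le_total 0 t with h0 | h0
      · rw [abs_of_nonneg h0] at *
        rw [min_eq_left (by linarith), max_eq_right (by linarith), abs_of_nonneg (by linarith)]
        linarith
      · rw [abs_of_nonpos h0] at *
        rw [min_eq_right (by linarith), max_eq_left (by linarith), abs_of_nonpos (by linarith)]
        linarith
    nlinarith [abs_nonneg t]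

/-- Pairings with smoothed functions only see finitely many frequencies, up to a small error. -/
lemma tendsto_integral_mul_smoothing {L M : ℝ} (hL : 1 ≤ L) {δ v w : ℕ → Torus d → ℝ} {C : ℝ}
    (hδ : ∀ n, Integrable (δ n)) (hC : ∀ n, ∫ x, |δ n x| ≤ C)
    (hfc : ∀ k, Tendsto (fun n => fc (δ n) k) atTop (𝓝 0))
    (hv : ∀ n, MemLp (v n) 2) (hM : ∀ n x, |v n x| ≤ M) (hw : ∀ n, MemLp (w n) 2)
    (hk : ∀ n k, fc (w n) k = smoothWeight L k * fc (v n) k) :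
    Tendsto (fun n => ∫ x, δ n x * w n x) atTop (𝓝 0) := by
  have hvM : ∀ n k, ‖fc (v n) k‖ ≤ M := fun n k => by
    refine (norm_fc_le k).trans ?_
    have := integral_mono ((hv n).integrable (by simp)).abs (integrable_const M) (hM n)
    simpa using this
  have hwM : ∀ n k, ‖fc (w n) k‖ ≤ smoothWeight L k * M := fun n k => by
    have h0 := smoothWeight_nonneg (by linarith : 0 < L) k
    rw [hk, norm_mul, Complex.norm_real, Real.norm_eq_abs, abs_of_nonneg h0]
    gcongr
    exact hvM n k
  have hM0 : 0 ≤ M := (norm_nonneg _).trans (hvM 0 0)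
  have e : ∀ n, ∫ x, δ n x * w n x = ∑' k, (fc (δ n) k * conj (fc (w n) k)).re := fun n =>
    (hasSum_fc_mul_of_summable (hδ n) (hw n) (summable_norm_fc_smoothing hL (hk n))).tsum_eq.symm
  simp_rw [e]
  rw [show (0 : ℝ) = ∑' _ : Fin d → ℤ, (0 : ℝ) by simp]
  refine tendsto_tsum_of_dominated_convergence
    (bound := fun k => C * (smoothWeight L k * M))
      (((summable_smoothWeight hL).mul_right M).mul_left C)
    (fun k => ?_) (Eventually.of_forall fun n k => ?_)
  · have h1 := (hfc k).norm.mul_const (smoothWeight L k * M)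
    rw [norm_zero, zero_mul] at h1
    refine squeeze_zero_norm (fun n => ?_) h1
    rw [Real.norm_eq_abs]
    refine (abs_mul_conj_re_le _ _).trans ?_
    gcongr
    exact hwM n k
  · rw [Real.norm_eq_abs]
    refine (abs_mul_conj_re_le _ _).trans ?_
    have h2 := (norm_fc_le (u := δ n) k).trans (hC n)
    exact mul_le_mul h2 (hwM n k) (norm_nonneg _) ((norm_nonneg _).trans h2)

lemma abs_le_one_add_rpow {r : ℝ} (hr : 1 ≤ r) (a : ℝ) : |a| ≤ 1 + |a| ^ r := by
  rcases le_total |a| 1 with h | h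
  · have := Real.rpow_nonneg (abs_nonneg a) r
    linarith
  · have := Real.self_le_rpow_of_one_le h hr
    linarith

/-- **Compactness**: weakly null sequences in `L^s` pair to zero with sequences that are bounded in
`W^{1,2} ∩ L^{2s'}`, even though the latter need not converge. -/
lemma tendsto_integral_mul_of_bounded_energy {s s' : ℝ} (hss : s.HolderConjugate s') (hs2 : 2 ≤ s')
    {δ u : ℕ → Torus d → ℝ} {C₁ C₂ C₃ : ℝ}
    (hδ : ∀ n, MemLp (δ n) (ENNReal.ofReal s)) (hC₁ : ∀ n, ∫ x, |δ n x| ^ s ≤ C₁)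
    (hfc : ∀ k, Tendsto (fun n => fc (δ n) k) atTop (𝓝 0))
    (hu : ∀ n, H1 (u n)) (hC₂ : ∀ n, energy (u n) (u n) ≤ C₂)
    (hu' : ∀ n, MemLp (u n) (ENNReal.ofReal (2 * s'))) (hC₃ : ∀ n, ∫ x, |u n x| ^ (2 * s') ≤ C₃) :
    Tendsto (fun n => ∫ x, δ n x * u n x) atTop (𝓝 0) := by
  have hs'0 := hss.symm.pos
  have hδi : ∀ n, Integrable (δ n) := fun n => (hδ n).integrable (one_le_ofReal hss.lt.le)
  have hδs : ∀ n, Integrable fun x => |δ n x| ^ s := fun n => integrable_abs_rpow hss.pos (hδ n)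
  have hus : ∀ n, Integrable fun x => |u n x| ^ (2 * s') := fun n =>
    integrable_abs_rpow (by positivity) (hu' n)
  have hC₁0 : 0 ≤ C₁ := (integral_nonneg fun x => by positivity).trans (hC₁ 0)
  have hC₂0 : 0 ≤ C₂ := (energy_self_nonneg _).trans (hC₂ 0)
  have hC₃0 : 0 ≤ C₃ := (integral_nonneg fun x => by positivity).trans (hC₃ 0)
  rw [Metric.tendsto_atTop]
  intro ε hε
  -- the truncation level
  set M : ℝ := 4 * (C₁ + C₃ + 1) / ε with hM
  have hM0 : 0 < M := by positivity
  have hM1 : (C₁ + C₃) / M ≤ ε / 4 := by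
    rw [div_le_iff₀ hM0, hM]; field_simp; linarith
  obtain ⟨A, hA, hY⟩ := exists_young_weight hss.symm (c := ε / (4 * (C₁ + 1))) (by positivity)
  -- the smoothing parameter
  obtain ⟨N, hN⟩ : ∃ N : ℕ, A * ((2 * M) ^ (s' - 2) * (d / ((N : ℝ) + 1) * C₂)) ≤ ε / 4 := by
    have h1 : Tendsto (fun n : ℕ => (n : ℝ) + 1) atTop atTop :=
      tendsto_atTop_add_const_right _ _ tendsto_natCast_atTop_atTop
    have h2 :=
        (((h1.const_div_atTop (d : ℝ)).mul_const C₂).const_mul ((2 * M) ^ (s' - 2))).const_mul A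
    simp only [zero_mul, mul_zero] at h2
    exact (h2.eventually_le_const (by positivity : 0 < ε / 4)).exists
  set L : ℝ := (N : ℝ) + 1 with hL
  have hL0 : 0 < L := by positivity
  set v : ℕ → Torus d → ℝ := fun n x => clamp (-M) M (u n x) with hv
  have hvH : ∀ n, H1 (v n) := fun n => (hu n).clamp _ _
  have hvM : ∀ n x, |v n x| ≤ M := fun n x => abs_clamp_le hM0.le _
  have hvE : ∀ n, energy (v n) (v n) ≤ C₂ := fun n => by
    refine le_trans (energy_le_energy (hvH n) (hvH n) (hu n) (hu n) fun x y => ?_) (hC₂ n)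
    rw [← sq, ← sq]
    exact sq_le_sq.2 (abs_clamp_sub_le _ _ _ _)
  choose w hw2 hwM hwk using fun n => exists_smoothing hL0 (hvH n).1 (Eventually.of_forall (hvM n))
  have h1 := tendsto_integral_mul_smoothing (L := L) (C := 1 + C₁) (by simp [hL]) hδi (fun n => by
    have := integral_mono (hδi n).abs ((integrable_const 1).add (hδs n))
      fun x => abs_le_one_add_rpow hss.lt.le (δ n x)
    refine this.trans ?_
    have e : ∫ x, (1 + |δ n x| ^ s) = 1 + ∫ x, |δ n x| ^ s := by
      rw [integral_add (integrable_const 1) (hδs n)]; simp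
    refine e.le.trans ?_
    linarith [hC₁ n]) hfc (fun n => (hvH n).1) hvM hw2 hwk
  obtain ⟨n₀, hn₀⟩ := (Metric.tendsto_atTop.1 h1) (ε / 4) (by positivity)
  refine ⟨n₀, fun n hn => ?_⟩
  have h2 := hn₀ n hn
  rw [Real.dist_eq, sub_zero] at h2 ⊢
  have hδm := (hδi n).1
  have hi1 : Integrable fun x => δ n x * w n x :=
    (hδi n).mul_bdd (hw2 n).1 (hwM n)
  have hi2 : Integrable fun x => δ n x * (v n x - w n x) := by
    refine (hδi n).mul_bdd (c := 2 * M) ((hvH n).1.1.sub (hw2 n).1) ?_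
    filter_upwards [hwM n] with x hx
    refine (norm_sub_le _ _).trans ?_
    rw [Real.norm_eq_abs, Real.norm_eq_abs]
    linarith [hvM n x]
  have hpw3 : ∀ x, |δ n x * (u n x - v n x)| ≤ (|δ n x| ^ s + |u n x| ^ (2 * s')) / M := fun x => by
    rw [abs_mul]
    have h3 := abs_sub_clamp_le hM0 (u n x)
    have h4 := young_le hss (abs_nonneg (δ n x)) (sq_nonneg |u n x|)
    have h5 : (|u n x| ^ 2) ^ s' = |u n x| ^ (2 * s') := by
      rw [Real.rpow_mul (abs_nonneg _)]; norm_num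
    rw [h5] at h4
    calc |δ n x| * |u n x - v n x| ≤ |δ n x| * (|u n x| ^ 2 / M) := by gcongr
      _ = |δ n x| * |u n x| ^ 2 / M := by ring
      _ ≤ _ := by gcongr
  have hi3 : Integrable fun x => δ n x * (u n x - v n x) := by
    refine (((hδs n).add (hus n)).div_const M).mono'
      (hδm.mul ((hu n).1.1.sub (hvH n).1.1)) (Eventually.of_forall hpw3)
  have hI3 : |∫ x, δ n x * (u n x - v n x)| ≤ ε / 4 := by
    refine (abs_integral_le_integral_abs).trans ?_
    refine (integral_mono hi3.abs (((hδs n).add (hus n)).div_const M) hpw3).trans ?_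
    refine le_trans ?_ hM1
    have e : ∫ x, (|δ n x| ^ s + |u n x| ^ (2 * s')) / M
        = ((∫ x, |δ n x| ^ s) + ∫ x, |u n x| ^ (2 * s')) / M := by
      rw [integral_div, integral_add (hδs n) (hus n)]
    refine e.le.trans ?_
    gcongr
    · exact hC₁ n
    · exact hC₃ n
  have hvw2 : Integrable fun x => (v n x - w n x) ^ 2 := ((hvH n).1.sub (hw2 n)).integrable_sq
  have hpw4 : ∀ᵐ x, |δ n x * (v n x - w n x)| ≤
      A * ((2 * M) ^ (s' - 2) * (v n x - w n x) ^ 2) + ε / (4 * (C₁ + 1)) * |δ n x| ^ s := by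
    filter_upwards [hwM n] with x hx
    have h4 := hY |v n x - w n x| |δ n x|
    rw [abs_abs, abs_abs] at h4
    have h5 : |v n x - w n x| ≤ 2 * M := (abs_sub _ _).trans (by linarith [hvM n x])
    have h6 : |v n x - w n x| ^ s' ≤ (2 * M) ^ (s' - 2) * (v n x - w n x) ^ 2 := by
      rcases (abs_nonneg (v n x - w n x)).eq_or_lt with h7 | h7
      · rw [← h7, Real.zero_rpow hs'0.ne']; positivity
      · calc |v n x - w n x| ^ s' = |v n x - w n x| ^ (s' - 2) * |v n x - w n x| ^ (2 : ℝ) := by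
              rw [← Real.rpow_add h7]; congr 1; ring
          _ = |v n x - w n x| ^ (s' - 2) * (v n x - w n x) ^ 2 := by
              rw [Real.rpow_two, sq_abs]
          _ ≤ _ := by
              gcongr
    rw [abs_mul, mul_comm]
    refine h4.trans ?_
    gcongr
  have hI4 : |∫ x, δ n x * (v n x - w n x)| ≤ ε / 4 + ε / 4 := by
    refine (abs_integral_le_integral_abs).trans ?_
    have hia := (hvw2.const_mul ((2 * M) ^ (s' - 2))).const_mul A
    have hib := (hδs n).const_mul (ε / (4 * (C₁ + 1)))
    refine (integral_mono_ae hi2.abs (hia.add hib) hpw4).trans ?_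
    have e : ∫ x, (A * ((2 * M) ^ (s' - 2) * (v n x - w n x) ^ 2) +
        ε / (4 * (C₁ + 1)) * |δ n x| ^ s) = A * ((2 * M) ^ (s' - 2) * ∫ x, (v n x - w n x) ^ 2) +
        ε / (4 * (C₁ + 1)) * ∫ x, |δ n x| ^ s := by
      rw [integral_add hia hib, integral_const_mul, integral_const_mul, integral_const_mul]
    refine e.le.trans (add_le_add ?_ ?_)
    · refine le_trans ?_ hN
      have h8 := integral_smoothing_sub_sq_le hL0 (hvH n) (hw2 n) (hwk n)
      have h9 : d / L * energy (v n) (v n) ≤ d / L * C₂ := by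
        gcongr
        exact hvE n
      have h10 := h8.trans h9
      gcongr
    · calc ε / (4 * (C₁ + 1)) * ∫ x, |δ n x| ^ s ≤ ε / (4 * (C₁ + 1)) * (C₁ + 1) := by
            gcongr
            linarith [hC₁ n]
        _ = ε / 4 := by field_simp
  have e : ∫ x, δ n x * u n x = (∫ x, δ n x * w n x) + (∫ x, δ n x * (v n x - w n x)) +
      ∫ x, δ n x * (u n x - v n x) := by
    have hi12 : Integrable fun x => δ n x * w n x + δ n x * (v n x - w n x) := hi1.add hi2
    rw [← integral_add hi1 hi2, ← integral_add hi12 hi3]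
    congr 1; ext x; ring
  rw [e]
  have t1 := abs_add_le ((∫ x, δ n x * w n x) + (∫ x, δ n x * (v n x - w n x)))
    (∫ x, δ n x * (u n x - v n x))
  have t2 := abs_add_le (∫ x, δ n x * w n x) (∫ x, δ n x * (v n x - w n x))
  linarith

/-! ### Weak stability -/

lemma norm_toLp_rpow {u : Torus d → ℝ} {q : ℝ} (hq : 0 < q) (hu : MemLp u (ENNReal.ofReal q)) :
    ‖hu.toLp u‖ ^ q = ∫ x, |u x| ^ q := by
  rw [Lp.norm_toLp, toReal_eLpNorm hu.1, lpNorm_rpow hq hu]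

/-- **Uniform boundedness**: a sequence of nonnegative functions whose pairings with each function
in `L^{p'}` are bounded is bounded in `L^p`. -/
lemma exists_integral_rpow_le {p q : ℝ} (hpq : p.HolderConjugate q) {ρ : ℕ → Torus d → ℝ}
    (hρ : ∀ n, MemLp (ρ n) (ENNReal.ofReal p)) (hρ0 : ∀ n, ∀ᵐ x, 0 ≤ ρ n x)
    (h : ∀ g : Torus d → ℝ, MemLp g (ENNReal.ofReal q) → ∃ C, ∀ n, |∫ x, ρ n x * g x| ≤ C) :
    ∃ C, ∀ n, ∫ x, ρ n x ^ p ≤ C := by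
  have hp0 := hpq.pos
  have hq0 := hpq.symm.pos
  have : Fact (1 ≤ ENNReal.ofReal p) := ⟨one_le_ofReal hpq.lt.le⟩
  have : Fact (1 ≤ ENNReal.ofReal q) := ⟨one_le_ofReal hpq.symm.lt.le⟩
  have : ENNReal.HolderConjugate (ENNReal.ofReal p) (ENNReal.ofReal q) := hpq.ennrealOfReal
  set T : ℕ → (Lp ℝ (ENNReal.ofReal q) (volume : Measure (Torus d)) →L[ℝ] ℝ) := fun n =>
    (ContinuousLinearMap.mul ℝ ℝ).lpPairing volume (ENNReal.ofReal p) (ENNReal.ofReal q)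
      ((hρ n).toLp (ρ n)) with hT
  have hTe : ∀ n (g : Torus d → ℝ) (hg : MemLp g (ENNReal.ofReal q)),
      T n (hg.toLp g) = ∫ x, ρ n x * g x := fun n g hg => by
    simp only [hT]
    rw [ContinuousLinearMap.lpPairing_eq_integral]
    apply integral_congr_ae
    filter_upwards [(hρ n).coeFn_toLp, hg.coeFn_toLp] with x h1 h2
    rw [h1, h2]; rfl
  obtain ⟨C, hC⟩ := banach_steinhaus (g := T) fun g => by
    obtain ⟨C, hC⟩ := h g (Lp.memLp g)
    refine ⟨C, fun n => ?_⟩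
    have := hTe n g (Lp.memLp g)
    rw [Lp.toLp_coeFn] at this
    rw [this]
    exact hC n
  refine ⟨C ^ p, fun n => ?_⟩
  set I := ∫ x, ρ n x ^ p with hI
  have hI0 : 0 ≤ I := integral_nonneg_of_ae (by
    filter_upwards [hρ0 n] with x hx
    exact Real.rpow_nonneg hx p)
  have hC0 : 0 ≤ C := (norm_nonneg _).trans (hC n)
  -- the extremal test function
  have he : ∀ᵐ x, |ρ n x ^ (p - 1)| ^ q = ρ n x ^ p := by
    filter_upwards [hρ0 n] with x hx
    rw [abs_of_nonneg (by positivity), ← Real.rpow_mul hx]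
    congr 1
    exact hpq.sub_one_mul_conj
  have hg : MemLp (fun x => ρ n x ^ (p - 1)) (ENNReal.ofReal q) := by
    rw [← integrable_norm_rpow_iff ((hρ n).1.aemeasurable.pow_const _).aestronglyMeasurable
      (by simpa using hq0) (by simp), ENNReal.toReal_ofReal hq0.le]
    refine (integrable_rpow_of_memLp (hρ n) (hρ0 n) hpq.lt.le le_rfl).congr ?_
    filter_upwards [he] with x hx
    exact hx.symm
  have h1 : T n (hg.toLp _) = I := by
    rw [hTe]
    apply integral_congr_ae
    filter_upwards [hρ0 n] with x hx
    rcases hx.eq_or_lt with h2 | h2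
    · rw [← h2, Real.zero_rpow hp0.ne', zero_mul]
    · rw [← Real.rpow_one_add' hx (by linarith [hpq.lt])]
      congr 1; ring
  have h2 : ‖hg.toLp _‖ ^ q = I := by
    rw [norm_toLp_rpow hq0 hg]
    exact integral_congr_ae he
  have h3 : I ≤ C * ‖hg.toLp _‖ := by
    rw [← h1]
    refine (le_abs_self _).trans ?_
    exact ((T n).le_opNorm _).trans (by gcongr; exact hC n)
  set a := ‖hg.toLp _‖ with ha
  have ha0 : 0 ≤ a := norm_nonneg _
  rcases ha0.eq_or_lt with h4 | h4
  · rw [← h4, mul_zero] at h3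
    exact h3.trans (by positivity)
  · have h5 : a ^ (q - 1) ≤ C := by
      rw [← h2] at h3
      have h6 : a ^ q = a ^ (q - 1) * a := by
        rw [← Real.rpow_add_one h4.ne']; congr 1; ring
      rw [h6] at h3
      exact le_of_mul_le_mul_right h3 h4
    calc I = (a ^ (q - 1)) ^ p := by
          rw [← h2, ← Real.rpow_mul ha0, hpq.symm.sub_one_mul_conj]
      _ ≤ C ^ p := by gcongr

/-- A sequence that is bounded in `L^p` and whose Fourier coefficients tend to zero is weakly
null. -/
lemma tendsto_integral_mul_of_fc {p q : ℝ} (hpq : p.HolderConjugate q) {g : ℕ → Torus d → ℝ} {C : ℝ}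
    (hg : ∀ n, MemLp (g n) (ENNReal.ofReal p)) (hC : ∀ n, ∫ x, |g n x| ^ p ≤ C)
    (hfc : ∀ k, Tendsto (fun n => fc (g n) k) atTop (𝓝 0)) {h : Torus d → ℝ}
    (hh : MemLp h (ENNReal.ofReal q)) :
    Tendsto (fun n => ∫ x, g n x * h x) atTop (𝓝 0) := by
  have hp0 := hpq.pos
  have : Fact (1 ≤ ENNReal.ofReal p) := ⟨one_le_ofReal hpq.lt.le⟩
  have : Fact (1 ≤ ENNReal.ofReal q) := ⟨one_le_ofReal hpq.symm.lt.le⟩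
  have : ENNReal.HolderConjugate (ENNReal.ofReal p) (ENNReal.ofReal q) := hpq.ennrealOfReal
  have hgc : ∀ n, MemLp (fun x => (g n x : ℂ)) (ENNReal.ofReal p) := fun n => (hg n).ofReal
  set P := (ContinuousLinearMap.mul ℂ ℂ).lpPairing (volume : Measure (Torus d)) (ENNReal.ofReal p)
    (ENNReal.ofReal q) with hP
  set T : ℕ → (Lp ℂ (ENNReal.ofReal q) (volume : Measure (Torus d)) →L[ℂ] ℂ) := fun n =>
    P ((hgc n).toLp _) with hT
  have hTe : ∀ n (f : Torus d → ℂ) (hf : MemLp f (ENNReal.ofReal q)),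
      T n (hf.toLp f) = ∫ x, (g n x : ℂ) * f x := fun n f hf => by
    simp only [hT, hP]
    rw [ContinuousLinearMap.lpPairing_eq_integral]
    apply integral_congr_ae
    filter_upwards [(hgc n).coeFn_toLp, hf.coeFn_toLp] with x h1 h2
    rw [h1, h2]; rfl
  have hC0 : 0 ≤ C := (integral_nonneg fun x => by positivity).trans (hC 0)
  set K := ‖P‖ * C ^ p⁻¹ with hK
  have hK0 : 0 ≤ K := by positivity
  -- the pairings with `g n` are uniformly bounded functionals that tend to zero on a dense subspace
  have hTK : ∀ n, ‖T n‖ ≤ K := fun n => by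
    refine (P.le_opNorm _).trans ?_
    have h1 : ‖(hgc n).toLp _‖ = ‖(hg n).toLp (g n)‖ := by
      rw [Lp.norm_toLp, Lp.norm_toLp]
      congr 1
      exact eLpNorm_congr_norm_ae (Eventually.of_forall fun x => Complex.norm_real _)
    rw [h1]
    refine mul_le_mul_of_nonneg_left ?_ (norm_nonneg P)
    rw [Real.le_rpow_inv_iff_of_pos (norm_nonneg _) hC0 hp0, norm_toLp_rpow hp0 (hg n)]
    exact hC n
  have hspan : ∀ F ∈ Submodule.span ℂ (Set.range fun k : Fin d → ℤ =>
      ContinuousMap.toLp (E := ℂ) (ENNReal.ofReal q) (volume : Measure (Torus d)) ℂ (mFourier k)),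
      Tendsto (fun n => T n F) atTop (𝓝 0) := by
    intro F hF
    induction hF using Submodule.span_induction with
    | mem F hF =>
      obtain ⟨k, rfl⟩ := hF
      refine (hfc (-k)).congr fun n => ?_
      have hm : MemLp (mFourier k) (ENNReal.ofReal q) (volume : Measure (Torus d)) :=
        MemLp.of_bound (mFourier k).continuous.aestronglyMeasurable 1
          (Eventually.of_forall fun x => (norm_mFourier_apply k x).le)
      have h1 : ContinuousMap.toLp (E := ℂ) (ENNReal.ofReal q) (volume : Measure (Torus d)) ℂ
          (mFourier k) = hm.toLp _ := by
        apply Lp.ext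
        exact (ContinuousMap.coeFn_toLp volume (mFourier k)).trans hm.coeFn_toLp.symm
      show fc (g n) (-k) = T n (ContinuousMap.toLp (E := ℂ) (ENNReal.ofReal q)
        (volume : Measure (Torus d)) ℂ (mFourier k))
      rw [h1, hTe, fc, neg_neg]
    | zero => simp
    | add F G _ _ h1 h2 => simpa using h1.add h2
    | smul c F _ h1 => simpa using h1.const_mul c
  have hdense : (Submodule.span ℂ (Set.range fun k : Fin d → ℤ =>
      ContinuousMap.toLp (E := ℂ) (ENNReal.ofReal q) (volume : Measure (Torus d)) ℂ
        (mFourier k))).topologicalClosure = ⊤ := by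
    simpa only [Submodule.map_span, ContinuousLinearMap.coe_coe, ← Set.range_comp,
      Function.comp_def] using (ContinuousMap.toLp_denseRange ℂ (volume : Measure (Torus d)) ℂ
        (by simp)).topologicalClosure_map_submodule (span_mFourier_closure_eq_top (d := Fin d))
  have hhc : MemLp (fun x => (h x : ℂ)) (ENNReal.ofReal q) := hh.ofReal
  set H := hhc.toLp _ with hH
  have hTH : Tendsto (fun n => T n H) atTop (𝓝 0) := by
    rw [Metric.tendsto_atTop]
    intro ε hε
    have hmem : H ∈ (Submodule.span ℂ (Set.range fun k : Fin d → ℤ =>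
      ContinuousMap.toLp (E := ℂ) (ENNReal.ofReal q) (volume : Measure (Torus d)) ℂ
        (mFourier k))).topologicalClosure := by rw [hdense]; trivial
    obtain ⟨F, hF, hHF⟩ := Metric.mem_closure_iff.1 hmem (ε / (2 * (K + 1))) (by positivity)
    obtain ⟨n₀, hn₀⟩ := (Metric.tendsto_atTop.1 (hspan F hF)) (ε / 2) (by positivity)
    refine ⟨n₀, fun n hn => ?_⟩
    have h1 := hn₀ n hn
    rw [dist_zero_right] at h1 ⊢
    rw [dist_eq_norm] at hHF
    have h2 : ‖T n (H - F)‖ ≤ ε / 2 := by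
      refine ((T n).le_opNorm _).trans ?_
      calc ‖T n‖ * ‖H - F‖ ≤ (K + 1) * (ε / (2 * (K + 1))) := by
            gcongr
            linarith [hTK n]
        _ = ε / 2 := by field_simp
    calc ‖T n H‖ = ‖T n (H - F) + T n F‖ := by rw [map_sub, sub_add_cancel]
      _ ≤ ‖T n (H - F)‖ + ‖T n F‖ := norm_add_le _ _
      _ < ε := by linarith
  have := (Complex.continuous_re.tendsto _).comp hTH
  rw [Complex.zero_re] at this
  refine this.congr fun n => ?_
  rw [Function.comp_apply, hH, hTe]
  have e : ∫ x, (g n x : ℂ) * (h x : ℂ) = ((∫ x, g n x * h x : ℝ) : ℂ) := by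
    rw [← integral_complex_ofReal]
    congr 1; ext x; push_cast; rfl
  rw [e, Complex.ofReal_re]

lemma abs_sub_rpow_le {r : ℝ} (hr : 0 ≤ r) (a b : ℝ) :
    |a - b| ^ r ≤ 2 ^ r * (|a| ^ r + |b| ^ r) := by
  have h1 : |a - b| ≤ 2 * max |a| |b| := by
    refine (abs_sub _ _).trans ?_
    linarith [le_max_left |a| |b|, le_max_right |a| |b|]
  calc |a - b| ^ r ≤ (2 * max |a| |b|) ^ r := by gcongr
    _ = 2 ^ r * max |a| |b| ^ r := Real.mul_rpow (by norm_num) (by positivity)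
    _ ≤ _ := by
      gcongr
      rcases max_cases |a| |b| with h | h <;> rw [h.1]
      · linarith [Real.rpow_nonneg (abs_nonneg b) r]
      · linarith [Real.rpow_nonneg (abs_nonneg a) r]

lemma integral_abs_sub_rpow_le {r : ℝ} (hr : 0 < r) {f g : Torus d → ℝ}
    (hf : MemLp f (ENNReal.ofReal r)) (hg : MemLp g (ENNReal.ofReal r)) :
    ∫ x, |f x - g x| ^ r ≤ 2 ^ r * ((∫ x, |f x| ^ r) + ∫ x, |g x| ^ r) := by
  have h1 := integrable_abs_rpow hr hf
  have h2 := integrable_abs_rpow hr hg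
  rw [← integral_add h1 h2, ← integral_const_mul]
  refine integral_mono_of_nonneg (Eventually.of_forall fun x => by positivity)
    ((h1.add h2).const_mul _) (Eventually.of_forall fun x => abs_sub_rpow_le hr.le _ _)

/-- **Weak stability**: along a weakly convergent sequence of densities the potentials converge
strongly in `W^{1,2}` and in every `L^t`, and the Fourier coefficients of `e^Φ` converge. -/
theorem RegularPB.weak_stability {p B M : ℝ} (hp : 1 < p) {ρs Φs : ℕ → Torus d → ℝ}
    {ρ Φ : Torus d → ℝ} (hs : ∀ n, RegularPB p B (ρs n) (Φs n)) (h : RegularPB p B ρ Φ)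
    (hM : ∀ n, ∫ x, ρs n x ^ p ≤ M)
    (hfc : ∀ k, Tendsto (fun n => fc (ρs n) k) atTop (𝓝 (fc ρ k))) :
    Tendsto (fun n => energy (fun x => Φs n x - Φ x) (fun x => Φs n x - Φ x)) atTop (𝓝 0) ∧
    (∀ t : ℝ, 2 ≤ t → Tendsto (fun n => ∫ x, |Φs n x - Φ x| ^ t) atTop (𝓝 0)) ∧
    ∀ k, Tendsto (fun n => fc (fun x => Real.exp (Φs n x) - Real.exp (Φ x)) k) atTop (𝓝 0) := by
  have hs1 : 1 < min p 2 := lt_min hp one_lt_two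
  have hss := Real.HolderConjugate.conjExponent hs1
  set s := min p 2 with hsdef
  set s' := Real.conjExponent s with hs'
  have hs2 : 2 ≤ s' := by
    rw [hs', Real.conjExponent, le_div_iff₀ (by linarith)]
    linarith [min_le_right p 2]
  have hp0 : 0 < p := by linarith
  have hpot : ∀ {σ Ψ : Torus d → ℝ}, RegularPB p B σ Ψ → ∀ {t : ℝ}, 0 < t →
      MemLp Ψ (ENNReal.ofReal t) := fun hσ _ ht => hσ.memLp_potential hp ht
  set δ : ℕ → Torus d → ℝ := fun n x => ρs n x - ρ x with hδ
  set u : ℕ → Torus d → ℝ := fun n x => Φs n x - Φ x with hu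
  have hδp : ∀ n, MemLp (δ n) (ENNReal.ofReal p) := fun n => (hs n).memLp.sub h.memLp
  have hδs : ∀ n, MemLp (δ n) (ENNReal.ofReal s) := fun n =>
    (hδp n).mono_exponent (ENNReal.ofReal_le_ofReal (min_le_left _ _))
  have hut : ∀ n (t : ℝ), 0 < t → MemLp (u n) (ENNReal.ofReal t) := fun n t ht =>
    (hpot (hs n) ht).sub (hpot h ht)
  have habs : ∀ {σ : Torus d → ℝ}, (∀ᵐ x, 0 ≤ σ x) → ∫ x, |σ x| ^ p = ∫ x, σ x ^ p := fun h0 => by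
    apply integral_congr_ae
    filter_upwards [h0] with x hx
    rw [abs_of_nonneg hx]
  -- bounds for the densities
  set R := ∫ x, ρ x ^ p with hR
  have hδC : ∀ n, ∫ x, |δ n x| ^ s ≤ 1 + 2 ^ p * (M + R) := fun n => by
    have h1 := integrable_abs_rpow hp0 (hδp n)
    have h2 : ∀ x, |δ n x| ^ s ≤ 1 + |δ n x| ^ p := fun x => by
      rcases le_total |δ n x| 1 with h3 | h3
      · have h4 := Real.rpow_le_one (abs_nonneg (δ n x)) h3 hss.pos.le
        have h5 := Real.rpow_nonneg (abs_nonneg (δ n x)) p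
        linarith
      · have := Real.rpow_le_rpow_of_exponent_le h3 (min_le_left p 2)
        linarith
    have h3 := integral_mono (integrable_abs_rpow hss.pos (hδs n)) ((integrable_const 1).add h1) h2
    have h4 : ∫ x, (1 + |δ n x| ^ p) = 1 + ∫ x, |δ n x| ^ p := by
      rw [integral_add (integrable_const 1) h1]; simp
    have h5 := integral_abs_sub_rpow_le hp0 (hs n).memLp h.memLp
    rw [habs (hs n).nonneg, habs h.nonneg] at h5
    have h6 : (2 : ℝ) ^ p * ((∫ x, ρs n x ^ p) + R) ≤ 2 ^ p * (M + R) := by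
      gcongr
      exact hM n
    exact (h3.trans h4.le).trans (by linarith)
  -- bounds for the potentials
  have hmom : ∀ t : ℝ, 0 < t → ∃ C, ∀ n, ∫ x, |u n x| ^ t ≤ C := fun t ht => by
    obtain ⟨A, hA, hAe⟩ := exists_abs_rpow_le_exp B ht hp0
    have h1 : ∀ {σ Ψ : Torus d → ℝ}, RegularPB p B σ Ψ → ∫ x, |Ψ x| ^ t ≤ A * ∫ x, σ x ^ p := by
      intro σ Ψ hσ
      have h2 : ∫ x, |Ψ x| ^ t ≤ ∫ x, A * Real.exp (p * Ψ x) := by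
        refine integral_mono_ae (integrable_abs_rpow ht (hpot hσ ht))
          (hσ.integrable_exp.const_mul A) ?_
        filter_upwards [hσ.lower] with x hx
        exact hAe _ hx
      rw [integral_const_mul] at h2
      exact h2.trans (mul_le_mul_of_nonneg_left hσ.integral_exp_le hA.le)
    refine ⟨2 ^ t * (A * M + A * R), fun n => ?_⟩
    refine (integral_abs_sub_rpow_le ht (hpot (hs n) ht) (hpot h ht)).trans ?_
    have h3 := h1 (hs n)
    have h4 := h1 h
    have h5 := mul_le_mul_of_nonneg_left (hM n) hA.le
    gcongr
    exact h3.trans h5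
  have hE : ∀ n, energy (u n) (u n) + ∫ x, (Real.exp (Φs n x) - Real.exp (Φ x)) * u n x
      ≤ ∫ x, δ n x * u n x := fun n => ((hs n).energy_sub_le hp h).2.2
  have hEi : ∀ n, Integrable fun x => (Real.exp (Φs n x) - Real.exp (Φ x)) * u n x :=
    fun n => ((hs n).energy_sub_le hp h).1
  have hdi : ∀ n, Integrable fun x => δ n x * u n x := fun n => ((hs n).energy_sub_le hp h).2.1
  have hG0 : ∀ n, 0 ≤ ∫ x, (Real.exp (Φs n x) - Real.exp (Φ x)) * u n x := fun n =>
    integral_nonneg fun x => exp_mul_sub_nonneg _ _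
  obtain ⟨C₂, hC₂⟩ := hmom s' (by linarith)
  obtain ⟨C₃, hC₃⟩ := hmom (2 * s') (by linarith)
  have hEC : ∀ n, energy (u n) (u n) ≤ 1 * (1 + 2 ^ p * (M + R)) + 1 * C₂ := fun n => by
    have h1 := integral_mul_le_young (p := s) (q := s') (C := 1) (c := 1) (f := δ n) (g := u n)
      (fun a b => by
        have := young_le hss (abs_nonneg a) (abs_nonneg b)
        rw [← abs_mul] at this
        linarith [le_abs_self (a * b)]) (hdi n)
      (integrable_abs_rpow hss.pos (hδs n))
        (integrable_abs_rpow hss.symm.pos (hut n _ hss.symm.pos))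
    have h2 := hδC n
    have h3 := hC₂ n
    linarith [hE n, hG0 n]
  have hfcδ : ∀ k, Tendsto (fun n => fc (δ n) k) atTop (𝓝 0) := fun k => by
    have h1 := (hfc k).sub_const (fc ρ k)
    rw [sub_self] at h1
    refine h1.congr fun n => ?_
    rw [← fc_sub ((hs n).integrable hp) (h.integrable hp)]
  have hlim : Tendsto (fun n => ∫ x, δ n x * u n x) atTop (𝓝 0) :=
    tendsto_integral_mul_of_bounded_energy hss hs2 hδs hδC hfcδ
      (fun n => (hs n).solves.2.1.sub h.solves.2.1) hEC (fun n => hut n _ (by linarith)) hC₃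
  have hT : ∀ t : ℝ, 2 ≤ t → Tendsto (fun n => ∫ x, |u n x| ^ t) atTop (𝓝 0) := fun t ht => by
    obtain ⟨c, hc, hcoer⟩ := exists_exp_coercive B ht
    have h0 := hlim.const_mul c⁻¹
    rw [mul_zero] at h0
    refine squeeze_zero (fun n => integral_nonneg fun x => by positivity) (fun n => ?_) h0
    obtain ⟨-, h1⟩ := integrable_of_coercive (t := t) (hut n 1 one_pos).1 (hEi n) hc (by
      filter_upwards [(hs n).lower, h.lower] with x h3 h4
      exact hcoer _ _ h3 h4)
    rw [inv_mul_eq_div, le_div_iff₀ hc]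
    linarith [hE n, energy_self_nonneg (u n)]
  refine ⟨squeeze_zero (fun n => energy_self_nonneg _)
      (fun n => by linarith [hE n, hG0 n]) hlim, hT,
    fun k => ?_⟩
  have hui : ∀ n, MemLp (u n) 2 := fun n => by simpa using hut n 2 two_pos
  have hfu : Tendsto (fun n => fc (u n) k) atTop (𝓝 0) := by
    have h2 := (hT 2 le_rfl).sqrt
    rw [Real.sqrt_zero] at h2
    refine squeeze_zero_norm (fun n => ?_) h2
    apply Real.le_sqrt_of_sq_le
    refine ((hasSum_norm_fc_sq (hui n)).summable.le_tsum k fun _ _ => sq_nonneg _).trans ?_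
    rw [(hasSum_norm_fc_sq (hui n)).tsum_eq]
    refine le_of_eq ?_
    congr 1; ext x
    rw [Real.rpow_two, sq_abs]
  -- the equation expresses the coefficients of `e^{Φₙ} - e^Φ` through those of `δ n` and `u n`
  have h3 := (hfcδ k).sub (hfu.const_mul (lam k : ℂ))
  rw [mul_zero, sub_zero] at h3
  refine h3.congr fun n => ?_
  have e1 := (hs n).solves.2.2 k
  have e2 := h.solves.2.2 k
  rw [fc_sub ((hs n).integrable hp) (hs n).solves.1] at e1
  rw [fc_sub (h.integrable hp) h.solves.1] at e2
  simp only [hδ, hu]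
  rw [fc_sub ((hs n).integrable hp) (h.integrable hp),
    fc_sub (hs n).solves.2.1.integrable h.solves.2.1.integrable,
    fc_sub (hs n).solves.1 h.solves.1]
  linear_combination e2 - e1

/-! ### The functional `ρ ↦ Φ[ρ]` -/

section MemLpPlus

variable {p : ℝ} {ρ : Torus d → ℝ}

lemma MemLpPlus.integrable (h : MemLpPlus p ρ) (hp : 1 < p) : Integrable ρ :=
  h.1.integrable (one_le_ofReal hp.le)

lemma MemLpPlus.lpNorm_one (h : MemLpPlus p ρ) : lpNorm ρ 1 volume = ∫ x, ρ x := by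
  rw [lpNorm_one_eq_integral_norm h.1.1]
  apply integral_congr_ae
  filter_upwards [h.2.1] with x hx
  exact Real.norm_of_nonneg hx

lemma MemLpPlus.integral_pos (h : MemLpPlus p ρ) : 0 < ∫ x, ρ x :=
  h.lpNorm_one ▸ h.2.2

lemma MemLpPlus.integral_abs_rpow (h : MemLpPlus p ρ) (r : ℝ) :
    ∫ x, |ρ x| ^ r = ∫ x, ρ x ^ r := by
  apply integral_congr_ae
  filter_upwards [h.2.1] with x hx
  rw [abs_of_nonneg hx]

lemma MemLpPlus.lpNorm_rpow (h : MemLpPlus p ρ) (hp : 1 < p) :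
    lpNorm ρ (ENNReal.ofReal p) volume ^ p = ∫ x, ρ x ^ p := by
  rw [_root_.lpNorm_rpow (by linarith) h.1, h.integral_abs_rpow]

end MemLpPlus

/-- Uniqueness for the Poisson–Boltzmann equation. -/
lemma SolvesPB.unique {ρ Φ Ψ : Torus d → ℝ} (hΦ : SolvesPB ρ Φ) (hΨ : SolvesPB ρ Ψ)
    (hρ : Integrable ρ) : Φ =ᵐ[volume] Ψ := by
  filter_upwards [hΦ.mono hΨ hρ hρ (Eventually.of_forall fun x => le_rfl),
    hΨ.mono hΦ hρ hρ (Eventually.of_forall fun x => le_rfl)] with x h1 h2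
  exact le_antisymm h1 h2

lemma isPBSolution_pbPotential {ρ Φ : Torus d → ℝ} (h : IsPBSolution ρ Φ) :
    IsPBSolution ρ (pbPotential ρ) := by
  have hex : ∃ Φ : Torus d → ℝ, IsPBSolution ρ Φ := ⟨Φ, h⟩
  unfold pbPotential
  rw [dif_pos hex]
  exact hex.choose_spec

/-- Existence with bounds for `Φ[ρ]` that are uniform over densities with mass bounded below and
`L^p` norm bounded above. -/
lemma exists_regularPB (d : ℕ) {p m : ℝ} (hp : 1 < p) (hm : 0 < m) (M : ℝ) :
    ∃ B : ℝ, ∀ ρ : Torus d → ℝ, MemLpPlus p ρ → m ≤ ∫ x, ρ x → ∫ x, ρ x ^ p ≤ M →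
      RegularPB p B ρ (pbPotential ρ) ∧ ∀ r, 1 ≤ r → r ≤ p →
        Integrable (fun x => Real.exp (r * pbPotential ρ x)) ∧
          ∫ x, Real.exp (r * pbPotential ρ x) ≤ ∫ x, ρ x ^ r := by
  obtain ⟨B, hB⟩ := exists_solvesPB d (M := M) hp hm
  refine ⟨B, fun ρ hρ h1 h2 => ?_⟩
  obtain ⟨Φ, hΦ, hlow, hmom⟩ := hB ρ hρ.1 hρ.2.1 h1 h2
  have hi := hρ.integrable hp
  have hsol := (isPBSolution_iff hi).1 (isPBSolution_pbPotential ((isPBSolution_iff hi).2 hΦ))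
  have he := hΦ.unique hsol hi
  have hmom' : ∀ r, 1 ≤ r → r ≤ p → Integrable (fun x => Real.exp (r * pbPotential ρ x)) ∧
      ∫ x, Real.exp (r * pbPotential ρ x) ≤ ∫ x, ρ x ^ r := fun r hr hrp => by
    have e : (fun x => Real.exp (r * Φ x)) =ᵐ[volume] fun x => Real.exp (r * pbPotential ρ x) := by
      filter_upwards [he] with x hx
      rw [hx]
    rw [← integral_congr_ae e]
    exact ⟨(hmom r hr hrp).1.congr e, (hmom r hr hrp).2⟩
  refine ⟨⟨hρ.1, hρ.2.1, hsol, ?_, (hmom' p hp.le le_rfl).1, (hmom' p hp.le le_rfl).2⟩, hmom'⟩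
  filter_upwards [hlow, he] with x hx hx2
  rwa [← hx2]

/-- A constant `B` with `Φ[ρ] ≥ -B` whenever `‖ρ‖_{L¹} ≥ a` and `‖ρ‖_{L^p} ≤ b`; it is `0` unless
`a > 0`. -/
def potentialBound (d : ℕ) {p : ℝ} (hp : 1 < p) (a b : ℝ) : ℝ :=
  if ha : 0 < a then (exists_regularPB d hp ha (b ^ p)).choose else 0

lemma MemLpPlus.regularPB_and_moments {p : ℝ} {ρ : Torus d → ℝ} (h : MemLpPlus p ρ) (hp : 1 < p) :
    RegularPB p (potentialBound d hp (lpNorm ρ 1 volume) (lpNorm ρ (ENNReal.ofReal p) volume)) ρ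
      (pbPotential ρ) ∧ ∀ r, 1 ≤ r → r ≤ p →
        Integrable (fun x => Real.exp (r * pbPotential ρ x)) ∧
          ∫ x, Real.exp (r * pbPotential ρ x) ≤ ∫ x, ρ x ^ r := by
  rw [potentialBound, dif_pos h.2.2]
  exact (exists_regularPB d hp h.2.2 _).choose_spec ρ h h.lpNorm_one.le (h.lpNorm_rpow hp).ge

lemma MemLpPlus.regularPB {p : ℝ} {ρ : Torus d → ℝ} (h : MemLpPlus p ρ) (hp : 1 < p) :
    RegularPB p (potentialBound d hp (lpNorm ρ 1 volume) (lpNorm ρ (ENNReal.ofReal p) volume)) ρ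
      (pbPotential ρ) :=
  (h.regularPB_and_moments hp).1

/-- Neutrality, from the zeroth Fourier coefficient of the equation. -/
lemma SolvesPB.integral_eq {ρ Φ : Torus d → ℝ} (h : SolvesPB ρ Φ) (hρ : Integrable ρ) :
    ∫ x, Real.exp (Φ x) = ∫ x, ρ x := by
  have h1 := h.2.2 0
  rw [lam_zero, fc_zero_index, fc_zero_index, integral_sub hρ h.1, Complex.ofReal_zero, zero_mul]
    at h1
  have h2 : (∫ x, ρ x) - ∫ x, Real.exp (Φ x) = 0 := by exact_mod_cast h1.symm
  linarith

lemma lpNorm_two_sq {G : Torus d → Vec d} (hG : MemLp G 2) :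
    lpNorm G 2 volume ^ 2 = ∫ x, inner ℝ (G x) (G x) := by
  rw [← toReal_eLpNorm hG.1, ← Lp.norm_toLp G hG, ← real_inner_self_eq_norm_sq, L2.inner_def]
  apply integral_congr_ae
  filter_upwards [hG.coeFn_toLp] with x hx
  rw [hx]

lemma energy_eq_lpNorm_sq {u v : Torus d → ℝ} (hu : H1 u) (hv : H1 v) :
    lpNorm (weakGrad u - weakGrad v) 2 volume ^ 2
      = energy (fun x => u x - v x) (fun x => u x - v x) := by
  have h := hu.isL2WeakGrad.sub hv.isL2WeakGrad hu.1 hv.1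
  rw [lpNorm_two_sq h.1, h.integral_inner h (hu.1.sub hv.1) (hu.1.sub hv.1)]

lemma potentialEnergy_eq (ρ : Torus d → ℝ) :
    potentialEnergy ρ = 1 / 2 * ∫ x, inner ℝ (weakGrad (pbPotential ρ) x)
      (weakGrad (pbPotential ρ) x) := by
  rw [potentialEnergy, ← integral_const_mul]
  simp_rw [real_inner_self_eq_norm_sq]

/-- If `u n → u` in `W^{1,2}`, then the gradients converge weakly and their norms converge. -/
lemma tendsto_integral_inner_weakGrad {u : ℕ → Torus d → ℝ} {v : Torus d → ℝ} (hu : ∀ n, H1 (u n))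
    (hv : H1 v)
    (h : Tendsto (fun n => energy (fun x => u n x - v x) (fun x => u n x - v x)) atTop (𝓝 0)) :
    (∀ g : Torus d → Vec d, MemLp g 2 → Tendsto (fun n => ∫ x, inner ℝ (weakGrad (u n) x) (g x))
      atTop (𝓝 (∫ x, inner ℝ (weakGrad v x) (g x)))) ∧
    Tendsto (fun n => ∫ x, inner ℝ (weakGrad (u n) x) (weakGrad (u n) x)) atTop
      (𝓝 (∫ x, inner ℝ (weakGrad v x) (weakGrad v x))) := by
  have hG := fun n => (hu n).isL2WeakGrad.1
  have hH := hv.isL2WeakGrad.1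
  have hlim : Tendsto (fun n => (hG n).toLp _) atTop (𝓝 (hH.toLp _)) := by
    rw [tendsto_iff_norm_sub_tendsto_zero]
    have h1 := h.sqrt
    rw [Real.sqrt_zero] at h1
    refine h1.congr fun n => ?_
    rw [← MemLp.toLp_sub, Lp.norm_toLp, toReal_eLpNorm ((hG n).sub hH).1,
      ← energy_eq_lpNorm_sq (hu n) hv, Real.sqrt_sq lpNorm_nonneg]
  have hin : ∀ {f g : Torus d → Vec d} (hf : MemLp f 2) (hg : MemLp g 2),
      inner ℝ (hf.toLp f) (hg.toLp g) = ∫ x, inner ℝ (f x) (g x) := fun hf hg => by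
    rw [L2.inner_def]
    apply integral_congr_ae
    filter_upwards [hf.coeFn_toLp, hg.coeFn_toLp] with x h1 h2
    rw [h1, h2]
  refine ⟨fun g hg => ?_, ?_⟩
  · have := hlim.inner (tendsto_const_nhds (x := hg.toLp g)) (𝕜 := ℝ)
    simpa only [hin] using this
  · have := hlim.inner hlim (𝕜 := ℝ)
    simpa only [hin] using this

lemma WeakLpTendsto.tendsto_integral_mul {p : ℝ} {f : ℕ → Torus d → ℝ} {g : Torus d → ℝ}
    (h : WeakLpTendsto p f g) {φ : Torus d → ℝ} (hφ : MemLp φ (ENNReal.ofReal (p / (p - 1)))) :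
    Tendsto (fun n => ∫ x, f n x * φ x) atTop (𝓝 (∫ x, g x * φ x)) := by
  have := h.2.2 φ hφ
  simpa only [RCLike.inner_apply, conj_trivial, mul_comm (φ _)] using this

lemma WeakLpTendsto.tendsto_fc {p : ℝ} (hp : 1 < p) {f : ℕ → Torus d → ℝ} {g : Torus d → ℝ}
    (h : WeakLpTendsto p f g) (k : Fin d → ℤ) :
    Tendsto (fun n => fc (f n) k) atTop (𝓝 (fc g k)) := by
  have h1 := h.tendsto_integral_mul (memLp_of_continuous (torusSmooth_cosFun k).continuous _)
  have h2 := h.tendsto_integral_mul (memLp_of_continuous (torusSmooth_sinFun k).continuous _)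
  simp_rw [fc_eq_cos_sin (h.2.1.integrable (one_le_ofReal hp.le)),
    fc_eq_cos_sin ((h.1 _).integrable (one_le_ofReal hp.le))]
  exact ((Complex.continuous_ofReal.tendsto _).comp h1).sub
    (((Complex.continuous_ofReal.tendsto _).comp h2).mul_const _)

lemma WeakLpTendsto.tendsto_integral {p : ℝ} {f : ℕ → Torus d → ℝ} {g : Torus d → ℝ}
    (h : WeakLpTendsto p f g) : Tendsto (fun n => ∫ x, f n x) atTop (𝓝 (∫ x, g x)) := by
  have := h.tendsto_integral_mul (memLp_const (1 : ℝ))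
  simpa only [mul_one] using this

lemma abs_integral_mul_le {p q : ℝ} (hpq : p.HolderConjugate q) {f g : Torus d → ℝ}
    (hf : MemLp f (ENNReal.ofReal p)) (hg : MemLp g (ENNReal.ofReal q)) :
    |∫ x, f x * g x| ≤ lpNorm f (ENNReal.ofReal p) volume * lpNorm g (ENNReal.ofReal q) volume := by
  refine (norm_integral_le_integral_norm (fun x => f x * g x)).trans ?_
  simp_rw [norm_mul]
  refine (integral_mul_norm_le_Lp_mul_Lq hpq hf hg).trans (le_of_eq ?_)
  simp_rw [Real.norm_eq_abs]
  rw [← lpNorm_rpow hpq.pos hf, ← lpNorm_rpow hpq.symm.pos hg, one_div, one_div,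
    Real.rpow_rpow_inv lpNorm_nonneg hpq.ne_zero, Real.rpow_rpow_inv lpNorm_nonneg hpq.symm.ne_zero]

lemma StrongLpTendsto.weakLpTendsto {p : ℝ} (hp : 1 < p) {f : ℕ → Torus d → ℝ} {g : Torus d → ℝ}
    (h : StrongLpTendsto p f g) : WeakLpTendsto p f g := by
  have hpq := Real.HolderConjugate.conjExponent hp
  refine ⟨h.1, h.2.1, fun φ hφ => ?_⟩
  simp only [RCLike.inner_apply, conj_trivial, mul_comm (φ _)]
  have h1 : Tendsto (fun n => lpNorm (f n - g) (ENNReal.ofReal p) volume) atTop (𝓝 0) := by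
    have := (ENNReal.tendsto_toReal ENNReal.zero_ne_top).comp h.2.2
    refine this.congr fun n => ?_
    exact toReal_eLpNorm ((h.1 n).sub h.2.1).1
  have h2 := h1.mul_const (lpNorm φ (ENNReal.ofReal (p.conjExponent)) volume)
  rw [zero_mul] at h2
  rw [tendsto_iff_norm_sub_tendsto_zero]
  refine squeeze_zero (fun n => norm_nonneg _) (fun n => ?_) h2
  rw [← integral_sub (integrable_mul_of_holder hpq (h.1 n) hφ)
    (integrable_mul_of_holder hpq h.2.1 hφ)]
  simp_rw [← sub_mul]
  exact abs_integral_mul_le hpq ((h.1 n).sub h.2.1) hφ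

lemma integrable_entropyDensity {p B : ℝ} (hp : 1 < p) {ρ : Torus d → ℝ}
    (h : RegularPB p B ρ (pbPotential ρ)) : Integrable (entropyDensity ρ) := by
  have hpq := Real.HolderConjugate.conjExponent hp
  exact (integrable_mul_of_holder hpq (h.memLp_exp hp)
    ((h.memLp_potential hp hpq.symm.pos).sub (memLp_const 1))).add (integrable_const 1)

section WeakConvergence

variable {p : ℝ} {ρs : ℕ → Torus d → ℝ} {ρ : Torus d → ℝ}

lemma WeakLpTendsto.exists_integral_rpow_le (hp : 1 < p) (h : WeakLpTendsto p ρs ρ)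
    (hs : ∀ n, MemLpPlus p (ρs n)) : ∃ M, ∀ n, ∫ x, ρs n x ^ p ≤ M := by
  refine _root_.exists_integral_rpow_le (Real.HolderConjugate.conjExponent hp) h.1
    (fun n => (hs n).2.1) fun g hg => ?_
  obtain ⟨C, hC⟩ := (h.tendsto_integral_mul hg).abs.bddAbove_range
  exact ⟨C, fun n => hC ⟨n, rfl⟩⟩

/-- Weak stability for `Φ[ρ]`: the masses of a weakly convergent sequence converge, hence they are
eventually bounded below, and the uniform bounds apply. -/
lemma WeakLpTendsto.pbPotential_stability (hp : 1 < p) (h : WeakLpTendsto p ρs ρ)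
    (hs : ∀ n, MemLpPlus p (ρs n)) (hρ : MemLpPlus p ρ) :
    Tendsto (fun n => energy (fun x => pbPotential (ρs n) x - pbPotential ρ x)
      (fun x => pbPotential (ρs n) x - pbPotential ρ x)) atTop (𝓝 0) ∧
    (∀ t : ℝ, 2 ≤ t → Tendsto (fun n => ∫ x, |pbPotential (ρs n) x - pbPotential ρ x| ^ t) atTop
      (𝓝 0)) ∧
    ∀ k, Tendsto (fun n => fc (fun x => Real.exp (pbPotential (ρs n) x)
      - Real.exp (pbPotential ρ x)) k) atTop (𝓝 0) := by
  obtain ⟨M, hM⟩ := h.exists_integral_rpow_le hp hs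
  have hpos := hρ.integral_pos
  obtain ⟨N, hN⟩ := eventually_atTop.1
    (h.tendsto_integral.eventually_const_le (half_lt_self hpos))
  obtain ⟨B, hB⟩ := exists_regularPB d hp (half_pos hpos) (max M (∫ x, ρ x ^ p))
  have key := RegularPB.weak_stability (M := M) hp
    (fun n => (hB (ρs (n + N)) (hs _) (hN _ (by lia)) ((hM _).trans (le_max_left _ _))).1)
    (hB ρ hρ (half_le_self hpos.le) (le_max_right _ _)).1 (fun n => hM (n + N))
    (fun k => (tendsto_add_atTop_iff_nat N).2 (h.tendsto_fc hp k))
  exact ⟨(tendsto_add_atTop_iff_nat N).1 key.1,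
    fun t ht => (tendsto_add_atTop_iff_nat N).1 (key.2.1 t ht),
    fun k => (tendsto_add_atTop_iff_nat N).1 (key.2.2 k)⟩

lemma WeakLpTendsto.tendsto_integral_exp_sub_mul (hp : 1 < p) (h : WeakLpTendsto p ρs ρ)
    (hs : ∀ n, MemLpPlus p (ρs n)) (hρ : MemLpPlus p ρ) {g : Torus d → ℝ}
    (hg : MemLp g (ENNReal.ofReal (p / (p - 1)))) :
    Tendsto (fun n => ∫ x, (Real.exp (pbPotential (ρs n) x) - Real.exp (pbPotential ρ x)) * g x)
      atTop (𝓝 0) := by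
  obtain ⟨M, hM⟩ := h.exists_integral_rpow_le hp hs
  have hp0 : 0 < p := by linarith
  have habs : ∀ Φ : Torus d → ℝ, ∫ x, |Real.exp (Φ x)| ^ p = ∫ x, Real.exp (p * Φ x) := fun Φ => by
    congr 1; ext x
    rw [Real.abs_exp, ← Real.exp_mul, mul_comm]
  refine tendsto_integral_mul_of_fc (Real.HolderConjugate.conjExponent hp)
    (C := 2 ^ p * (M + ∫ x, ρ x ^ p))
    (fun n => (((hs n).regularPB hp).memLp_exp hp).sub ((hρ.regularPB hp).memLp_exp hp))
    (fun n => ?_) (h.pbPotential_stability hp hs hρ).2.2 hg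
  refine (integral_abs_sub_rpow_le hp0 (((hs n).regularPB hp).memLp_exp hp)
    ((hρ.regularPB hp).memLp_exp hp)).trans ?_
  rw [habs, habs]
  exact mul_le_mul_of_nonneg_left (add_le_add (((hs n).regularPB hp).integral_exp_le.trans (hM n))
    (hρ.regularPB hp).integral_exp_le) (by positivity)

lemma WeakLpTendsto.tendsto_lpNorm_pbPotential_sub (hp : 1 < p) (h : WeakLpTendsto p ρs ρ)
    (hs : ∀ n, MemLpPlus p (ρs n)) (hρ : MemLpPlus p ρ) {q : ℝ} (hq : 0 < q) :
    Tendsto (fun n => lpNorm (fun x => pbPotential (ρs n) x - pbPotential ρ x)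
      (ENNReal.ofReal q) volume) atTop (𝓝 0) := by
  have ht0 : 0 < max q 2 := by positivity
  have hm : ∀ n, MemLp (fun x => pbPotential (ρs n) x - pbPotential ρ x)
      (ENNReal.ofReal (max q 2)) := fun n =>
    (((hs n).regularPB hp).memLp_potential hp ht0).sub ((hρ.regularPB hp).memLp_potential hp ht0)
  have h1 := ((h.pbPotential_stability hp hs hρ).2.1 _ (le_max_right q 2)).rpow_const
    (p := (max q 2)⁻¹) (Or.inr (by positivity))
  rw [Real.zero_rpow (by positivity)] at h1
  refine squeeze_zero (fun n => lpNorm_nonneg) (fun n => ?_) h1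
  rw [← lpNorm_rpow ht0 (hm n), Real.rpow_rpow_inv lpNorm_nonneg ht0.ne']
  exact lpNorm_mono_exponent (ENNReal.ofReal_le_ofReal (le_max_left q 2)) (hm n)

lemma WeakLpTendsto.tendsto_potentialEnergy (hp : 1 < p) (h : WeakLpTendsto p ρs ρ)
    (hs : ∀ n, MemLpPlus p (ρs n)) (hρ : MemLpPlus p ρ) :
    Tendsto (fun n => potentialEnergy (ρs n)) atTop (𝓝 (potentialEnergy ρ)) := by
  have h1 := fun n => ((hs n).regularPB hp).solves.2.1
  have h2 := (hρ.regularPB hp).solves.2.1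
  simp_rw [potentialEnergy_eq]
  exact (tendsto_integral_inner_weakGrad h1 h2 (h.pbPotential_stability hp hs hρ).1).2.const_mul _

/-- The entropy is weakly continuous: the potentials converge strongly, `e^Φ` converges weakly. -/
lemma WeakLpTendsto.tendsto_electronEntropy (hp : 1 < p) (h : WeakLpTendsto p ρs ρ)
    (hs : ∀ n, MemLpPlus p (ρs n)) (hρ : MemLpPlus p ρ) :
    Tendsto (fun n => electronEntropy (ρs n)) atTop (𝓝 (electronEntropy ρ)) := by
  have hpq := Real.HolderConjugate.conjExponent hp
  obtain ⟨M, hM⟩ := h.exists_integral_rpow_le hp hs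
  have hp0 : 0 < p := by linarith
  have hr := fun n => (hs n).regularPB hp
  have hr0 := hρ.regularPB hp
  have hM0 : 0 ≤ M := by
    refine (integral_nonneg_of_ae ?_).trans (hM 0)
    filter_upwards [(hs 0).2.1] with x hx
    exact Real.rpow_nonneg hx p
  have hexp : ∀ n, lpNorm (fun x => Real.exp (pbPotential (ρs n) x)) (ENNReal.ofReal p) volume
      ≤ M ^ p⁻¹ := fun n => by
    rw [Real.le_rpow_inv_iff_of_pos lpNorm_nonneg hM0 hp0, lpNorm_rpow hp0 ((hr n).memLp_exp hp)]
    refine le_trans (le_of_eq ?_) ((hr n).integral_exp_le.trans (hM n))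
    congr 1; ext x
    rw [Real.abs_exp, ← Real.exp_mul, mul_comm]
  have hu : ∀ n, MemLp (fun x => pbPotential (ρs n) x - pbPotential ρ x)
      (ENNReal.ofReal p.conjExponent) := fun n =>
    ((hr n).memLp_potential hp hpq.symm.pos).sub (hr0.memLp_potential hp hpq.symm.pos)
  have hw : MemLp (fun x => pbPotential ρ x - 1) (ENNReal.ofReal p.conjExponent) :=
    (hr0.memLp_potential hp hpq.symm.pos).sub (memLp_const 1)
  have h1 : Tendsto (fun n => ∫ x, Real.exp (pbPotential (ρs n) x)
      * (pbPotential (ρs n) x - pbPotential ρ x)) atTop (𝓝 0) := by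
    have h2 := (h.tendsto_lpNorm_pbPotential_sub hp hs hρ hpq.symm.pos).const_mul (M ^ p⁻¹)
    rw [mul_zero] at h2
    refine squeeze_zero_norm (fun n => ?_) h2
    refine (abs_integral_mul_le hpq ((hr n).memLp_exp hp) (hu n)).trans ?_
    exact mul_le_mul_of_nonneg_right (hexp n) lpNorm_nonneg
  have h2 := h.tendsto_integral_exp_sub_mul hp hs hρ hw
  -- `e^{Φₙ} (Φₙ - 1) - e^Φ (Φ - 1) = e^{Φₙ} (Φₙ - Φ) + (e^{Φₙ} - e^Φ) (Φ - 1)`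
  have h3 := (h1.add h2).add_const (electronEntropy ρ)
  rw [zero_add, zero_add] at h3
  refine h3.congr fun n => ?_
  have i1 := integrable_mul_of_holder hpq ((hr n).memLp_exp hp) (hu n)
  have i2 : Integrable fun x => (Real.exp (pbPotential (ρs n) x) - Real.exp (pbPotential ρ x))
      * (pbPotential ρ x - 1) :=
    integrable_mul_of_holder hpq (((hr n).memLp_exp hp).sub (hr0.memLp_exp hp)) hw
  unfold electronEntropy
  rw [← integral_add i1 i2]
  refine (integral_add (i1.add i2) (integrable_entropyDensity hp hr0)).symm.trans ?_
  congr 1; ext x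
  simp only [entropyDensity, Pi.add_apply]
  ring

end WeakConvergence

/-- The moment bounds as bounds for Lebesgue norms. -/
lemma eLpNorm_exp_le {r : ℝ} (hr : 1 ≤ r) {ρ Φ : Torus d → ℝ} (hρ : MemLp ρ (ENNReal.ofReal r))
    (hρ0 : ∀ᵐ x, 0 ≤ ρ x) (hΦ : AEStronglyMeasurable Φ)
    (hi : Integrable fun x => Real.exp (r * Φ x))
    (hle : ∫ x, Real.exp (r * Φ x) ≤ ∫ x, ρ x ^ r) :
    MemLp (fun x => Real.exp (Φ x)) (ENNReal.ofReal r) ∧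
      eLpNorm (fun x => Real.exp (Φ x)) (ENNReal.ofReal r) volume
        ≤ eLpNorm ρ (ENNReal.ofReal r) volume := by
  have hr0 : 0 < r := by linarith
  have hne : ENNReal.ofReal r ≠ 0 := by simpa using hr0
  have e : ∀ x, ‖Real.exp (Φ x)‖ ^ r = Real.exp (r * Φ x) := fun x => by
    rw [Real.norm_of_nonneg (Real.exp_pos _).le, ← Real.exp_mul, mul_comm]
  have hm : MemLp (fun x => Real.exp (Φ x)) (ENNReal.ofReal r) := by
    rw [← integrable_norm_rpow_iff (Real.continuous_exp.comp_aestronglyMeasurable hΦ) hne (by simp),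
      ENNReal.toReal_ofReal hr0.le]
    simpa only [e] using hi
  refine ⟨hm, ?_⟩
  rw [hm.eLpNorm_eq_integral_rpow_norm hne (by simp),
      hρ.eLpNorm_eq_integral_rpow_norm hne (by simp),
    ENNReal.toReal_ofReal hr0.le]
  simp_rw [e]
  apply ENNReal.ofReal_le_ofReal
  refine Real.rpow_le_rpow (integral_nonneg fun x => (Real.exp_pos _).le) (hle.trans (le_of_eq ?_))
    (by positivity)
  apply integral_congr_ae
  filter_upwards [hρ0] with x hx
  rw [Real.norm_of_nonneg hx]

end

theorem theorem1p1 (d : ℕ) (hd : 2 ≤ d) (p : ℝ) (hp : 1 < p) :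
    -- existence and uniqueness in `W^{1,2}`
    (∀ ρ : Torus d → ℝ, MemLpPlus p ρ →
      IsPBSolution ρ (pbPotential ρ) ∧
        ∀ Ψ : Torus d → ℝ, IsPBSolution ρ Ψ → Ψ =ᵐ[volume] pbPotential ρ) ∧
    -- (i) electron density bounds and neutrality
    (∀ ρ : Torus d → ℝ, MemLpPlus p ρ →
      (∀ r : ℝ, 1 ≤ r → r ≤ p →
        MemLp (fun x => Real.exp (pbPotential ρ x)) (ENNReal.ofReal r) volume ∧
        eLpNorm (fun x => Real.exp (pbPotential ρ x)) (ENNReal.ofReal r) volume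
          ≤ eLpNorm ρ (ENNReal.ofReal r) volume) ∧
      eLpNorm (fun x => Real.exp (pbPotential ρ x)) 1 volume = eLpNorm ρ 1 volume) ∧
    -- (ii) weak stability
    (∀ (ρs : ℕ → Torus d → ℝ) (ρ : Torus d → ℝ),
      (∀ n, MemLpPlus p (ρs n)) → MemLpPlus p ρ → WeakLpTendsto p ρs ρ →
        WeakLpTendsto 2 (fun n => weakGrad (pbPotential (ρs n))) (weakGrad (pbPotential ρ)) ∧
        WeakLpTendsto p (fun n x => Real.exp (pbPotential (ρs n) x))
          (fun x => Real.exp (pbPotential ρ x))) ∧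
    -- (iii) uniform lower bound and integrability of the potential
    ((∃ c : ℝ → ℝ → ℝ, (∀ a b, 0 < c a b) ∧
      ∀ ρ : Torus d → ℝ, MemLpPlus p ρ →
        ∀ᵐ x, c (lpNorm ρ (ENNReal.ofReal p) volume) (lpNorm ρ 1 volume)
          ≤ Real.exp (pbPotential ρ x)) ∧
      ∀ ρ : Torus d → ℝ, MemLpPlus p ρ → ∀ q : ℝ, 1 ≤ q →
        MemLp (pbPotential ρ) (ENNReal.ofReal q) volume) ∧
    -- (iv) strong stability; the arguments of `lam` and `Lam` are the `L¹` norms of `ρ₁`, `ρ₂`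
    -- followed by their `L^p` norms
    (∀ q : ℝ, 1 ≤ q →
      ∃ lam Lam : ℝ → ℝ → ℝ → ℝ → ℝ,
        (∀ a₁ a₂ b₁ b₂, 0 < lam a₁ a₂ b₁ b₂ ∧ 0 < Lam a₁ a₂ b₁ b₂) ∧
        ∀ ρ₁ ρ₂ : Torus d → ℝ, MemLpPlus p ρ₁ → MemLpPlus p ρ₂ →
          lpNorm (weakGrad (pbPotential ρ₁) - weakGrad (pbPotential ρ₂)) 2 volume ^ 2
            + lam (lpNorm ρ₁ 1 volume) (lpNorm ρ₂ 1 volume)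
                (lpNorm ρ₁ (ENNReal.ofReal p) volume) (lpNorm ρ₂ (ENNReal.ofReal p) volume)
              * lpNorm (pbPotential ρ₁ - pbPotential ρ₂) (ENNReal.ofReal q) volume
                  ^ (2 * q / min q 2)
          ≤ Lam (lpNorm ρ₁ 1 volume) (lpNorm ρ₂ 1 volume)
                (lpNorm ρ₁ (ENNReal.ofReal p) volume) (lpNorm ρ₂ (ENNReal.ofReal p) volume)
              * lpNorm (ρ₁ - ρ₂) (ENNReal.ofReal p) volume ^ (2 * p / max p 2)) ∧
    -- (v) the energy functionals are finite on `L^p_+`, ...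
    (∀ ρ : Torus d → ℝ, MemLpPlus p ρ →
      Integrable (fun x => (1 / 2 : ℝ) * ‖weakGrad (pbPotential ρ) x‖ ^ 2) ∧
      Integrable (entropyDensity ρ)) ∧
    -- ... continuous under strong convergence, ...
    (∀ (ρs : ℕ → Torus d → ℝ) (ρ : Torus d → ℝ),
      (∀ n, MemLpPlus p (ρs n)) → MemLpPlus p ρ → StrongLpTendsto p ρs ρ →
        Tendsto (fun n => potentialEnergy (ρs n)) atTop (𝓝 (potentialEnergy ρ)) ∧
        Tendsto (fun n => electronEntropy (ρs n)) atTop (𝓝 (electronEntropy ρ))) ∧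
    -- ... and lower semicontinuous under weak convergence
    (∀ (ρs : ℕ → Torus d → ℝ) (ρ : Torus d → ℝ),
      (∀ n, MemLpPlus p (ρs n)) → MemLpPlus p ρ → WeakLpTendsto p ρs ρ →
        (potentialEnergy ρ : EReal)
          ≤ liminf (fun n => (potentialEnergy (ρs n) : EReal)) atTop ∧
        (electronEntropy ρ : EReal)
          ≤ liminf (fun n => (electronEntropy (ρs n) : EReal)) atTop) := by
  refine ⟨fun ρ hρ => ?_, fun ρ hρ => ⟨fun r hr hrp => ?_, ?_⟩, fun ρs ρ hs hρ hw => ⟨?_, ?_⟩,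
    ⟨?_, fun ρ hρ q hq => (hρ.regularPB hp).memLp_potential hp (by linarith)⟩, fun q hq => ?_,
    fun ρ hρ => ⟨?_, integrable_entropyDensity hp (hρ.regularPB hp)⟩, fun ρs ρ hs hρ hw => ?_,
    fun ρs ρ hs hρ hw => ⟨?_, ?_⟩⟩
  · have hi := hρ.integrable hp
    have hr := hρ.regularPB hp
    exact ⟨(isPBSolution_iff hi).2 hr.solves, fun Ψ hΨ =>
      ((isPBSolution_iff hi).1 hΨ).unique hr.solves hi⟩
  · have hr' := hρ.regularPB_and_moments hp
    exact eLpNorm_exp_le hr (hρ.1.mono_exponent (ENNReal.ofReal_le_ofReal hrp)) hρ.2.1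
      hr'.1.aestronglyMeasurable (hr'.2 r hr hrp).1 (hr'.2 r hr hrp).2
  · have hr := hρ.regularPB hp
    have hi := hρ.integrable hp
    rw [eLpNorm_one_eq_lintegral_enorm, eLpNorm_one_eq_lintegral_enorm,
      ← ofReal_integral_norm_eq_lintegral_enorm hr.solves.1,
      ← ofReal_integral_norm_eq_lintegral_enorm hi]
    simp_rw [Real.norm_eq_abs, Real.abs_exp]
    rw [hr.solves.integral_eq hi]
    congr 1
    apply integral_congr_ae
    filter_upwards [hρ.2.1] with x hx
    rw [abs_of_nonneg hx]
  · have h1 := fun n => ((hs n).regularPB hp).solves.2.1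
    have h2 := (hρ.regularPB hp).solves.2.1
    refine ⟨fun n => by simpa using (h1 n).isL2WeakGrad.1, by simpa using h2.isL2WeakGrad.1,
      fun g hg => ?_⟩
    have e : (2 : ℝ) / (2 - 1) = 2 := by norm_num
    exact (tendsto_integral_inner_weakGrad h1 h2 (hw.pbPotential_stability hp hs hρ).1).1 g
      (by simpa [e] using hg)
  · refine ⟨fun n => ((hs n).regularPB hp).memLp_exp hp, (hρ.regularPB hp).memLp_exp hp,
      fun g hg => ?_⟩
    have h1 := (hw.tendsto_integral_exp_sub_mul hp hs hρ hg).add_const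
      (∫ x, Real.exp (pbPotential ρ x) * g x)
    rw [zero_add] at h1
    simp only [RCLike.inner_apply, conj_trivial, mul_comm (g _)]
    refine h1.congr fun n => ?_
    have hpq := Real.HolderConjugate.conjExponent hp
    have i1 := integrable_mul_of_holder hpq (((hs n).regularPB hp).memLp_exp hp) hg
    have i2 := integrable_mul_of_holder hpq ((hρ.regularPB hp).memLp_exp hp) hg
    simp_rw [sub_mul]
    rw [integral_sub i1 i2, sub_add_cancel]
  · refine ⟨fun b a => Real.exp (-potentialBound d hp a b), fun _ _ => Real.exp_pos _,
      fun ρ hρ => ?_⟩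
    filter_upwards [(hρ.regularPB hp).lower] with x hx
    exact Real.exp_le_exp.2 hx
  -- the constants for the larger of the two lower bounds
  · choose l L hl hL h using exists_strong_stability (d := d) hp hq
    refine ⟨fun a₁ a₂ b₁ b₂ => l (max (potentialBound d hp a₁ b₁) (potentialBound d hp a₂ b₂)),
      fun a₁ a₂ b₁ b₂ => L (max (potentialBound d hp a₁ b₁) (potentialBound d hp a₂ b₂)),
      fun _ _ _ _ => ⟨hl _, hL _⟩, fun ρ₁ ρ₂ h₁ h₂ => ?_⟩
    rw [energy_eq_lpNorm_sq (h₁.regularPB hp).solves.2.1 (h₂.regularPB hp).solves.2.1]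
    exact h _ _ _ _ _ ((h₁.regularPB hp).mono (le_max_left _ _))
      ((h₂.regularPB hp).mono (le_max_right _ _))
  · have h := (hρ.regularPB hp).solves.2.1.isL2WeakGrad.1
    exact (h.integrable_norm_pow (by norm_num)).const_mul _
  · have hw' := hw.weakLpTendsto hp
    exact ⟨hw'.tendsto_potentialEnergy hp hs hρ, hw'.tendsto_electronEntropy hp hs hρ⟩
  · exact ((continuous_coe_real_ereal.tendsto _).comp
      (hw.tendsto_potentialEnergy hp hs hρ)).liminf_eq.ge
  · exact ((continuous_coe_real_ereal.tendsto _).comp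
      (hw.tendsto_electronEntropy hp hs hρ)).liminf_eq.ge
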